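/- Let $G$ be a compact Lie group with Lie algebra $\mathfrak g$, let $H\subset G$ be a closed subgroup with Lie algebra $\mathfrak h$, and let $\langle\cdot,\cdot\rangle$ be an $\mathrm{Ad}_G$-invariant scalar product on $\mathfrak g$. Let $\mathfrak v$ be the orthogonal complement of $\mathfrak h$ in $\mathfrak g$, and let $\mathbb R[\mathfrak v]^H$ be the algebra of $\mathrm{Ad}_H$-invariant real polynomials on $\mathfrak v$, with the Poisson bracket $$\{f,g\}_{\mathfrak v}(v)=-\langle v,[\nabla f(v),\nabla g(v)]\rangle ,$$ where $\nabla$ is the gradient on $\mathfrak v$ with respect to $\langle\cdot,\cdot\rangle$. For a subalgebra $\mathcal F\subset\mathbb R[\mathfrak v]^H$, let $\mathrm{ddim}\,\mathcal F$ be the maximal number $l$ of functions $f_1,\dots,f_l\in\mathcal F$ that are independent at a generic point $v\in\mathfrak v$ (one in a suitable open dense set), and let $\mathrm{dind}\,\mathcal F$ be the corank of the matrix $(\{f_i,f_j\}_{\mathfrak v}(v))_{i,j\le l}$ at such a point. A subalgebra $\mathcal B\subset\mathbb R[\mathfrak v]^H$ is commutative if $\{f,g\}_{\mathfrak v}=0$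 for all $f,g\in\mathcal B$, and complete if $$\mathrm{ddim}\,\mathcal B+\mathrm{dind}\,\mathcal B=\mathrm{ddim}\,\mathbb R[\mathfrak v]^H+\mathrm{dind}\,\mathbb R[\mathfrak v]^H .$$ The pair $(G,H)$ is called integrable if, for every $\mathrm{Ad}_G$-invariant scalar product on $\mathfrak g$, the algebra $\mathbb R[\mathfrak v]^H$ has a complete commutative subalgebra. **Theorem.** The following are integrable pairs, for all non-negative integers satisfying the stated inequalities: 1. $(SO(n),\,SO(k_1)\times SO(k_2))$, $k_1+k_2\le n$; 2. $(U(n),\,U(1)^{k_1}\times U(k_2)\times U(k_3))$, $k_1+k_2+k_3\le n$; 3. $(U(n),\,SO(k))$, $k\le n$; 4. $(SO(n_1)\times SO(n_2),\,SO(k))$, $k\le n_1,n_2$; 5. $(U(n_1)\times U(n_2),\,U(k))$, $k\le n_1,n_2$. In 1–3 the subgroups are embedded naturally as block-diagonal matrices, completed by an identity block ($U(1)^{k_1}$ being the diagonal unitary matrices of size $k_1$, and $SO(k)\subset U(k)$ the real matrices). In 4 and 5 the subgroup is embedded diagonally, by $P\mapsto(\mathrm{diag}(P,1),\mathrm{diag}(P,1))$.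 -/

import Mathlib

open scoped Matrix

noncomputable section

namespace IntegrablePairs

/-! ### Lie algebras, invariant scalar products and the orthogonal complement -/

section General

variable {A : Type*} [Ring A] [TopologicalSpace A] [IsTopologicalRing A]
  [Algebra ℝ A]

/-- The Lie algebra `{X | exp (t X) ∈ G for all real t}` of a group `G` of invertible elements of
the finite-dimensional real algebra `A` (a matrix algebra, or a product of two matrix algebras).
For a closed subgroup `G` this set is already a real vector space, so that taking the linear span
adds nothing. -/
def lieAlg (G : Subgroup Aˣ) : Submodule ℝ A :=
  Submodule.span ℝ {X : A | ∀ t : ℝ, ∃ u ∈ G, (u : A) = NormedSpace.exp (t • X)}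

/-- `B` is an `Ad_G`-invariant scalar product on the Lie algebra of `G`. The bilinear form is given
on all of `A`, but only its values on the Lie algebra matter; every bilinear form on the Lie
algebra extends to `A`. -/
structure IsInvariantScalarProduct (G : Subgroup Aˣ) (B : LinearMap.BilinForm ℝ A) : Prop where
  symm : ∀ x ∈ lieAlg G, ∀ y ∈ lieAlg G, B x y = B y x
  pos : ∀ x ∈ lieAlg G, x ≠ 0 → 0 < B x x
  invariant : ∀ u ∈ G, ∀ x ∈ lieAlg G, ∀ y ∈ lieAlg G,
    B (u * x * (u⁻¹ : Aˣ)) (u * y * (u⁻¹ : Aˣ)) = B x y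

/-- The orthogonal complement `𝔳` of the Lie algebra of `H` in the Lie algebra of `G`. -/
def complement (G H : Subgroup Aˣ) (B : LinearMap.BilinForm ℝ A) : Submodule ℝ A where
  carrier := {x | x ∈ lieAlg G ∧ ∀ y ∈ lieAlg H, B x y = 0}
  zero_mem' := ⟨zero_mem _, fun y _ => by simp⟩
  add_mem' := fun hx hy => ⟨add_mem hx.1 hy.1, fun z hz => by simp [hx.2 z hz, hy.2 z hz]⟩
  smul_mem' := fun c _ hx => ⟨Submodule.smul_mem _ c hx.1, fun z hz => by simp [hx.2 z hz]⟩

/-! ### Invariant polynomials and their Poisson bracket -/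

/-- The algebra `ℝ[V]` of polynomial functions on a real vector space `V`: the algebra of functions
generated by the linear ones. -/
def polynomialFunctions (V : Type*) [AddCommGroup V] [Module ℝ V] : Subalgebra ℝ (V → ℝ) :=
  Algebra.adjoin ℝ (Set.range fun l : V →ₗ[ℝ] ℝ => (l : V → ℝ))

/-- The algebra `ℝ[V]^H` of polynomial functions `f` on `V` with `f (Ad_h x) = f x` for all `h` in
`H` and `x` in `V`. (The group `H` preserves `V` in all uses below.) -/
def invariantPolynomials (H : Subgroup Aˣ) (V : Submodule ℝ A) : Subalgebra ℝ (V → ℝ) where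
  carrier := {f | f ∈ polynomialFunctions V ∧
    ∀ h ∈ H, ∀ x y : V, (y : A) = h * x * (h⁻¹ : Aˣ) → f y = f x}
  mul_mem' := fun hf hg => ⟨mul_mem hf.1 hg.1, fun h hh x y e => by
    simp [hf.2 h hh x y e, hg.2 h hh x y e]⟩
  add_mem' := fun hf hg => ⟨add_mem hf.1 hg.1, fun h hh x y e => by
    simp [hf.2 h hh x y e, hg.2 h hh x y e]⟩
  algebraMap_mem' := fun r => ⟨Subalgebra.algebraMap_mem _ r, fun _ _ _ _ _ => rfl⟩

/-- The gradient of `f : V → ℝ` at `x`: the vector `u` of `V` with `B u w = df_x(w)` for all `w` in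
`V`. It exists and is unique when `B` is positive definite on the finite-dimensional space `V` and
`f` is differentiable, in particular for all polynomial functions. -/
def grad (B : LinearMap.BilinForm ℝ A) {V : Submodule ℝ A} (f : V → ℝ) (x : V) : V :=
  Classical.epsilon fun u : V => ∀ w : V, B u w = lineDeriv ℝ f x w

/-- The bracket `{f, g}(x) = -⟨x, [∇f(x), ∇g(x)]⟩`. -/
def bracket (B : LinearMap.BilinForm ℝ A) {V : Submodule ℝ A} (f g : V → ℝ) (x : V) : ℝ :=
  -B x ⁅(grad B f x : A), (grad B g x : A)⁆

/-! ### Differential dimension, differential index and completeness -/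

/-- The number of functions in `F` that are independent at `x`: the dimension of the span of the
differentials at `x` of the members of `F`. -/
def differentialRank {V : Submodule ℝ A} (F : Subalgebra ℝ (V → ℝ)) (x : V) : ℕ :=
  Module.finrank ℝ
    (Submodule.span ℝ (Set.range fun (f : F) (w : V) => lineDeriv ℝ (f : V → ℝ) x w))

/-- The rank at `x` of the (possibly infinite) matrix of the brackets `{f, g}(x)` with `f`, `g` in
`F`: the dimension of the span of its rows. The bracket at `x` depends on the differentials at `x`
only, so this is also the rank of the matrix `{f_i, f_j}(x)` for any members `f_1, …, f_l` of `F`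
whose differentials form a basis of the span of all the differentials at `x`. -/
def bracketRank (B : LinearMap.BilinForm ℝ A) {V : Submodule ℝ A} (F : Subalgebra ℝ (V → ℝ))
    (x : V) : ℕ :=
  Module.finrank ℝ (Submodule.span ℝ (Set.range fun f g : F => bracket B (f : V → ℝ) g x))

/-- `ddim F = l` and `dind F = r`: at a generic point `x`, that is, on an open dense set, there are
exactly `l` independent functions in `F`, and the matrix of their brackets at `x` has corank `r`. -/
def HasDimIndex (B : LinearMap.BilinForm ℝ A) {V : Submodule ℝ A} (F : Subalgebra ℝ (V → ℝ))
    (l r : ℕ) : Prop :=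
  ∃ U : Set V, IsOpen U ∧ Dense U ∧
    ∀ x ∈ U, differentialRank F x = l ∧ bracketRank B F x + r = l

/-- `C` is complete in `F`: `ddim C + dind C = ddim F + dind F`. -/
def IsCompleteIn (B : LinearMap.BilinForm ℝ A) {V : Submodule ℝ A}
    (C F : Subalgebra ℝ (V → ℝ)) : Prop :=
  ∃ l r l' r' : ℕ, HasDimIndex B C l r ∧ HasDimIndex B F l' r' ∧ l + r = l' + r'

/-- `(G, H)` is an integrable pair: `H` is a subgroup of `G`, and, for every choice of an
`Ad_G`-invariant scalar product on the Lie algebra of `G`, the algebra `ℝ[𝔳]^H` has a subalgebra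
that is commutative with respect to the bracket and complete. -/
def IsIntegrablePair (G H : Subgroup Aˣ) : Prop :=
  H ≤ G ∧ ∀ B : LinearMap.BilinForm ℝ A, IsInvariantScalarProduct G B →
    ∃ C : Subalgebra ℝ (complement G H B → ℝ),
      C ≤ invariantPolynomials H (complement G H B) ∧
      (∀ f ∈ C, ∀ g ∈ C, ∀ x, bracket B f g x = 0) ∧
      IsCompleteIn B C (invariantPolynomials H (complement G H B))

end General

/-! ### The classical groups and block embeddings -/

/-- Square matrices of size `n`. -/
abbrev Mat (n : ℕ) (R : Type*) : Type _ := Matrix (Fin n) (Fin n) R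

/-- `SO(n)`. -/
abbrev SO (n : ℕ) : Submonoid (Mat n ℝ) := Matrix.specialOrthogonalGroup (Fin n) ℝ

/-- `U(n)`. -/
abbrev U (n : ℕ) : Submonoid (Mat n ℂ) := Matrix.unitaryGroup (Fin n) ℂ

/-- `U(1)^n`, as the group of diagonal unitary matrices of size `n`. -/
def torus (n : ℕ) : Submonoid (Mat n ℂ) :=
  (Submonoid.pi Set.univ fun _ : Fin n => unitary ℂ).map (Matrix.diagonalRingHom (Fin n) ℂ)

/-- The block matrix `diag(P, Q)` of size `a + b`. -/
def blockHom (R : Type*) [CommRing R] (a b : ℕ) : Mat a R × Mat b R →* Mat (a + b) R where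
  toFun M := Matrix.reindex finSumFinEquiv finSumFinEquiv (Matrix.fromBlocks M.1 0 0 M.2)
  map_one' := by simp [Matrix.fromBlocks_one]
  map_mul' M N := by
    simp [Matrix.submatrix_mul_equiv, Matrix.fromBlocks_multiply]

/-- The block matrix `diag(P, 1)` of size `n`, for `P` of size `k ≤ n`. -/
def padHom (R : Type*) [CommRing R] {k n : ℕ} (h : k ≤ n) : Mat k R →* Mat n R where
  toFun P := Matrix.reindex (finCongr (Nat.add_sub_of_le h)) (finCongr (Nat.add_sub_of_le h))
    (blockHom R k (n - k) (P, 1))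
  map_one' := by
    rw [← Prod.one_eq_mk, map_one]
    simp
  map_mul' P Q := by
    have e : (P * Q, (1 : Mat (n - k) R)) = (P, 1) * (Q, 1) := by simp
    rw [e, map_mul]
    simp [Matrix.submatrix_mul_equiv]

/-- A real matrix as a complex one. -/
def complexify (n : ℕ) : Mat n ℝ →* Mat n ℂ := (Complex.ofRealHom.mapMatrix).toMonoidHom

/-- `SO(k₁) × SO(k₂)` in `SO(n)`: the matrices `diag(P, Q, 1)`. -/
def SOBlocks {k₁ k₂ n : ℕ} (h : k₁ + k₂ ≤ n) : Submonoid (Mat n ℝ) :=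
  (((SO k₁).prod (SO k₂)).map (blockHom ℝ k₁ k₂)).map (padHom ℝ h)

/-- `U(1)^{k₁} × U(k₂) × U(k₃)` in `U(n)`: the matrices `diag(D, P, Q, 1)` with `D` diagonal. -/
def UBlocks {k₁ k₂ k₃ n : ℕ} (h : k₁ + k₂ + k₃ ≤ n) : Submonoid (Mat n ℂ) :=
  (((((torus k₁).prod (U k₂)).map (blockHom ℂ k₁ k₂)).prod (U k₃)).map
    (blockHom ℂ (k₁ + k₂) k₃)).map (padHom ℂ h)

/-- `SO(k)` in `U(n)`: the matrices `diag(P, 1)` with `P` real. -/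
def SOinU {k n : ℕ} (h : k ≤ n) : Submonoid (Mat n ℂ) :=
  ((SO k).map (complexify k)).map (padHom ℂ h)

/-- The diagonal embedding `P ↦ (diag(P, 1), diag(P, 1))`. -/
def diagHom (R : Type*) [CommRing R] {k n₁ n₂ : ℕ} (h₁ : k ≤ n₁) (h₂ : k ≤ n₂) :
    Mat k R →* Mat n₁ R × Mat n₂ R :=
  (padHom R h₁).prod (padHom R h₂)

end IntegrablePairs

end

/-!
The proof constructs commuting invariants as traces of powers of diagonal blocks and verifies
completeness at a single point by the chain method.

*One point and one scalar product suffice.* Write `𝔤` and `𝔥` for the Lie algebras of `G` and `H`.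
Suppose that commuting `H`-invariant polynomials have the following property at one point `y₀` of
the complement of `𝔥`: the sum of `𝔥` and the span of their gradients contains its own orthogonal
space for the skew form `⟨y₀, [·, ·]⟩` on `𝔤`. This is an inequality between ranks of matrices that
depend polynomially on the point, so by semicontinuity (`exists_generic_rank`) it holds at a generic
point, where it says that the gradients form a Lagrangian subspace of the gradients of all
invariants; counting dimensions gives completeness. An automorphism of the vector space `𝔤` that
commutes with the adjoint action carries one invariant scalar product to another one, hence the
property needs to be verified only for the trace form. This is `isIntegrablePair_of_lagrangian`.

*The polynomials.* Fix a chain of index sets that starts with a set `S` and grows by one index at a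
time (`chainSet`), and take the functions `tracePow`, the traces of the powers of the diagonal
blocks of a matrix `x` on these sets. The gradient `blockPow` of such a function is a power of a
block. It commutes with that block, hence is orthogonal, for the form `⟨x, [·, ·]⟩`, to all matrices
supported on the block, and so the functions commute.

*The chain method.* A subspace is called coisotropic if it contains its orthogonal space for the form
`⟨x, [·, ·]⟩`. A coisotropic subspace of the skew-Hermitian matrices on one index set yields one for
the next index set by adding the powers of the next block, provided that the step is multiplicity
free at `x` (`IsCoisotropicIn.sup`). Adding one index is multiplicity free at a matrix whose block on
the larger set is the block `A` on the smaller one bordered by a vector with nonzero components in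
an orthonormal basis of eigenvectors of `A` (`HasBordering.exists_isMultiplicityFree`, with
`hasBordering_complex` and `hasBordering_real`). As the border is free at every step, any block on `S` extends to a matrix at
which all steps are multiplicity free (`HasBordering.exists_chain`).

*The start of the chain.* It remains to find a suitable block on `S`, orthogonal to `𝔥`, such that
its powers and `𝔥` span a coisotropic subspace. For two diagonal blocks this is an off-diagonal
matrix with distinct singular values (`exists_sub_mem_powSpan_of_orthogonal`); the indices of a torus
are kept outside `S`, where diagonal matrices commute with all projections onto coordinate
subspaces. For the real matrices among the complex ones it is a diagonal matrix with distinct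
imaginary entries (`mem_sup_powSpan_of_orthogonal_real`). For the diagonal embedding, with one chain
in each factor, it is `(a, -a)` for a matrix `a` with a cyclic vector (`isCoisotropicIn_diagonal`).
-/

namespace IntegrablePairs

/-! ### Polynomial functions and their differentials -/

section PolynomialFunctions

variable {V : Type*} [AddCommGroup V] [Module ℝ V]

theorem linear_mem_polynomialFunctions (l : V →ₗ[ℝ] ℝ) :
    (fun x => l x) ∈ polynomialFunctions V :=
  Algebra.subset_adjoin ⟨l, rfl⟩

theorem const_mem_polynomialFunctions (r : ℝ) : (fun _ => r) ∈ polynomialFunctions V :=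
  Subalgebra.algebraMap_mem _ r

theorem comp_linear_mem_polynomialFunctions {W : Type*} [AddCommGroup W] [Module ℝ W]
    {f : W → ℝ} (hf : f ∈ polynomialFunctions W) (φ : V →ₗ[ℝ] W) :
    (fun x => f (φ x)) ∈ polynomialFunctions V := by
  induction hf using Algebra.adjoin_induction with
  | mem f hf =>
    obtain ⟨l, rfl⟩ := hf
    exact linear_mem_polynomialFunctions (l ∘ₗ φ)
  | algebraMap r => exact const_mem_polynomialFunctions r
  | add f g _ _ hf hg => exact add_mem hf hg
  | mul f g _ _ hf hg => exact mul_mem hf hg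

/-- A polynomial function has a linear differential at every point, which computes its derivative
along every curve. No topology on `V` is involved: a curve is differentiable when all its
coordinates are. -/
theorem exists_differential {f : V → ℝ} (hf : f ∈ polynomialFunctions V) (x : V) :
    ∃ D : V →ₗ[ℝ] ℝ, ∀ (γ : ℝ → V) (v : V), γ 0 = x →
      (∀ l : V →ₗ[ℝ] ℝ, HasDerivAt (fun t => l (γ t)) (l v) 0) →
        HasDerivAt (fun t => f (γ t)) (D v) 0 := by
  induction hf using Algebra.adjoin_induction with
  | mem f hf =>
    obtain ⟨l, rfl⟩ := hf
    exact ⟨l, fun γ v _ h => h l⟩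
  | algebraMap r =>
    exact ⟨0, fun γ v _ _ => hasDerivAt_const (0 : ℝ) r⟩
  | add f g _ _ hf hg =>
    obtain ⟨D, hD⟩ := hf
    obtain ⟨E, hE⟩ := hg
    exact ⟨D + E, fun γ v h0 h => (hD γ v h0 h).add (hE γ v h0 h)⟩
  | mul f g _ _ hf hg =>
    obtain ⟨D, hD⟩ := hf
    obtain ⟨E, hE⟩ := hg
    refine ⟨g x • D + f x • E, fun γ v h0 h => ?_⟩
    have := (hD γ v h0 h).mul (hE γ v h0 h)
    rw [h0] at this
    refine (show HasDerivAt (fun t => (f * g) (γ t)) _ 0 from this).congr_deriv ?_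
    change _ = g x * D v + f x * E v
    ring

theorem hasDerivAt_line (l : V →ₗ[ℝ] ℝ) (x v : V) :
    HasDerivAt (fun t : ℝ => l (x + t • v)) (l v) 0 := by
  have : (fun t : ℝ => l (x + t • v)) = fun t => l x + t * l v := by
    ext t; simp
  rw [this]
  simpa using ((hasDerivAt_id (0 : ℝ)).mul_const (l v)).const_add (l x)

/-- The differential of `exists_differential` is the line derivative used in the gradient. -/
theorem exists_lineDeriv {f : V → ℝ} (hf : f ∈ polynomialFunctions V) (x : V) :
    ∃ D : V →ₗ[ℝ] ℝ, (∀ v, lineDeriv ℝ f x v = D v) ∧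
      (∀ v, HasDerivAt (fun t : ℝ => f (x + t • v)) (D v) 0) ∧
      ∀ (γ : ℝ → V) (v : V), γ 0 = x →
      (∀ l : V →ₗ[ℝ] ℝ, HasDerivAt (fun t => l (γ t)) (l v) 0) →
        HasDerivAt (fun t => f (γ t)) (D v) 0 := by
  obtain ⟨D, hD⟩ := exists_differential hf x
  have h (v : V) := hD (fun t => x + t • v) v (by simp) fun l => hasDerivAt_line l x v
  exact ⟨D, fun v => (h v).deriv, h, hD⟩

theorem lineDeriv_mul {f g : V → ℝ} (hf : f ∈ polynomialFunctions V)
    (hg : g ∈ polynomialFunctions V) (x v : V) :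
    lineDeriv ℝ (f * g) x v = g x * lineDeriv ℝ f x v + f x * lineDeriv ℝ g x v := by
  obtain ⟨D, hD, hD', -⟩ := exists_lineDeriv hf x
  obtain ⟨E, hE, hE', -⟩ := exists_lineDeriv hg x
  have := (hD' v).mul (hE' v)
  rw [hD, hE]
  refine (show HasDerivAt (fun t : ℝ => (f * g) (x + t • v)) _ 0 from this).deriv.trans ?_
  simp; ring

theorem lineDeriv_add {f g : V → ℝ} (hf : f ∈ polynomialFunctions V)
    (hg : g ∈ polynomialFunctions V) (x v : V) :
    lineDeriv ℝ (f + g) x v = lineDeriv ℝ f x v + lineDeriv ℝ g x v := by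
  obtain ⟨D, hD, hD', -⟩ := exists_lineDeriv hf x
  obtain ⟨E, hE, hE', -⟩ := exists_lineDeriv hg x
  rw [hD, hE]
  exact (show HasDerivAt (fun t : ℝ => (f + g) (x + t • v)) _ 0 from (hD' v).add (hE' v)).deriv

theorem lineDeriv_algebraMap (r : ℝ) (x v : V) :
    lineDeriv ℝ (algebraMap ℝ (V → ℝ) r) x v = 0 :=
  (hasDerivAt_const (0 : ℝ) r).deriv

theorem lineDeriv_mem_polynomialFunctions {f : V → ℝ} (hf : f ∈ polynomialFunctions V) (v : V) :
    (fun x => lineDeriv ℝ f x v) ∈ polynomialFunctions V := by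
  induction hf using Algebra.adjoin_induction with
  | mem f hf =>
    obtain ⟨l, rfl⟩ := hf
    convert const_mem_polynomialFunctions (V := V) (l v) using 2 with x
    exact (hasDerivAt_line l x v).deriv
  | algebraMap r =>
    simp only [lineDeriv_algebraMap]
    exact const_mem_polynomialFunctions 0
  | add f g hf' hg' hf hg =>
    simp only [lineDeriv_add hf' hg']
    exact add_mem hf hg
  | mul f g hf' hg' hf hg =>
    simp only [lineDeriv_mul hf' hg']
    exact add_mem (mul_mem hg' hf) (mul_mem hf' hg)

theorem exists_polynomial_on_line {f : V → ℝ} (hf : f ∈ polynomialFunctions V) (x v : V) :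
    ∃ p : Polynomial ℝ, ∀ t : ℝ, f (x + t • v) = p.eval t := by
  induction hf using Algebra.adjoin_induction with
  | mem f hf =>
    obtain ⟨l, rfl⟩ := hf
    refine ⟨.C (l x) + .C (l v) * .X, fun t => ?_⟩
    change l (x + t • v) = _
    simp only [map_add, map_smul, smul_eq_mul, Polynomial.eval_add, Polynomial.eval_mul,
      Polynomial.eval_C, Polynomial.eval_X]
    ring
  | algebraMap r => exact ⟨.C r, fun t => Polynomial.eval_C.symm⟩
  | add f g _ _ hf hg =>
    obtain ⟨p, hp⟩ := hf
    obtain ⟨q, hq⟩ := hg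
    exact ⟨p + q, fun t => by simp [hp, hq]⟩
  | mul f g _ _ hf hg =>
    obtain ⟨p, hp⟩ := hf
    obtain ⟨q, hq⟩ := hg
    exact ⟨p * q, fun t => by simp [hp, hq]⟩

/-- A nonzero polynomial function is nonzero on a dense set: on the line from any point to a point
where it does not vanish it is a nonzero polynomial, which has finitely many roots. -/
theorem dense_ne_zero [TopologicalSpace V] [IsTopologicalAddGroup V] [ContinuousSMul ℝ V]
    {f : V → ℝ} (hf : f ∈ polynomialFunctions V) {x₀ : V} (h₀ : f x₀ ≠ 0) :
    Dense {x | f x ≠ 0} := by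
  intro x
  obtain ⟨p, hp⟩ := exists_polynomial_on_line hf x (x₀ - x)
  have hp0 : p ≠ 0 := by
    rintro rfl
    have := hp 1
    simp at this
    exact h₀ this
  have hev : ∀ᶠ t in nhdsWithin (0 : ℝ) {0}ᶜ, f (x + t • (x₀ - x)) ≠ 0 := by
    have hfin : ((p.roots.toFinset : Set ℝ) \ {0}).Finite := (Finset.finite_toSet _).subset
      Set.sdiff_subset
    have : ∀ᶠ t in nhds (0 : ℝ), t ∉ (p.roots.toFinset : Set ℝ) \ {0} :=
      hfin.isClosed.isOpen_compl.mem_nhds (by simp)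
    filter_upwards [nhdsWithin_le_nhds this, self_mem_nhdsWithin] with t ht ht0 hft
    rw [hp] at hft
    exact ht ⟨by simp [hp0, hft], ht0⟩
  refine mem_closure_of_tendsto (f := fun t : ℝ => x + t • (x₀ - x)) (b := nhdsWithin 0 {0}ᶜ) ?_ hev
  have hc : Continuous fun t : ℝ => x + t • (x₀ - x) := by fun_prop
  have := hc.tendsto 0
  simp only [zero_smul, add_zero] at this
  exact this.mono_left nhdsWithin_le_nhds

theorem continuous_of_mem_polynomialFunctions [TopologicalSpace V] [IsTopologicalAddGroup V]
    [ContinuousSMul ℝ V] [T2Space V] [FiniteDimensional ℝ V] {f : V → ℝ}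
    (hf : f ∈ polynomialFunctions V) : Continuous f := by
  induction hf using Algebra.adjoin_induction with
  | mem f hf =>
    obtain ⟨l, rfl⟩ := hf
    exact l.continuous_of_finiteDimensional
  | algebraMap r => exact continuous_const
  | add f g _ _ hf hg => exact hf.add hg
  | mul f g _ _ hf hg => exact hf.mul hg

end PolynomialFunctions

/-! ### Generic ranks -/

section GenericRank

/-- A nonzero minor of maximal size: `l` linearly independent functions on `J` stay independent on
suitable `l` points of `J`. -/
theorem exists_det_ne_zero {J : Type*} {l : ℕ} (v : Fin l → J → ℝ) (hv : LinearIndependent ℝ v) :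
    ∃ w : Fin l → J, (Matrix.of fun a b => v a (w b)).det ≠ 0 := by
  let col : J → Fin l → ℝ := fun j a => v a j
  have hspan : Submodule.span ℝ (Set.range col) = ⊤ := by
    by_contra hne
    obtain ⟨z, hz⟩ : ∃ z, z ∉ Submodule.span ℝ (Set.range col) := by
      by_contra! h
      exact hne (Submodule.eq_top_iff'.2 h)
    obtain ⟨f, hfz, hf⟩ := Submodule.exists_le_ker_of_notMem hz
    have hf' (j : J) : f (col j) = 0 := hf (Submodule.subset_span ⟨j, rfl⟩)
    have hsum (u : Fin l → ℝ) : f u = ∑ a, f (Pi.single a 1) * u a := by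
      conv_lhs => rw [pi_eq_sum_univ' u]
      simp [mul_comm]
    have hrel : ∑ a, f (Pi.single a 1) • v a = 0 := by
      ext j
      have := hf' j
      rw [hsum] at this
      simpa using this
    have := Fintype.linearIndependent_iff.1 hv _ hrel
    apply hfz
    rw [hsum]
    simp [this]
  have hfr : Module.finrank ℝ (Submodule.span ℝ (Set.range col)) = l := by
    rw [hspan]; simp
  obtain ⟨g, hg, -, hgi⟩ := Submodule.exists_fun_fin_finrank_span_eq ℝ (Set.range col)
  choose w hw using hg
  refine ⟨fun b => w (Fin.cast hfr.symm b), ?_⟩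
  have hi : LinearIndependent ℝ (fun b : Fin l => g (Fin.cast hfr.symm b)) :=
    hgi.comp _ (Fin.cast_injective _)
  have : IsUnit (Matrix.of fun b => g (Fin.cast hfr.symm b)) :=
    Matrix.linearIndependent_rows_iff_isUnit.1 hi
  rw [← Matrix.det_transpose]
  rw [Matrix.isUnit_iff_isUnit_det] at this
  convert this.ne_zero using 2
  ext b a
  simp only [Matrix.transpose_apply, Matrix.of_apply, ← hw, col]

/-- The rank of a matrix of polynomial functions takes its maximal value on an open dense set. -/
theorem exists_generic_rank {V : Type*} [AddCommGroup V] [Module ℝ V] [TopologicalSpace V]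
    [IsTopologicalAddGroup V] [ContinuousSMul ℝ V] [T2Space V] [FiniteDimensional ℝ V]
    {I J : Type*} (Φ : V → I → J → ℝ)
    (hΦ : ∀ i j, (fun x => Φ x i j) ∈ polynomialFunctions V) (N : ℕ)
    (hfin : ∀ x, FiniteDimensional ℝ (Submodule.span ℝ (Set.range (Φ x))))
    (hN : ∀ x, Module.finrank ℝ (Submodule.span ℝ (Set.range (Φ x))) ≤ N) :
    ∃ l, (∀ x, Module.finrank ℝ (Submodule.span ℝ (Set.range (Φ x))) ≤ l) ∧
      ∃ U : Set V, IsOpen U ∧ Dense U ∧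
        ∀ x ∈ U, Module.finrank ℝ (Submodule.span ℝ (Set.range (Φ x))) = l := by
  set r : V → ℕ := fun x => Module.finrank ℝ (Submodule.span ℝ (Set.range (Φ x))) with hr
  obtain ⟨x₀, hx₀⟩ : ∃ x₀, ∀ x, r x ≤ r x₀ := by
    have : (Set.range r).Finite := (Set.finite_Iic N).subset (by rintro _ ⟨x, rfl⟩; exact hN x)
    obtain ⟨_, ⟨x₀, rfl⟩, h⟩ := Set.exists_max_image (Set.range r) id this ⟨r 0, 0, rfl⟩
    exact ⟨x₀, fun x => h _ ⟨x, rfl⟩⟩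
  refine ⟨r x₀, hx₀, ?_⟩
  have := hfin x₀
  obtain ⟨g, hg, -, hgi⟩ := Submodule.exists_fun_fin_finrank_span_eq ℝ (Set.range (Φ x₀))
  choose s hs using hg
  obtain ⟨w, hw⟩ := exists_det_ne_zero g hgi
  let q : V → ℝ := fun x => (Matrix.of fun a b => Φ x (s a) (w b)).det
  have hq : q ∈ polynomialFunctions V := by
    have : q = ∑ σ : Equiv.Perm _, (Equiv.Perm.sign σ : ℝ) •
        ∏ a, (fun x => Φ x (s (σ a)) (w a)) := by
      ext x
      simp [q, Matrix.det_apply']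
    rw [this]
    exact sum_mem fun σ _ => Subalgebra.smul_mem _ (prod_mem fun a _ => hΦ _ _) _
  have hq0 : q x₀ ≠ 0 := by
    simpa only [q, hs] using hw
  refine ⟨{x | q x ≠ 0}, ?_, dense_ne_zero hq hq0, fun x hx => le_antisymm (hx₀ x) ?_⟩
  · exact isOpen_ne_fun (continuous_of_mem_polynomialFunctions hq) continuous_const
  have hli : LinearIndependent ℝ (fun a => Φ x (s a)) := by
    have h1 : LinearIndependent ℝ (Matrix.of fun a b => Φ x (s a) (w b)).row :=
      Matrix.linearIndependent_rows_iff_isUnit.2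
        ((Matrix.isUnit_iff_isUnit_det _).2 (isUnit_iff_ne_zero.2 hx))
    exact LinearIndependent.of_comp (LinearMap.funLeft ℝ ℝ w) h1
  have := hfin x
  have h2 : LinearIndependent ℝ (fun a => (⟨Φ x (s a), Submodule.subset_span ⟨s a, rfl⟩⟩ :
      Submodule.span ℝ (Set.range (Φ x)))) :=
    LinearIndependent.of_comp (Submodule.subtype _) hli
  simpa using h2.fintype_card_le_finrank

end GenericRank

/-! ### Lagrangian subspaces of a skew form -/

section Lagrangian

variable {X : Type*} [AddCommGroup X] [Module ℝ X] [FiniteDimensional ℝ X]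

/-- A subspace `M` that contains its own orthogonal space has at least half the dimension of the
space and the radical together; `lagrangian_of_finrank` is a converse for isotropic subspaces. In
this form the condition depends only on ranks, which are semicontinuous. -/
theorem finrank_of_lagrangian {β : LinearMap.BilinForm ℝ X} (hβ : β.IsRefl) {M : Submodule ℝ X}
    (hM : ∀ ξ, (∀ η ∈ M, β η ξ = 0) → ξ ∈ M) :
    2 * Module.finrank ℝ X ≤ 2 * Module.finrank ℝ M + Module.finrank ℝ (LinearMap.range β) := by
  have h1 := LinearMap.BilinForm.finrank_add_finrank_orthogonal hβ M
  have h2 : Module.finrank ℝ (β.orthogonal M) ≤ Module.finrank ℝ M :=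
    Submodule.finrank_mono fun ξ hξ => hM ξ hξ
  have h3 := LinearMap.finrank_range_add_finrank_ker β
  have h4 : M ⊓ β.orthogonal ⊤ = LinearMap.ker β := by
    rw [LinearMap.BilinForm.orthogonal_top_eq_ker hβ]
    refine inf_eq_right.2 fun ξ hξ => hM ξ fun η _ => hβ _ _ ?_
    rw [LinearMap.mem_ker.1 hξ]; rfl
  rw [h4] at h1
  omega

theorem lagrangian_of_finrank {β : LinearMap.BilinForm ℝ X} (hβ : β.IsRefl) {M : Submodule ℝ X}
    (hiso : ∀ ξ ∈ M, ∀ η ∈ M, β η ξ = 0)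
    (hdim : 2 * Module.finrank ℝ X ≤
      2 * Module.finrank ℝ M + Module.finrank ℝ (LinearMap.range β)) :
    ∀ ξ, (∀ η ∈ M, β η ξ = 0) → ξ ∈ M := by
  have h1 := LinearMap.BilinForm.finrank_add_finrank_orthogonal hβ M
  have hle : M ≤ β.orthogonal M := fun ξ hξ η hη => hiso ξ hξ η hη
  have h3 := LinearMap.finrank_range_add_finrank_ker β
  have h4 : Module.finrank ℝ ↥(M ⊓ β.orthogonal ⊤) ≤ Module.finrank ℝ (LinearMap.ker β) := by
    rw [LinearMap.BilinForm.orthogonal_top_eq_ker hβ]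
    exact Submodule.finrank_mono inf_le_right
  have := Submodule.eq_of_le_of_finrank_le hle (by omega)
  intro ξ hξ
  rw [this]
  exact hξ

theorem finrank_eq_of_lagrangian {β : LinearMap.BilinForm ℝ X} (hβ : β.IsRefl) {M : Submodule ℝ X}
    (hiso : ∀ ξ ∈ M, ∀ η ∈ M, β η ξ = 0)
    (hM : ∀ ξ, (∀ η ∈ M, β η ξ = 0) → ξ ∈ M) :
    2 * Module.finrank ℝ X = 2 * Module.finrank ℝ M + Module.finrank ℝ (LinearMap.range β) := by
  have h1 := LinearMap.BilinForm.finrank_add_finrank_orthogonal hβ M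
  have h2 : β.orthogonal M = M :=
    le_antisymm (fun ξ hξ => hM ξ hξ) fun ξ hξ η hη => hiso ξ hξ η hη
  have h3 := LinearMap.finrank_range_add_finrank_ker β
  have h4 : M ⊓ β.orthogonal ⊤ = LinearMap.ker β := by
    rw [LinearMap.BilinForm.orthogonal_top_eq_ker hβ]
    refine inf_eq_right.2 fun ξ hξ => hM ξ fun η _ => hβ _ _ ?_
    rw [LinearMap.mem_ker.1 hξ]; rfl
  rw [h4, h2] at h1
  omega

/-- The form of `finrank_eq_of_lagrangian` for a subspace `L` of `W` that is its own orthogonal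
space within `W`. -/
theorem finrank_eq_of_lagrangian_of_le {β : LinearMap.BilinForm ℝ X} (hβ : β.IsRefl)
    {L W : Submodule ℝ X} (hLW : L ≤ W) (hiso : ∀ ξ ∈ L, ∀ η ∈ L, β η ξ = 0)
    (hL : ∀ ξ ∈ W, (∀ η ∈ L, β η ξ = 0) → ξ ∈ L) :
    2 * Module.finrank ℝ W =
      2 * Module.finrank ℝ L + Module.finrank ℝ (LinearMap.range (β.domRestrict₁₂ W W)) := by
  let γ : LinearMap.BilinForm ℝ W := β.domRestrict₁₂ W W
  have hγ : γ.IsRefl := fun ξ η h => hβ _ _ h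
  rw [← LinearEquiv.finrank_eq (Submodule.comapSubtypeEquivOfLe hLW)]
  exact finrank_eq_of_lagrangian hγ (fun ξ hξ η hη => hiso ξ hξ η hη)
    fun ξ hξ => hL ξ ξ.2 fun η hη => hξ ⟨η, hLW hη⟩ hη

theorem finrank_range_domRestrict_le (β : LinearMap.BilinForm ℝ X) (W : Submodule ℝ X) :
    Module.finrank ℝ (LinearMap.range (β.domRestrict₁₂ W W)) ≤ Module.finrank ℝ W :=
  LinearMap.finrank_range_le _

end Lagrangian

/-! ### The commutator bracket of an algebra -/

section Commutator

variable {A : Type*} [Ring A]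

/-- Additivity of the commutator. The commutator of a ring is a bracket without a global instance of
`LieRing`, so that its laws are stated for the bare bracket here and in the next lemmas. -/
theorem ring_add_lie (x y z : A) : ⁅x + y, z⁆ = ⁅x, z⁆ + ⁅y, z⁆ := by
  simp only [Ring.lie_def]; noncomm_ring

theorem ring_lie_add (x y z : A) : ⁅x, y + z⁆ = ⁅x, y⁆ + ⁅x, z⁆ := by
  simp only [Ring.lie_def]; noncomm_ring

theorem ring_lie_skew (x y : A) : -⁅y, x⁆ = ⁅x, y⁆ := by
  simp only [Ring.lie_def]; noncomm_ring

@[simp]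
theorem ring_zero_lie (x : A) : ⁅(0 : A), x⁆ = 0 := by simp [Ring.lie_def]

@[simp]
theorem ring_lie_zero (x : A) : ⁅x, (0 : A)⁆ = 0 := by simp [Ring.lie_def]

theorem ring_smul_lie [Algebra ℝ A] (c : ℝ) (x y : A) : ⁅c • x, y⁆ = c • ⁅x, y⁆ := by
  simp [Ring.lie_def, smul_sub]

theorem ring_lie_smul [Algebra ℝ A] (c : ℝ) (x y : A) : ⁅x, c • y⁆ = c • ⁅x, y⁆ := by
  simp [Ring.lie_def, smul_sub]

end Commutator

/-! ### The Lie algebra of a matrix group -/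

section LieAlgebra

variable {A : Type*} [NormedRing A] [NormedAlgebra ℝ A] {G H : Subgroup Aˣ}

theorem lieAlg_mono (h : H ≤ G) : lieAlg H ≤ lieAlg G :=
  Submodule.span_mono fun _ hX t => let ⟨u, hu, e⟩ := hX t; ⟨u, h hu, e⟩

variable [FiniteDimensional ℝ A]

theorem hasDerivAt_conj_exp (η z : A) (l : A →ₗ[ℝ] ℝ) :
    HasDerivAt (fun t : ℝ => l (NormedSpace.exp (t • η) * z * NormedSpace.exp (-(t • η))))
      (l ⁅η, z⁆) 0 := by
  have : CompleteSpace A := FiniteDimensional.complete ℝ A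
  have h1 := hasDerivAt_exp_smul_const (𝕂 := ℝ) η (0 : ℝ)
  have h2 := hasDerivAt_exp_smul_const (𝕂 := ℝ) (-η) (0 : ℝ)
  have h3 := (h1.mul_const z).mul h2
  have h4 := (LinearMap.toContinuousLinearMap l).hasFDerivAt.comp_hasDerivAt (0 : ℝ) h3
  simp only [smul_neg] at h4
  refine (show HasDerivAt _ _ (0 : ℝ) from h4).congr_deriv ?_
  simp [Ring.lie_def, sub_eq_add_neg]

theorem coe_inv_of_coe_eq_exp {u : Aˣ} {X : A} (hu : (u : A) = NormedSpace.exp X) :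
    ((u⁻¹ : Aˣ) : A) = NormedSpace.exp (-X) := by
  have : CompleteSpace A := FiniteDimensional.complete ℝ A
  let _ : NormedAlgebra ℚ A := NormedAlgebra.restrictScalars ℚ ℝ A
  refine Units.inv_eq_of_mul_eq_one_right ?_
  rw [hu, ← NormedSpace.exp_add_of_commute (Commute.refl X).neg_right]
  simp

theorem conj_mem_lieAlg {u : Aˣ} (hu : u ∈ G) {X : A} (hX : X ∈ lieAlg G) :
    u * X * (u⁻¹ : Aˣ) ∈ lieAlg G := by
  have : CompleteSpace A := FiniteDimensional.complete ℝ A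
  let _ : NormedAlgebra ℚ A := NormedAlgebra.restrictScalars ℚ ℝ A
  induction hX using Submodule.span_induction with
  | mem X hX =>
    refine Submodule.subset_span fun t => ?_
    obtain ⟨v, hv, e⟩ := hX t
    refine ⟨u * v * u⁻¹, mul_mem (mul_mem hu hv) (inv_mem hu), ?_⟩
    have : t • ((u : A) * X * (u⁻¹ : Aˣ)) = u * (t • X) * (u⁻¹ : Aˣ) := by simp
    rw [this, NormedSpace.exp_units_conj, ← e]
    simp
  | zero => simp
  | add x y _ _ hx hy => rw [mul_add, add_mul]; exact add_mem hx hy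
  | smul c x _ hx => rw [mul_smul_comm, smul_mul_assoc]; exact Submodule.smul_mem _ c hx

/-- Differentiating an invariance under conjugation along one-parameter subgroups. -/
theorem apply_lie_eq_zero {l : A →ₗ[ℝ] ℝ} {z : A}
    (h : ∀ u ∈ H, l (u * z * (u⁻¹ : Aˣ)) = l z) {η : A} (hη : η ∈ lieAlg H) : l ⁅η, z⁆ = 0 := by
  induction hη using Submodule.span_induction with
  | mem η hη =>
    refine (hasDerivAt_conj_exp η z l).unique ?_
    convert hasDerivAt_const (0 : ℝ) (l z) using 2 with t
    obtain ⟨u, hu, e⟩ := hη t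
    rw [← h u hu, e, coe_inv_of_coe_eq_exp e]
  | zero => simp
  | add x y _ _ hx hy => rw [ring_add_lie, map_add, hx, hy, add_zero]
  | smul c x _ hx => rw [ring_smul_lie, map_smul, hx, smul_zero]

/-- A subspace that contains the orbit of `z` under conjugation contains its tangent vectors: every
linear functional that vanishes on the subspace vanishes on them by `apply_lie_eq_zero`. -/
theorem lie_mem_of_conj_mem {V : Submodule ℝ A} {z : A}
    (h : ∀ u ∈ H, u * z * (u⁻¹ : Aˣ) ∈ V) {η : A} (hη : η ∈ lieAlg H) : ⁅η, z⁆ ∈ V := by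
  by_contra hn
  obtain ⟨l, hl, hV⟩ := Submodule.exists_le_ker_of_notMem hn
  refine hl (apply_lie_eq_zero (fun u hu => ?_) hη)
  have h1 : z ∈ V := by simpa using h 1 (one_mem H)
  rw [LinearMap.mem_ker.1 (hV (h u hu)), LinearMap.mem_ker.1 (hV h1)]

theorem lie_mem_lieAlg {X Y : A} (hX : X ∈ lieAlg G) (hY : Y ∈ lieAlg G) : ⁅X, Y⁆ ∈ lieAlg G :=
  lie_mem_of_conj_mem (fun _ hu => conj_mem_lieAlg hu hY) hX

/-- Infinitesimal form of the invariance of a scalar product. -/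
theorem IsInvariantScalarProduct.lie {B : LinearMap.BilinForm ℝ A}
    (hB : IsInvariantScalarProduct G B) {η x y : A} (hη : η ∈ lieAlg G) (hx : x ∈ lieAlg G)
    (hy : y ∈ lieAlg G) : B ⁅η, x⁆ y = B x ⁅y, η⁆ := by
  have key : B.flip y ⁅η, x⁆ + B x ⁅η, y⁆ = 0 := by
    induction hη using Submodule.span_induction with
    | mem η hη =>
      have h1 := hasDerivAt_conj_exp η x (B.flip y)
      have h2 := hasDerivAt_conj_exp (-η) y (B x)
      have e : (fun t : ℝ => B.flip y (NormedSpace.exp (t • η) * x * NormedSpace.exp (-(t • η))))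
          = fun t : ℝ => B x (NormedSpace.exp (t • -η) * y * NormedSpace.exp (-(t • -η))) := by
        ext t
        obtain ⟨u, hu, e⟩ := hη t
        have e' := coe_inv_of_coe_eq_exp e
        have hy' := conj_mem_lieAlg (inv_mem hu) hy
        have := hB.invariant u hu x hx _ hy'
        rw [smul_neg, neg_neg, ← e, ← e']
        change B _ y = _
        rw [inv_inv] at this
        rw [← this]
        congr 1
        simp [mul_assoc]
      rw [e] at h1
      have := h1.unique h2
      rw [this, ← map_add, ← ring_add_lie, neg_add_cancel, ring_zero_lie, map_zero]
    | zero => rw [ring_zero_lie, ring_zero_lie, map_zero, map_zero, add_zero]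
    | add a b _ _ ha hb =>
      rw [ring_add_lie, ring_add_lie, map_add, map_add, add_add_add_comm, ha, hb, add_zero]
    | smul c a _ ha =>
      rw [ring_smul_lie, ring_smul_lie, map_smul, map_smul, ← smul_add, ha, smul_zero]
  change B _ y + _ = 0 at key
  rw [← ring_lie_skew y η, map_neg]
  linarith

theorem conj_mem_complement {B : LinearMap.BilinForm ℝ A} (hB : IsInvariantScalarProduct G B)
    (hHG : H ≤ G) {u : Aˣ} (hu : u ∈ H) {x : A} (hx : x ∈ complement G H B) :
    u * x * (u⁻¹ : Aˣ) ∈ complement G H B := by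
  refine ⟨conj_mem_lieAlg (hHG hu) hx.1, fun y hy => ?_⟩
  have hy' := conj_mem_lieAlg (inv_mem hu) hy
  have := hB.invariant u (hHG hu) x hx.1 _ (lieAlg_mono hHG hy')
  rw [hx.2 _ hy'] at this
  rw [← this]
  congr 1
  simp [mul_assoc]

/-- The differential of an `Ad_H`-invariant polynomial vanishes on the tangent space of the
`H`-orbit. -/
theorem lineDeriv_lie_eq_zero {B : LinearMap.BilinForm ℝ A} (hB : IsInvariantScalarProduct G B)
    (hHG : H ≤ G) {f : complement G H B → ℝ}
    (hf : f ∈ invariantPolynomials H (complement G H B)) (x : complement G H B) {η : A}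
    (hη : η ∈ lieAlg H) (hm : ⁅η, (x : A)⁆ ∈ complement G H B) :
    lineDeriv ℝ f x ⟨⁅η, (x : A)⁆, hm⟩ = 0 := by
  obtain ⟨D, hD, -, hγ⟩ := exists_lineDeriv hf.1 x
  obtain ⟨l, hl⟩ := LinearMap.exists_extend D
  have hl' (v : complement G H B) : l v = D v := LinearMap.congr_fun hl v
  rw [hD, ← hl']
  change l ⁅η, (x : A)⁆ = 0
  clear hm
  induction hη using Submodule.span_induction with
  | mem η hη =>
    have hmem (t : ℝ) : NormedSpace.exp (t • η) * (x : A) * NormedSpace.exp (-(t • η)) ∈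
        complement G H B := by
      obtain ⟨u, hu, e⟩ := hη t
      rw [← e, ← coe_inv_of_coe_eq_exp e]
      exact conj_mem_complement hB hHG hu x.2
    have hm : ⁅η, (x : A)⁆ ∈ complement G H B :=
      lie_mem_of_conj_mem (fun u hu => conj_mem_complement hB hHG hu x.2)
        (Submodule.subset_span hη : η ∈ lieAlg H)
    have := hγ (fun t => ⟨_, hmem t⟩) ⟨_, hm⟩ (by ext; simp) fun k => by
      obtain ⟨k', hk'⟩ := LinearMap.exists_extend k
      have hk (v : complement G H B) : k v = k' v := (LinearMap.congr_fun hk' v).symm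
      simp only [hk]
      exact hasDerivAt_conj_exp η x k'
    rw [show l ⁅η, (x : A)⁆ = D ⟨_, hm⟩ from hl' ⟨_, hm⟩]
    refine this.unique ?_
    convert hasDerivAt_const (0 : ℝ) (f x) using 2 with t
    obtain ⟨u, hu, e⟩ := hη t
    refine hf.2 u hu _ _ ?_
    rw [coe_inv_of_coe_eq_exp e, e]
  | zero => simp
  | add a b _ _ ha hb => rw [ring_add_lie, map_add, ha, hb, add_zero]
  | smul c a _ ha => rw [ring_smul_lie, map_smul, ha, smul_zero]

end LieAlgebra

/-! ### Gradients -/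

section Gradient

variable {A : Type*} [Ring A] [Algebra ℝ A] {B : LinearMap.BilinForm ℝ A} {V : Submodule ℝ A}

/-- The skew form `(ξ, η) ↦ l [i ξ, i η]`. -/
def lieForm {X : Type*} [AddCommMonoid X] [Module ℝ X] (l : A →ₗ[ℝ] ℝ) (i : X →ₗ[ℝ] A) :
    X →ₗ[ℝ] X →ₗ[ℝ] ℝ :=
  LinearMap.mk₂ ℝ (fun ξ η => l ⁅i ξ, i η⁆) (by simp [ring_add_lie])
    (by simp [ring_smul_lie]) (by simp [ring_lie_add]) (by simp [ring_lie_smul])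

@[simp]
theorem lieForm_apply {X : Type*} [AddCommMonoid X] [Module ℝ X] (l : A →ₗ[ℝ] ℝ) (i : X →ₗ[ℝ] A)
    (ξ η : X) : lieForm l i ξ η = l ⁅i ξ, i η⁆ := rfl

theorem lieForm_isRefl {X : Type*} [AddCommMonoid X] [Module ℝ X] (l : A →ₗ[ℝ] ℝ)
    (i : X →ₗ[ℝ] A) : LinearMap.IsRefl (lieForm l i) := fun ξ η h => by
  rw [lieForm_apply] at h ⊢
  rw [← ring_lie_skew, map_neg, h, neg_zero]

/-- The span of the gradients at `x` of the members of `K`. -/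
def gradSpan (B : LinearMap.BilinForm ℝ A) (K : Subalgebra ℝ (V → ℝ)) (x : V) : Submodule ℝ V :=
  Submodule.span ℝ (Set.range fun f : K => grad B (f : V → ℝ) x)

theorem grad_mem_gradSpan {K : Subalgebra ℝ (V → ℝ)} {f : V → ℝ} (hf : f ∈ K) (x : V) :
    grad B f x ∈ gradSpan B K x :=
  Submodule.subset_span ⟨⟨f, hf⟩, rfl⟩

theorem eq_of_forall_bilin_eq (hpos : ∀ x ∈ V, x ≠ 0 → 0 < B x x) {u v : V}
    (h : ∀ w : V, B u w = B v w) : u = v := by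
  by_contra hne
  have h1 : ((u - v : V) : A) ≠ 0 := by
    simpa [sub_eq_zero] using hne
  have h2 := hpos _ (u - v).2 h1
  have h3 := h (u - v)
  have h4 : B (u - v : V) (u - v : V) = B u (u - v : V) - B v (u - v : V) := by
    rw [← LinearMap.sub_apply, ← map_sub]; rfl
  linarith

variable [FiniteDimensional ℝ A]

theorem exists_bilin_eq (hpos : ∀ x ∈ V, x ≠ 0 → 0 < B x x) (D : V →ₗ[ℝ] ℝ) :
    ∃ u : V, ∀ w : V, B u w = D w := by
  let b : V →ₗ[ℝ] Module.Dual ℝ V := B.compl₁₂ V.subtype V.subtype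
  have hinj : Function.Injective b := fun u v h =>
    eq_of_forall_bilin_eq hpos fun w => LinearMap.congr_fun h w
  have hsurj : Function.Surjective b :=
    (LinearMap.injective_iff_surjective_of_finrank_eq_finrank Subspace.dual_finrank_eq.symm).1 hinj
  obtain ⟨u, hu⟩ := hsurj D
  exact ⟨u, fun w => LinearMap.congr_fun hu w⟩

theorem bilin_grad (hpos : ∀ x ∈ V, x ≠ 0 → 0 < B x x) {f : V → ℝ}
    (hf : f ∈ polynomialFunctions V) (x w : V) : B (grad B f x) w = lineDeriv ℝ f x w := by
  obtain ⟨D, hD, -, -⟩ := exists_lineDeriv hf x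
  have : ∃ u : V, ∀ w : V, B u w = lineDeriv ℝ f x w := by
    simpa only [hD] using exists_bilin_eq hpos D
  exact Classical.epsilon_spec this w

theorem gradSpan_adjoin_le (hpos : ∀ x ∈ V, x ≠ 0 → 0 < B x x) {s : Set (V → ℝ)}
    (hs : s ⊆ polynomialFunctions V) {x : V} {W : Submodule ℝ V}
    (hW : ∀ f ∈ s, grad B f x ∈ W) : gradSpan B (Algebra.adjoin ℝ s) x ≤ W := by
  have hle : Algebra.adjoin ℝ s ≤ polynomialFunctions V := Algebra.adjoin_le hs
  refine Submodule.span_le.2 ?_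
  rintro _ ⟨⟨f, hf⟩, rfl⟩
  change grad B f x ∈ W
  induction hf using Algebra.adjoin_induction with
  | mem f hf => exact hW f hf
  | algebraMap r =>
    have : grad B (algebraMap ℝ (V → ℝ) r) x = 0 := eq_of_forall_bilin_eq hpos fun w => by
      rw [bilin_grad hpos (Subalgebra.algebraMap_mem _ r), lineDeriv_algebraMap]; simp
    rw [this]
    exact zero_mem _
  | add f g hf' hg' hf hg =>
    have : grad B (f + g) x = grad B f x + grad B g x := eq_of_forall_bilin_eq hpos fun w => by
      rw [bilin_grad hpos (add_mem (hle hf') (hle hg')), lineDeriv_add (hle hf') (hle hg'),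
        Submodule.coe_add, map_add, LinearMap.add_apply, bilin_grad hpos (hle hf'),
        bilin_grad hpos (hle hg')]
    rw [this]
    exact add_mem hf hg
  | mul f g hf' hg' hf hg =>
    have : grad B (f * g) x = g x • grad B f x + f x • grad B g x :=
      eq_of_forall_bilin_eq hpos fun w => by
        rw [bilin_grad hpos (mul_mem (hle hf') (hle hg')), lineDeriv_mul (hle hf') (hle hg'),
          Submodule.coe_add, map_add, LinearMap.add_apply, Submodule.coe_smul, Submodule.coe_smul,
          map_smul, map_smul, LinearMap.smul_apply, LinearMap.smul_apply, bilin_grad hpos (hle hf'),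
          bilin_grad hpos (hle hg'), smul_eq_mul, smul_eq_mul]
    rw [this]
    exact add_mem (W.smul_mem _ hf) (W.smul_mem _ hg)

theorem differentialRank_eq (hpos : ∀ x ∈ V, x ≠ 0 → 0 < B x x) {K : Subalgebra ℝ (V → ℝ)}
    (hK : K ≤ polynomialFunctions V) (x : V) :
    differentialRank K x = Module.finrank ℝ (gradSpan B K x) := by
  let b : V →ₗ[ℝ] V → ℝ := LinearMap.pi fun w => B.flip w ∘ₗ V.subtype
  have hinj : Function.Injective b := fun u v h =>
    eq_of_forall_bilin_eq hpos fun w => congr_fun h w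
  have : Submodule.span ℝ (Set.range fun (f : K) (w : V) => lineDeriv ℝ (f : V → ℝ) x w) =
      (gradSpan B K x).map b := by
    rw [gradSpan, Submodule.map_span, ← Set.range_comp]
    congr 2
    ext f w
    exact (bilin_grad hpos (hK f.2) x w).symm
  rw [differentialRank, this]
  exact (LinearEquiv.finrank_eq (Submodule.equivMapOfInjective b hinj _)).symm

theorem finrank_range_eq_of_ker_eq {X Y Z : Type*} [AddCommGroup X] [Module ℝ X]
    [FiniteDimensional ℝ X] [AddCommGroup Y] [Module ℝ Y] [AddCommGroup Z] [Module ℝ Z]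
    (f : X →ₗ[ℝ] Y) (g : X →ₗ[ℝ] Z) (h : LinearMap.ker f = LinearMap.ker g) :
    Module.finrank ℝ (LinearMap.range f) = Module.finrank ℝ (LinearMap.range g) := by
  have h1 := LinearMap.finrank_range_add_finrank_ker f
  have h2 := LinearMap.finrank_range_add_finrank_ker g
  rw [h] at h1
  omega

/-- The rank of a matrix of brackets is the rank of the skew form on the span. -/
theorem finrank_span_neg_eq {X ι : Type*} [AddCommGroup X] [Module ℝ X] [FiniteDimensional ℝ X]
    (β : X →ₗ[ℝ] X →ₗ[ℝ] ℝ) (u : ι → X) :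
    Module.finrank ℝ (Submodule.span ℝ (Set.range fun i j => -β (u i) (u j))) =
      Module.finrank ℝ (LinearMap.range (β.domRestrict₁₂ (Submodule.span ℝ (Set.range u))
        (Submodule.span ℝ (Set.range u)))) := by
  let R : X →ₗ[ℝ] ι → ℝ := LinearMap.pi fun j => -β.flip (u j)
  have h1 : Submodule.span ℝ (Set.range fun i j => -β (u i) (u j)) =
      LinearMap.range (R ∘ₗ (Submodule.span ℝ (Set.range u)).subtype) := by
    rw [LinearMap.range_comp, Submodule.range_subtype, Submodule.map_span, ← Set.range_comp]
    rfl
  rw [h1]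
  refine finrank_range_eq_of_ker_eq _ _ ?_
  ext v
  simp only [LinearMap.mem_ker]
  constructor
  · intro h
    ext ⟨w, hw⟩
    change β v w = 0
    induction hw using Submodule.span_induction with
    | mem w hw =>
      obtain ⟨j, rfl⟩ := hw
      exact neg_eq_zero.1 (congr_fun h j)
    | zero => simp
    | add a b _ _ ha hb => rw [map_add, ha, hb, add_zero]
    | smul c a _ ha => rw [map_smul, ha, smul_zero]
  · intro h
    ext j
    exact neg_eq_zero.2 (LinearMap.congr_fun h ⟨_, Submodule.subset_span ⟨j, rfl⟩⟩)

theorem bracketRank_eq (K : Subalgebra ℝ (V → ℝ)) (x : V) :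
    bracketRank B K x = Module.finrank ℝ
      (LinearMap.range ((lieForm (B x) V.subtype).domRestrict₁₂
        (gradSpan B K x) (gradSpan B K x))) :=
  finrank_span_neg_eq (lieForm (B x) V.subtype) fun f : K => grad B (f : V → ℝ) x

end Gradient

/-! ### A criterion for integrability -/

section Criterion

variable {A : Type*} [NormedRing A] [NormedAlgebra ℝ A] {G H : Subgroup Aˣ}
  {B T : LinearMap.BilinForm ℝ A}

theorem complement_pos (hB : IsInvariantScalarProduct G B) :
    ∀ x ∈ complement G H B, x ≠ 0 → 0 < B x x :=
  fun x hx => hB.pos x hx.1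

variable [FiniteDimensional ℝ A]

/-- Two scalar products on the Lie algebra differ by a linear automorphism. -/
theorem exists_linearEquiv_bilin_eq (hT : IsInvariantScalarProduct G T)
    (hB : IsInvariantScalarProduct G B) :
    ∃ φ : lieAlg G ≃ₗ[ℝ] lieAlg G, ∀ x y : lieAlg G, T (φ x) y = B x y := by
  choose φ hφ using fun x : lieAlg G =>
    exists_bilin_eq (V := lieAlg G) hT.pos ((B x).comp (lieAlg G).subtype)
  let Φ : lieAlg G →ₗ[ℝ] lieAlg G :=
    { toFun := φ
      map_add' := fun x y => eq_of_forall_bilin_eq hT.pos fun w => by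
        rw [Submodule.coe_add, map_add, LinearMap.add_apply, hφ, hφ, hφ]
        simp
      map_smul' := fun c x => eq_of_forall_bilin_eq hT.pos fun w => by
        rw [RingHom.id_apply, Submodule.coe_smul, map_smul, LinearMap.smul_apply, hφ, hφ]
        simp }
  have hinj : Function.Injective Φ := fun x y h => eq_of_forall_bilin_eq hB.pos fun w => by
    have hx : T (Φ x) w = B x w := hφ x w
    have hy : T (Φ y) w = B y w := hφ y w
    rw [← hx, ← hy, h]
  exact ⟨LinearEquiv.ofInjectiveEndo Φ hinj, fun x y => hφ x y⟩

theorem mem_lieAlg_of_orthogonal (hB : IsInvariantScalarProduct G B) (hHG : H ≤ G) {z : A}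
    (hz : z ∈ lieAlg G) (h : ∀ w ∈ complement G H B, B z w = 0) : z ∈ lieAlg H := by
  have hle := lieAlg_mono hHG
  obtain ⟨η, hη⟩ := exists_bilin_eq (V := lieAlg H) (fun x hx => hB.pos x (hle hx))
    ((B z).comp (lieAlg H).subtype)
  have hv : z - η ∈ complement G H B := by
    refine ⟨sub_mem hz (hle η.2), fun y hy => ?_⟩
    have := hη ⟨y, hy⟩
    rw [map_sub, LinearMap.sub_apply, this]
    simp
  have h0 : z - η = 0 := by
    by_contra hne
    have h1 := hB.pos _ hv.1 hne
    have h2 : B (z - η) (z - η) = B z (z - η) - B (z - η) η := by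
      rw [hB.symm _ hv.1 _ (hle η.2), map_sub B z, LinearMap.sub_apply]
    rw [h2, h _ hv, hv.2 _ η.2] at h1
    simp at h1
  rw [sub_eq_zero.1 h0]
  exact η.2

/-- The gradient of an `Ad_H`-invariant polynomial at `x` is orthogonal to the Lie algebra of `H`
for the skew form `⟨x, [·, ·]⟩`. -/
theorem bilin_lie_grad (hB : IsInvariantScalarProduct G B) (hHG : H ≤ G)
    {f : complement G H B → ℝ} (hf : f ∈ invariantPolynomials H (complement G H B))
    (x : complement G H B) {η : A} (hη : η ∈ lieAlg H) : B x ⁅(grad B f x : A), η⁆ = 0 := by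
  have hηG := lieAlg_mono hHG hη
  have hm : ⁅η, (x : A)⁆ ∈ complement G H B :=
    lie_mem_of_conj_mem (fun u hu => conj_mem_complement hB hHG hu x.2) hη
  rw [← hB.lie hηG x.2.1 (grad B f x).2.1, hB.symm _ hm.1 _ (grad B f x).2.1]
  have := bilin_grad (complement_pos hB) hf.1 x ⟨_, hm⟩
  rw [lineDeriv_lie_eq_zero hB hHG hf x hη hm] at this
  exact this

theorem bilin_lie_gradSpan (hB : IsInvariantScalarProduct G B) (hHG : H ≤ G)
    {x u : complement G H B} {η : A} (hη : η ∈ lieAlg H)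
    (hu : u ∈ gradSpan B (invariantPolynomials H (complement G H B)) x) :
    B x ⁅(u : A), η⁆ = 0 := by
  induction hu using Submodule.span_induction with
  | mem u hu =>
    obtain ⟨f, rfl⟩ := hu
    exact bilin_lie_grad hB hHG f.2 x hη
  | zero => simp
  | add a b _ _ ha hb => rw [Submodule.coe_add, ring_add_lie, map_add, ha, hb, add_zero]
  | smul c a _ ha => rw [Submodule.coe_smul, ring_smul_lie, map_smul, ha, smul_zero]

theorem bilin_lie_lieAlg (x : complement G H B) {η ζ : A} (hη : η ∈ lieAlg H)
    (hζ : ζ ∈ lieAlg H) : B x ⁅η, ζ⁆ = 0 :=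
  x.2.2 _ (lie_mem_lieAlg hη hζ)

/-- The span, inside the Lie algebra of `G`, of the Lie algebra of `H` and a subspace of the
orthogonal complement. -/
def extendByLieAlg (L : Submodule ℝ (complement G H B)) : Submodule ℝ (lieAlg G) :=
  (lieAlg H ⊔ L.map (complement G H B).subtype).comap (lieAlg G).subtype

theorem finrank_extendByLieAlg (hB : IsInvariantScalarProduct G B) (hHG : H ≤ G)
    (L : Submodule ℝ (complement G H B)) :
    Module.finrank ℝ (extendByLieAlg L) = Module.finrank ℝ (lieAlg H) + Module.finrank ℝ L := by
  have hle : lieAlg H ⊔ L.map (complement G H B).subtype ≤ lieAlg G := by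
    refine sup_le (lieAlg_mono hHG) ?_
    rintro _ ⟨u, -, rfl⟩
    exact u.2.1
  have hdisj : lieAlg H ⊓ L.map (complement G H B).subtype = ⊥ := by
    rw [eq_bot_iff]
    rintro _ ⟨hη, u, -, rfl⟩
    by_contra hne
    have := hB.pos _ u.2.1 hne
    exact this.ne' (u.2.2 _ hη)
  have h1 := Submodule.finrank_sup_add_finrank_inf_eq (lieAlg H)
    (L.map (complement G H B).subtype)
  rw [hdisj, finrank_bot, add_zero, LinearEquiv.finrank_eq
    (Submodule.equivMapOfInjective _ (Submodule.subtype_injective _) L).symm] at h1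
  rw [← h1]
  exact LinearEquiv.finrank_eq (Submodule.comapSubtypeEquivOfLe hle)

/-- The dimension of the span of the gradients is generically constant and maximal. -/
theorem exists_generic_finrank_gradSpan (K : Subalgebra ℝ (complement G H B → ℝ))
    (hpos : ∀ x ∈ complement G H B, x ≠ 0 → 0 < B x x) (hK : K ≤ polynomialFunctions _) :
    ∃ l, (∀ x, Module.finrank ℝ (gradSpan B K x) ≤ l) ∧
      ∃ U : Set (complement G H B), IsOpen U ∧ Dense U ∧
        ∀ x ∈ U, Module.finrank ℝ (gradSpan B K x) = l := by
  have hfin (x : complement G H B) : FiniteDimensional ℝ (Submodule.span ℝ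
      (Set.range fun (f : K) w => lineDeriv ℝ (f : complement G H B → ℝ) x w)) := by
    let b : Module.Dual ℝ (complement G H B) →ₗ[ℝ] (complement G H B → ℝ) := LinearMap.ltoFun ..
    refine Submodule.finiteDimensional_of_le (S₂ := LinearMap.range b) (Submodule.span_le.2 ?_)
    rintro _ ⟨f, rfl⟩
    obtain ⟨D, hD, -, -⟩ := exists_lineDeriv (hK f.2) x
    exact ⟨D, funext fun w => (hD w).symm⟩
  simp only [← differentialRank_eq hpos hK]
  refine exists_generic_rank (fun x (f : K) w => lineDeriv ℝ (f : complement G H B → ℝ) x w)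
    (fun f w => lineDeriv_mem_polynomialFunctions (hK f.2) w)
    (Module.finrank ℝ (complement G H B)) hfin fun x => ?_
  have := differentialRank_eq hpos hK x
  rw [differentialRank] at this
  rw [this]
  exact Submodule.finrank_le _

/-- The rank of the skew form `B x [·, ·]` on the Lie algebra of `G` is generically constant and
maximal, as `x` varies in the complement only. -/
theorem exists_generic_rank_lieForm :
    ∃ r, (∀ x : complement G H B,
        Module.finrank ℝ (LinearMap.range (lieForm (B x) (lieAlg G).subtype)) ≤ r) ∧
      ∃ U : Set (complement G H B), IsOpen U ∧ Dense U ∧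
        ∀ x ∈ U, Module.finrank ℝ (LinearMap.range (lieForm (B x) (lieAlg G).subtype)) = r := by
  have key (x : complement G H B) :
      Submodule.span ℝ (Set.range fun ξ η : lieAlg G => B x ⁅(ξ : A), (η : A)⁆) =
        LinearMap.range (LinearMap.ltoFun ℝ (lieAlg G) ℝ ℝ ∘ₗ
          lieForm (B x) (lieAlg G).subtype) := by
    rw [← Submodule.span_eq (LinearMap.range _), LinearMap.coe_range]
    rfl
  have key' (x : complement G H B) : Module.finrank ℝ (Submodule.span ℝ
      (Set.range fun ξ η : lieAlg G => B x ⁅(ξ : A), (η : A)⁆)) =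
      Module.finrank ℝ (LinearMap.range (lieForm (B x) (lieAlg G).subtype)) := by
    rw [key]
    refine finrank_range_eq_of_ker_eq _ _ ?_
    ext ξ
    simp only [LinearMap.mem_ker]
    exact ⟨fun h => LinearMap.ext fun η => congr_fun h η,
      fun h => funext fun η => LinearMap.congr_fun h η⟩
  simp only [← key']
  refine exists_generic_rank (fun (x : complement G H B) (ξ η : lieAlg G) =>
    B x ⁅(ξ : A), (η : A)⁆) (fun ξ η => ?_) (Module.finrank ℝ (lieAlg G)) (fun x => ?_) fun x => ?_
  · exact linear_mem_polynomialFunctions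
      (LinearMap.flip B ⁅(ξ : A), (η : A)⁆ ∘ₗ (complement G H B).subtype)
  · rw [key]; infer_instance
  · rw [key']; exact LinearMap.finrank_range_le _

/-- **Criterion for integrability.** Let the polynomials `F i` have gradients `N i` with respect to
one fixed invariant scalar product `T`, be invariant under `H` and commute with each other. If at a
single point `y₀` of the complement the Lie algebra of `H` and the gradients together span a
subspace of the Lie algebra of `G` that contains its own orthogonal space for the skew form
`T y₀ [·, ·]`, then the pair is integrable. -/
theorem isIntegrablePair_of_lagrangian {I : Type*} (hHG : H ≤ G)
    (hT : IsInvariantScalarProduct G T) (F : I → A → ℝ) (N : I → A → A)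
    (hF : ∀ i, F i ∈ polynomialFunctions A)
    (hFN : ∀ i x w, HasDerivAt (fun t : ℝ => F i (x + t • w)) (T (N i x) w) 0)
    (hFinv : ∀ i, ∀ u ∈ H, ∀ x, F i (u * x * (u⁻¹ : Aˣ)) = F i x)
    (hN : ∀ i, ∀ x ∈ lieAlg G, N i x ∈ lieAlg G)
    (hcomm : ∀ i j, ∀ x ∈ lieAlg G, T x ⁅N i x, N j x⁆ = 0)
    {y₀ : A} (hy₀ : y₀ ∈ complement G H T)
    (hLag : ∀ ξ ∈ lieAlg G, (∀ η ∈ lieAlg H, T y₀ ⁅ξ, η⁆ = 0) →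
      (∀ i, T y₀ ⁅ξ, N i y₀⁆ = 0) → ξ ∈ lieAlg H ⊔ Submodule.span ℝ (Set.range fun i => N i y₀)) :
    IsIntegrablePair G H := by
  refine ⟨hHG, fun B hB => ?_⟩
  have hpos := complement_pos (H := H) hB
  obtain ⟨φ, hφ⟩ := exists_linearEquiv_bilin_eq hT hB
  set V := complement G H B with hV
  set E := invariantPolynomials H V with hE
  -- `φ` carries `x` to the vector that represents the functional `B x` through `T`.
  let Φ : V →ₗ[ℝ] A := (lieAlg G).subtype ∘ₗ φ.toLinearMap ∘ₗ
    V.subtype.codRestrict (lieAlg G) fun x => x.2.1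
  have hΦG (x : V) : Φ x ∈ lieAlg G := (φ _).2
  have hΦ (x : V) {z : A} (hz : z ∈ lieAlg G) : T (Φ x) z = B x z := hφ ⟨x, x.2.1⟩ ⟨z, hz⟩
  have hΦu (x : V) {z : A} (hz : z ∈ lieAlg G) (h : ∀ w ∈ lieAlg G, T z w = B x w) : Φ x = z := by
    have := eq_of_forall_bilin_eq (V := lieAlg G) (u := ⟨Φ x, hΦG x⟩) (v := ⟨z, hz⟩) hT.pos
      fun w => by rw [h w w.2]; exact hΦ x w.2
    exact congrArg Subtype.val this
  let f : I → V → ℝ := fun i x => F i (Φ x)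
  have hfP (i : I) : f i ∈ polynomialFunctions V := comp_linear_mem_polynomialFunctions (hF i) Φ
  have hfE (i : I) : f i ∈ E := by
    refine ⟨hfP i, fun u hu x y hxy => ?_⟩
    have : Φ y = u * Φ x * (u⁻¹ : Aˣ) := by
      have huG := hHG hu
      refine hΦu y (conj_mem_lieAlg huG (hΦG x)) fun w hw => ?_
      have hw' := conj_mem_lieAlg (inv_mem huG) hw
      have h1 := hT.invariant u huG _ (hΦG x) _ hw'
      have h2 := hB.invariant u huG _ x.2.1 _ hw'
      rw [hΦ x hw', ← h2, ← hxy] at h1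
      simpa [mul_assoc] using h1
    change F i (Φ y) = F i (Φ x)
    rw [this, hFinv i u hu]
  let C : Subalgebra ℝ (V → ℝ) := Algebra.adjoin ℝ (Set.range f)
  have hCE : C ≤ E := Algebra.adjoin_le (by rintro _ ⟨i, rfl⟩; exact hfE i)
  have hEP : E ≤ polynomialFunctions V := fun f hf => hf.1
  have hfC (i : I) : f i ∈ C := Algebra.subset_adjoin ⟨i, rfl⟩
  -- The gradient of `f i` is `N i` up to a summand in the Lie algebra of `H`.
  have hgrad (i : I) (x : V) : N i (Φ x) - grad B (f i) x ∈ lieAlg H := by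
    have hNG := hN i _ (hΦG x)
    refine mem_lieAlg_of_orthogonal hB hHG (sub_mem hNG (grad B (f i) x).2.1) fun w hw => ?_
    have h1 := bilin_grad hpos (hfP i) x ⟨w, hw⟩
    have h2 : lineDeriv ℝ (f i) x ⟨w, hw⟩ = T (N i (Φ x)) (Φ ⟨w, hw⟩) := by
      refine HasDerivAt.deriv ?_
      simp only [f, map_add, map_smul]
      exact hFN i _ _
    rw [map_sub, LinearMap.sub_apply, sub_eq_zero, hB.symm _ hNG _ hw.1]
    rw [h2, hT.symm _ hNG _ (hΦG _), hΦ _ hNG] at h1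
    exact h1.symm
  have hLW (x : V) : gradSpan B C x ≤ gradSpan B E x := Submodule.span_mono (by
    rintro _ ⟨⟨g, hg⟩, rfl⟩
    exact ⟨⟨g, hCE hg⟩, rfl⟩)
  have hLspan (x : V) : gradSpan B C x ≤ Submodule.span ℝ (Set.range fun i => grad B (f i) x) :=
    gradSpan_adjoin_le hpos (by rintro _ ⟨i, rfl⟩; exact hfP i)
      (by rintro _ ⟨i, rfl⟩; exact Submodule.subset_span ⟨i, rfl⟩)
  have hHL (x : V) {u : V} (hu : u ∈ gradSpan B E x) {η : A} (hη : η ∈ lieAlg H) :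
      B x ⁅(u : A), η⁆ = 0 := bilin_lie_gradSpan hB hHG hη hu
  -- The Lie algebra of `H` does not contribute to `B x [·, ·]`: this form vanishes on its brackets
  -- with itself and with gradients of invariants. So the `f i` commute because the `N i` do.
  have hff (i j : I) (x : V) : B x ⁅(grad B (f i) x : A), (grad B (f j) x : A)⁆ = 0 := by
    have h0 := hcomm i j _ (hΦG x)
    rw [hΦ x (lie_mem_lieAlg (hN i _ (hΦG x)) (hN j _ (hΦG x)))] at h0
    have e (i : I) : N i (Φ x) = grad B (f i) x + (N i (Φ x) - grad B (f i) x) := by abel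
    have hi := hHL x (grad_mem_gradSpan (hfE i) x) (hgrad j x)
    have hj := hHL x (grad_mem_gradSpan (hfE j) x) (hgrad i x)
    have hij := bilin_lie_lieAlg x (hgrad i x) (hgrad j x)
    rw [← ring_lie_skew, map_neg, neg_eq_zero] at hj
    rw [e i, e j, ring_add_lie, ring_lie_add, ring_lie_add, map_add, map_add, map_add, hi, hj,
      hij] at h0
    simpa using h0
  have hLL (x : V) {u v : V} (hu : u ∈ gradSpan B C x) (hv : v ∈ gradSpan B C x) :
      B x ⁅(u : A), (v : A)⁆ = 0 := by
    have hu' := hLspan x hu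
    have hv' := hLspan x hv
    clear hu hv
    induction hu' using Submodule.span_induction with
    | mem u hu =>
      obtain ⟨i, rfl⟩ := hu
      induction hv' using Submodule.span_induction with
      | mem v hv =>
        obtain ⟨j, rfl⟩ := hv
        exact hff i j x
      | zero => simp
      | add a b _ _ ha hb => rw [Submodule.coe_add, ring_lie_add, map_add, ha, hb, add_zero]
      | smul c a _ ha => rw [Submodule.coe_smul, ring_lie_smul, map_smul, ha, smul_zero]
    | zero => simp
    | add a b _ _ ha hb => rw [Submodule.coe_add, ring_add_lie, map_add, ha, hb, add_zero]
    | smul c a _ ha => rw [Submodule.coe_smul, ring_smul_lie, map_smul, ha, smul_zero]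
  have hbr (x : V) {g k : V → ℝ} (hg : g ∈ C) (hk : k ∈ C) : bracket B g k x = 0 :=
    neg_eq_zero.2 (hLL x (grad_mem_gradSpan hg x) (grad_mem_gradSpan hk x))
  refine ⟨C, hCE, fun g hg k hk x => hbr x hg hk, ?_⟩
  obtain ⟨l, hl, U₁, hU₁, hU₁', h₁⟩ := exists_generic_finrank_gradSpan C hpos (hCE.trans hEP)
  obtain ⟨l', hl', U₂, hU₂, hU₂', h₂⟩ := exists_generic_finrank_gradSpan E hpos hEP
  obtain ⟨r, hr, U₃, hU₃, hU₃', h₃⟩ := exists_generic_rank_lieForm (G := G) (H := H) (B := B)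
  let ω : V → LinearMap.BilinForm ℝ (lieAlg G) := fun x => lieForm (B x) (lieAlg G).subtype
  have hω (x : V) : (ω x).IsRefl := lieForm_isRefl _ _
  let M : V → Submodule ℝ (lieAlg G) := fun x => extendByLieAlg (gradSpan B C x)
  have hM (x : V) : Module.finrank ℝ (M x) =
      Module.finrank ℝ (lieAlg H) + Module.finrank ℝ (gradSpan B C x) :=
    finrank_extendByLieAlg hB hHG _
  have hMH (x : V) {η : lieAlg G} (hη : (η : A) ∈ lieAlg H) : η ∈ M x :=
    show (η : A) ∈ lieAlg H ⊔ (gradSpan B C x).map V.subtype from Submodule.mem_sup_left hη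
  have hML (x : V) {u : V} (hu : u ∈ gradSpan B C x) : ⟨u, u.2.1⟩ ∈ M x :=
    show (u : A) ∈ lieAlg H ⊔ (gradSpan B C x).map V.subtype from
      Submodule.mem_sup_right ⟨u, hu, rfl⟩
  have hMiso (x : V) : ∀ ξ ∈ M x, ∀ η ∈ M x, ω x η ξ = 0 := by
    intro ξ hξ η hη
    obtain ⟨a, ha, _, ⟨u, hu, rfl⟩, hau⟩ := Submodule.mem_sup.1 hξ
    obtain ⟨b, hb, _, ⟨v, hv, rfl⟩, hbv⟩ := Submodule.mem_sup.1 hη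
    change B x ⁅(lieAlg G).subtype η, (lieAlg G).subtype ξ⁆ = 0
    have h1 := hHL x (hLW x hu) hb
    rw [← ring_lie_skew, map_neg, neg_eq_zero] at h1
    have h2 := hHL x (hLW x hv) ha
    rw [← hau, ← hbv, ring_add_lie, ring_lie_add, ring_lie_add, map_add, map_add, map_add,
      bilin_lie_lieAlg x hb ha]
    erw [h1, h2, hLL x hv hu]
    simp
  -- The base point that corresponds to `y₀` satisfies the condition of maximality.
  obtain ⟨x₀, hx₀⟩ : ∃ x₀ : V, Φ x₀ = y₀ := by
    obtain ⟨x, hx⟩ := φ.surjective ⟨y₀, hy₀.1⟩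
    have hxV : (x : A) ∈ V := by
      refine ⟨x.2, fun η hη => ?_⟩
      have := hφ x ⟨η, lieAlg_mono hHG hη⟩
      rw [hx] at this
      exact this.symm.trans (hy₀.2 η hη)
    exact ⟨⟨x, hxV⟩, congrArg Subtype.val hx⟩
  have hLag₀ : ∀ ξ, (∀ η ∈ M x₀, ω x₀ η ξ = 0) → ξ ∈ M x₀ := by
    intro ξ hξ
    have hξ' : ∀ η ∈ M x₀, T y₀ ⁅(ξ : A), (η : A)⁆ = 0 := fun η hη => by
      rw [← hx₀, hΦ x₀ (lie_mem_lieAlg ξ.2 η.2)]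
      exact hω _ _ _ (hξ η hη)
    have hNM (i : I) : ⟨N i y₀, hN i _ hy₀.1⟩ ∈ M x₀ := by
      have h1 := hML x₀ (grad_mem_gradSpan (hfC i) x₀)
      have h2 := hgrad i x₀
      rw [hx₀] at h2
      have h3 : (⟨N i y₀ - grad B (f i) x₀, lieAlg_mono hHG h2⟩ : lieAlg G) ∈ M x₀ := hMH x₀ h2
      convert add_mem h3 h1 using 1
      ext
      simp
    have h := hLag ξ ξ.2 (fun η hη => hξ' ⟨η, lieAlg_mono hHG hη⟩ (hMH x₀ hη))
      fun i => hξ' _ (hNM i)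
    have hle : lieAlg H ⊔ Submodule.span ℝ (Set.range fun i => N i y₀) ≤
        lieAlg H ⊔ (gradSpan B C x₀).map V.subtype :=
      sup_le le_sup_left (Submodule.span_le.2 (by rintro _ ⟨i, rfl⟩; exact hNM i))
    exact hle h
  -- Hence, by semicontinuity of the ranks, so does a generic point.
  have hLagU : ∀ x ∈ U₁ ∩ U₃, ∀ ξ, (∀ η ∈ M x, ω x η ξ = 0) → ξ ∈ M x := by
    rintro x ⟨hx1, hx3⟩
    refine lagrangian_of_finrank (hω x) (hMiso x) ?_
    have e0 := finrank_of_lagrangian (hω x₀) hLag₀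
    have e1 : Module.finrank ℝ (LinearMap.range (ω x₀)) ≤ r := hr x₀
    have e2 : Module.finrank ℝ (LinearMap.range (ω x)) = r := h₃ x hx3
    have e3 : Module.finrank ℝ (gradSpan B C x₀) ≤ l := hl x₀
    have e4 : Module.finrank ℝ (gradSpan B C x) = l := h₁ x hx1
    rw [hM] at e0 ⊢
    omega
  -- There the gradients of `C` are their own orthogonal space among the gradients `ξ` of all
  -- invariants: `ξ` lies in the sum of the Lie algebra of `H` and the gradients of `C`, and its
  -- first component is zero because `ξ` lies in the complement.
  have hdim : ∀ x ∈ (U₁ ∩ U₃) ∩ U₂, 2 * l' = 2 * l + bracketRank B E x := by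
    rintro x ⟨hx, hx2⟩
    rw [bracketRank_eq, ← h₂ x hx2, ← h₁ x hx.1]
    refine finrank_eq_of_lagrangian_of_le (lieForm_isRefl (B x) V.subtype) (hLW x)
      (fun ξ hξ η hη => hLL x hη hξ) fun ξ hξE hξ => ?_
    have hmem : (⟨ξ, ξ.2.1⟩ : lieAlg G) ∈ M x := by
      refine hLagU x hx _ fun η hη => ?_
      obtain ⟨b, hb, _, ⟨v, hv, rfl⟩, hbv⟩ := Submodule.mem_sup.1 hη
      change B x ⁅(lieAlg G).subtype η, (ξ : A)⁆ = 0
      have h1 := hHL x hξE hb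
      rw [← ring_lie_skew, map_neg, neg_eq_zero] at h1
      have h2 : B x ⁅(v : A), (ξ : A)⁆ = 0 := hξ v hv
      rw [← hbv, ring_add_lie, map_add, h1]
      simpa using h2
    obtain ⟨b, hb, _, ⟨v, hv, rfl⟩, hbv⟩ := Submodule.mem_sup.1 hmem
    have hb' : b = (ξ - v : V) := by
      rw [Submodule.coe_sub]
      exact eq_sub_of_add_eq hbv
    have hz : (ξ - v : V) = 0 := by
      by_contra hne
      have h1 := hpos _ (ξ - v : V).2 fun h0 => hne (Subtype.ext h0)
      rw [← hb'] at h1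
      have h2 := (ξ - v : V).2.2 b hb
      rw [← hb'] at h2
      exact h1.ne' h2
    change ξ ∈ gradSpan B C x
    rw [sub_eq_zero.1 hz]
    exact hv
  have hdense := (hU₁'.inter_of_isOpen_left hU₃' hU₁).inter_of_isOpen_left hU₂' (hU₁.inter hU₃)
  have hle : l ≤ l' ∧ l' ≤ 2 * l := by
    obtain ⟨x, hx⟩ := hdense.nonempty
    have e1 := hdim x hx
    have e2 := Submodule.finrank_mono (hLW x)
    have e3 : Module.finrank ℝ (gradSpan B C x) = l := h₁ x hx.1.1
    have e4 : Module.finrank ℝ (gradSpan B E x) = l' := h₂ x hx.2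
    have e5 : bracketRank B E x ≤ Module.finrank ℝ (gradSpan B E x) := by
      rw [bracketRank_eq]
      exact finrank_range_domRestrict_le _ _
    omega
  -- The brackets on `C` vanish, so its index is `l`. The rank of the brackets of all invariants is
  -- `2 * l' - 2 * l`, so their index is `2 * l - l'`, which is not negative by `hle`.
  refine ⟨l, l, l', 2 * l - l', ⟨U₁, hU₁, hU₁', fun x hx => ⟨?_, ?_⟩⟩,
    ⟨_, (hU₁.inter hU₃).inter hU₂, hdense, fun x hx => ⟨?_, ?_⟩⟩, by omega⟩
  · rw [differentialRank_eq hpos (hCE.trans hEP), h₁ x hx]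
  · have : (fun g k : C => bracket B (g : V → ℝ) k x) = 0 := by
      ext g k
      exact hbr x g.2 k.2
    have h0 : bracketRank B C x = 0 := by
      have hbot : Submodule.span ℝ (Set.range (0 : C → C → ℝ)) = ⊥ := by
        rw [Submodule.span_eq_bot]
        rintro _ ⟨g, rfl⟩
        rfl
      rw [bracketRank, this, hbot, finrank_bot]
    rw [h0, zero_add]
  · rw [differentialRank_eq hpos hEP, h₂ x hx.2]
  · have := hdim x hx
    omega

end Criterion

/-! ### Coisotropic subspaces along a chain of subalgebras -/

section Chain

/-- A functional that vanishes on the orthogonal space of `M` is represented by an element of `M`,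
even if the form is degenerate. -/
theorem exists_mem_eq_of_annihilates {X : Type*} [AddCommGroup X] [Module ℝ X]
    [FiniteDimensional ℝ X] (β : LinearMap.BilinForm ℝ X) (M : Submodule ℝ X) (f : X →ₗ[ℝ] ℝ)
    (h : ∀ η, (∀ m ∈ M, β m η = 0) → f η = 0) : ∃ m ∈ M, β m = f := by
  have hf : f ∈ (Submodule.dualCoannihilator (M.map β)).dualAnnihilator := by
    rw [Submodule.mem_dualAnnihilator]
    intro η hη
    rw [Submodule.mem_dualCoannihilator] at hη
    exact h η fun m hm => hη _ ⟨m, hm, rfl⟩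
  rw [Subspace.dualCoannihilator_dualAnnihilator_eq] at hf
  obtain ⟨m, hm, e⟩ := hf
  exact ⟨m, hm, e⟩

variable {A : Type*} [Ring A] [Algebra ℝ A] {l : A →ₗ[ℝ] ℝ} {k g M N Z : Submodule ℝ A}

/-- `M` contains every element of `k` that is orthogonal to `M` for the skew form `l [·, ·]`. -/
def IsCoisotropicIn (l : A →ₗ[ℝ] ℝ) (k M : Submodule ℝ A) : Prop :=
  ∀ ξ ∈ k, (∀ η ∈ M, l ⁅ξ, η⁆ = 0) → ξ ∈ M

/-- The elements of `g` that are orthogonal to `k` for the skew form `l [·, ·]` belong, up to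
summands in `Z`, to the radical of the restriction of this form to `k`. -/
def IsMultiplicityFree (l : A →ₗ[ℝ] ℝ) (k g Z : Submodule ℝ A) : Prop :=
  ∀ ξ ∈ g, (∀ η ∈ k, l ⁅ξ, η⁆ = 0) → ∃ κ ∈ k, (∀ η ∈ k, l ⁅κ, η⁆ = 0) ∧ ξ - κ ∈ Z

theorem IsCoisotropicIn.mono (h : IsCoisotropicIn l k M) (hMN : M ≤ N) : IsCoisotropicIn l k N :=
  fun ξ hξ hη => hMN (h ξ hξ fun η hm => hη η (hMN hm))

/-- The step of the chain method. A functional `l [ξ, ·]` on `k` that vanishes on the coisotropic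
subspace `M` comes from an element of `M`; after subtraction of this element `ξ` is orthogonal
to `k`. -/
theorem IsCoisotropicIn.sup [FiniteDimensional ℝ A] (h : IsCoisotropicIn l k M) (hMk : M ≤ k)
    (hkg : k ≤ g) (hZ : IsMultiplicityFree l k g Z) : IsCoisotropicIn l g (M ⊔ Z) := by
  intro ξ hξ hη
  obtain ⟨m, hm, hmξ⟩ := exists_mem_eq_of_annihilates (lieForm l k.subtype) (M.comap k.subtype)
    (lieForm l LinearMap.id ξ ∘ₗ k.subtype) fun η h0 => hη η (Submodule.mem_sup_left
      (h η η.2 fun m hm => lieForm_isRefl _ _ _ _ (h0 ⟨m, hMk hm⟩ hm)))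
  have hmξ' (η : A) (hη : η ∈ k) : l ⁅(m : A), η⁆ = l ⁅ξ, η⁆ := LinearMap.congr_fun hmξ ⟨η, hη⟩
  obtain ⟨κ, hκ, hκk, hz⟩ := hZ (ξ - m) (sub_mem hξ (hkg m.2)) fun η hη => by
    have e : ξ - m + m = ξ := sub_add_cancel _ _
    have := hmξ' η hη
    rw [← e, ring_add_lie, map_add] at this
    linarith
  have hκM : κ ∈ M := h κ hκ fun η hη => hκk η (hMk hη)
  have e : ξ = (m + κ) + (ξ - m - κ) := by abel
  rw [e]
  exact add_mem (Submodule.mem_sup_left (add_mem hm hκM)) (Submodule.mem_sup_right hz)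

/-- The chain method: if all steps of an increasing chain of subspaces are multiplicity free, then a
coisotropic subspace of the first member together with the radicals `Z i` gives one of the last. -/
theorem IsCoisotropicIn.chain [FiniteDimensional ℝ A] {k Z : ℕ → Submodule ℝ A} {n : ℕ}
    (h : IsCoisotropicIn l (k 0) M) (hM : M ≤ k 0) (hk : Monotone k)
    (hZ : ∀ i < n, IsMultiplicityFree l (k i) (k (i + 1)) (Z i))
    (hZk : ∀ i, Z i ≤ k (i + 1)) (hMN : M ≤ N) (hZN : ∀ i, Z i ≤ N) :
    IsCoisotropicIn l (k n) N := by
  suffices H : ∀ i ≤ n, ∃ M', M' ≤ k i ∧ M' ≤ N ∧ IsCoisotropicIn l (k i) M' by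
    obtain ⟨M', -, hM'N, hM'⟩ := H n le_rfl
    exact hM'.mono hM'N
  intro i
  induction i with
  | zero => exact fun _ => ⟨M, hM, hMN, h⟩
  | succ i ih =>
    intro hi
    obtain ⟨M', h1, h2, h3⟩ := ih (by omega)
    have hki := hk (Nat.le_succ i)
    exact ⟨M' ⊔ Z i, sup_le (h1.trans hki) (hZk i), sup_le h2 (hZN i),
      h3.sup h1 hki (hZ i (by omega))⟩

end Chain

/-! ### Vectors that see every eigenvalue of a skew-Hermitian matrix -/

section Bordering

open Matrix

/-- Every skew-Hermitian matrix `A` has a vector `b` such that, whenever `b c* - c b*` is a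
commutator with `A`, the vector `c` is a combination of the `A ^ j b`; the coefficients are those
for which `p j • A ^ j` is Hermitian. -/
def HasBordering (𝕜 : Type*) [RCLike 𝕜] : Prop :=
  ∀ {ι : Type} [Fintype ι] [DecidableEq ι] (A : Matrix ι ι 𝕜), Aᴴ = -A →
    ∃ b : ι → 𝕜, ∀ (Y : Matrix ι ι 𝕜) (c : ι → 𝕜),
      A * Y - Y * A = vecMulVec b (star c) - vecMulVec c (star b) →
        ∃ (p : ℕ → 𝕜) (N : ℕ), (∀ j, star (p j) = (-1) ^ j * p j) ∧
          c = ∑ j ∈ Finset.range N, p j • (A ^ j *ᵥ b)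

/-- Interpolation of real values that depend only on the node. -/
theorem exists_polynomial_eval_eq {ι : Type*} [Fintype ι] (d r : ι → ℝ)
    (h : ∀ i j, d i = d j → r i = r j) : ∃ q : Polynomial ℝ, ∀ i, q.eval (d i) = r i := by
  classical
  let ρ : ℝ → ℝ := fun x => if hx : ∃ i, d i = x then r hx.choose else 0
  have hρ (i : ι) : ρ (d i) = r i := by
    have hx : ∃ j, d j = d i := ⟨i, rfl⟩
    simp only [ρ, dif_pos hx]
    exact h _ _ hx.choose_spec
  refine ⟨Lagrange.interpolate (Finset.univ.image d) id ρ, fun i => ?_⟩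
  rw [← hρ i]
  exact Lagrange.eval_interpolate_at_node (v := id) ρ (Set.injOn_id _)
    (Finset.mem_image_of_mem d (Finset.mem_univ i))

/-- A unitary matrix maps some real vector to a vector without zero coordinates. -/
theorem exists_real_vector_mulVec_ne_zero {ι : Type*} [Fintype ι] [DecidableEq ι]
    (W : Matrix ι ι ℂ) (hW : W * Wᴴ = 1) :
    ∃ b : ι → ℝ, ∀ i, (W *ᵥ fun j => (b j : ℂ)) i ≠ 0 := by
  let p : ι → Submodule ℝ (ι → ℝ) := fun i => LinearMap.ker
    ({ toFun := fun b => (W *ᵥ fun j => (b j : ℂ)) i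
       map_add' := fun b c => by
         simp [mulVec, dotProduct, mul_add, Finset.sum_add_distrib]
       map_smul' := fun r b => by
         simp [mulVec, dotProduct, Finset.mul_sum, mul_left_comm] } : (ι → ℝ) →ₗ[ℝ] ℂ)
  obtain ⟨b, hb⟩ := Submodule.exists_forall_notMem_of_forall_ne_top p fun i hi => by
    have hW0 : W i = 0 := by
      ext j
      have h : Pi.single j (1 : ℝ) ∈ p i := by rw [hi]; trivial
      have h' : (W *ᵥ fun k => ((Pi.single j (1 : ℝ) : ι → ℝ) k : ℂ)) i = 0 := h
      simpa [mulVec, dotProduct, Pi.single_apply, apply_ite] using h'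
    have := congrFun (congrFun hW i) i
    rw [mul_apply] at this
    simp [hW0] at this
  exact ⟨b, hb⟩

/-- The bordering property over `ℂ`, with a real vector `b`, so that it descends to `ℝ`. The vector
is chosen with a nonzero component along every member of an orthonormal basis of eigenvectors. In
this basis the relation says that the quotients `c i / b i` are real and agree for equal eigenvalues
`d i` of `I • A`, so `c` is obtained from `b` by interpolation with a real polynomial in `I • A`. -/
theorem exists_real_bordering {ι : Type*} [Fintype ι] [DecidableEq ι] (A : Matrix ι ι ℂ)
    (hA : Aᴴ = -A) : ∃ b : ι → ℝ, ∀ (Y : Matrix ι ι ℂ) (c : ι → ℂ),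
      A * Y - Y * A = vecMulVec (fun j => (b j : ℂ)) (star c) -
        vecMulVec c (star fun j => (b j : ℂ)) →
        ∃ (p : ℕ → ℂ) (N : ℕ), (∀ j, star (p j) = (-1) ^ j * p j) ∧
          c = ∑ j ∈ Finset.range N, p j • (A ^ j *ᵥ fun j => (b j : ℂ)) := by
  have hH : (Complex.I • A).IsHermitian := by
    simp [IsHermitian, conjTranspose_smul, hA]
  set d := hH.eigenvalues with hd
  let U : Matrix ι ι ℂ := hH.eigenvectorUnitary
  let W : Matrix ι ι ℂ := Uᴴ
  have hUW : U * W = 1 := (mem_unitaryGroup_iff.1 hH.eigenvectorUnitary.2)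
  have hWU : W * U = 1 := (mem_unitaryGroup_iff'.1 hH.eigenvectorUnitary.2)
  have hWs : Wᴴ = U := conjTranspose_conjTranspose U
  let D : Matrix ι ι ℂ := diagonal fun i => (d i : ℂ)
  have hspec : W * (Complex.I • A) = D * W := by
    have h : Complex.I • A = U * D * W := hH.spectral_theorem
    rw [h, ← mul_assoc, ← mul_assoc, hWU, one_mul]
  obtain ⟨b, hb⟩ := exists_real_vector_mulVec_ne_zero W (by rw [hWs, hWU])
  refine ⟨b, fun Y c hY => ?_⟩
  set β : ι → ℂ := fun j => (b j : ℂ) with hβ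
  set b' := W *ᵥ β
  set c' := W *ᵥ c
  set Y' := W * Y * U
  -- the relation in an orthonormal basis of eigenvectors
  have key (i j : ι) : ((d i : ℂ) - d j) * Y' i j =
      Complex.I * (b' i * star (c' j) - c' i * star (b' j)) := by
    have h1 : D * Y' - Y' * D = W * (Complex.I • (A * Y - Y * A)) * U := by
      have e1 : D * Y' = W * (Complex.I • A) * Y * U := by
        rw [hspec]; simp only [Y', mul_assoc]
      have e2 : Y' * D = W * Y * (Complex.I • A) * U := by
        have h : (Complex.I • A) * U = U * D := by
          calc (Complex.I • A) * U = U * (W * (Complex.I • A)) * U := by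
                rw [← mul_assoc, hUW, one_mul]
            _ = U * D * (W * U) := by rw [hspec]; simp only [mul_assoc]
            _ = U * D := by rw [hWU, mul_one]
        simp only [Y', mul_assoc, h]
      rw [e1, e2]
      simp only [smul_sub, mul_sub, sub_mul, Matrix.mul_smul, Matrix.smul_mul, mul_assoc]
    have hv (u v : ι → ℂ) : W * vecMulVec u (star v) * U = vecMulVec (W *ᵥ u) (star (W *ᵥ v)) := by
      rw [mul_vecMulVec, vecMulVec_mul, star_mulVec, hWs]
    rw [hY, Matrix.mul_smul, Matrix.smul_mul, mul_sub, sub_mul, hv, hv] at h1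
    have h2 := congrFun (congrFun h1 i) j
    simp only [D, Matrix.sub_apply, diagonal_mul, mul_diagonal, Matrix.smul_apply, vecMulVec_apply,
      Pi.star_apply, smul_eq_mul] at h2
    linear_combination h2
  have key' (i j : ι) (hij : d i = d j) : star (c' j / b' j) = c' i / b' i := by
    have := key i j
    rw [hij, sub_self, zero_mul] at this
    have h3 := (mul_eq_zero.1 this.symm).resolve_left Complex.I_ne_zero
    rw [star_div₀, div_eq_div_iff (star_ne_zero.2 (hb j)) (hb i)]
    linear_combination h3
  have hreal (i : ι) : ((c' i / b' i).re : ℂ) = c' i / b' i :=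
    Complex.conj_eq_iff_re.1 (key' i i rfl)
  obtain ⟨q, hq⟩ := exists_polynomial_eval_eq d (fun i => (c' i / b' i).re) fun i j hij => by
    have := key' i j hij
    rw [← this, Complex.star_def, Complex.conj_re]
  refine ⟨fun j => q.coeff j * Complex.I ^ j, q.natDegree + 1, fun j => ?_, ?_⟩
  · simp only [star_mul', star_pow, Complex.star_def, Complex.conj_I, Complex.conj_ofReal]
    rw [neg_pow]
    ring
  · have hinj : Function.Injective (W *ᵥ ·) := fun u v h => by
      have := congrArg (U *ᵥ ·) h
      simpa [hUW] using this
    apply hinj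
    ext i
    have hpow (j : ℕ) : W * (Complex.I • A) ^ j = D ^ j * W := by
      induction j with
      | zero => simp
      | succ j ih => rw [pow_succ, ← mul_assoc, ih, mul_assoc, hspec, ← mul_assoc, pow_succ]
    have hc : c' i = ((q.eval (d i) : ℝ) : ℂ) * b' i := by
      rw [hq, hreal, div_mul_cancel₀ _ (hb i)]
    change c' i = _
    rw [hc, Polynomial.eval_eq_sum_range]
    have hterm (j : ℕ) : W *ᵥ ((q.coeff j * Complex.I ^ j) • (A ^ j *ᵥ β)) =
        (q.coeff j : ℂ) • (D ^ j *ᵥ b') := by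
      rw [mul_smul, mulVec_smul, ← smul_mulVec (Complex.I ^ j), ← smul_pow, mulVec_mulVec, hpow,
        ← mulVec_mulVec]
    simp only [mulVec_sum, hterm]
    simp [Finset.sum_apply, D, diagonal_pow, mulVec_diagonal, Finset.sum_mul, mul_assoc]

theorem hasBordering_complex : HasBordering ℂ := fun A hA => by
  obtain ⟨b, hb⟩ := exists_real_bordering A hA
  exact ⟨_, hb⟩

/-- The real case follows from the complex one by taking real parts. -/
theorem hasBordering_real : HasBordering ℝ := fun {ι} _ _ A hA => by
  let φ : Matrix ι ι ℝ →+* Matrix ι ι ℂ := Complex.ofRealHom.mapMatrix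
  have hφ (X : Matrix ι ι ℝ) (v : ι → ℝ) :
      φ X *ᵥ (fun j => (v j : ℂ)) = fun j => ((X *ᵥ v) j : ℂ) := by
    ext i
    simp [φ, mulVec, dotProduct]
  have hφs (u v : ι → ℝ) : φ (vecMulVec u (star v)) =
      vecMulVec (fun j => (u j : ℂ)) (star fun j => (v j : ℂ)) := by
    ext i j
    simp [φ, vecMulVec_apply]
  have hA' : (φ A)ᴴ = -φ A := by
    rw [← map_neg, ← hA]
    ext i j
    simp [φ]
  obtain ⟨b, hb⟩ := exists_real_bordering (φ A) hA'
  refine ⟨b, fun Y c hY => ?_⟩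
  obtain ⟨p, N, hp, hc⟩ := hb (φ Y) (fun j => (c j : ℂ)) (by
    rw [← map_mul, ← map_mul, ← map_sub, hY, map_sub, hφs, hφs])
  have hc' : c = ∑ j ∈ Finset.range N, (p j).re • (A ^ j *ᵥ b) := by
    ext i
    have := congrArg Complex.re (congrFun hc i)
    simp only [← map_pow, hφ] at this
    simpa [Finset.sum_apply] using this
  refine ⟨fun j => (p j).re, N, fun j => ?_, hc'⟩
  have := congrArg Complex.re (hp j)
  rcases Nat.even_or_odd j with h | h
  · simp [h.neg_one_pow]
  · simp [h.neg_one_pow] at this ⊢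
    linarith

end Bordering

/-! ### Central functions of powers -/

section Powers

variable {A : Type*} [NormedRing A] [NormedAlgebra ℝ A]

theorem exists_hasDerivAt_pow (Y W : A) (k : ℕ) :
    ∃ D : A, HasDerivAt (fun t : ℝ => (Y + t • W) ^ k) D 0 ∧
      ∀ l : A →ₗ[ℝ] ℝ, (∀ a b, l (a * b) = l (b * a)) →
        ∀ j, l (Y ^ j * (D * Y + Y ^ k * W)) = (k + 1) * l (Y ^ (j + k) * W) := by
  induction k with
  | zero =>
    refine ⟨0, ?_, fun l _ j => by simp⟩
    simpa using hasDerivAt_const (0 : ℝ) (1 : A)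
  | succ k ih =>
    obtain ⟨D, hD, hl⟩ := ih
    have h1 : HasDerivAt (fun t : ℝ => Y + t • W) W 0 := by
      simpa using ((hasDerivAt_id (0 : ℝ)).smul_const W).const_add Y
    refine ⟨D * Y + Y ^ k * W, ?_, fun l h j => ?_⟩
    · have := hD.mul h1
      simp only [zero_smul, add_zero] at this
      simpa only [pow_succ] using! this
    · have e : l (Y ^ j * ((D * Y + Y ^ k * W) * Y)) = l (Y ^ (j + 1) * (D * Y + Y ^ k * W)) := by
        rw [← mul_assoc, h, ← mul_assoc, pow_succ' Y j]
      rw [mul_add, map_add, e, hl l h, ← mul_assoc, ← pow_add, add_right_comm j 1 k, add_assoc]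
      push_cast
      ring

theorem hasDerivAt_trace_pow [FiniteDimensional ℝ A] (l : A →ₗ[ℝ] ℝ)
    (h : ∀ a b, l (a * b) = l (b * a)) (Y W : A)
    (m : ℕ) :
    HasDerivAt (fun t : ℝ => l ((Y + t • W) ^ (m + 1))) ((m + 1) * l (Y ^ m * W)) 0 := by
  obtain ⟨D, hD, hl⟩ := exists_hasDerivAt_pow Y W m
  have h1 : HasDerivAt (fun t : ℝ => Y + t • W) W 0 := by
    simpa using ((hasDerivAt_id (0 : ℝ)).smul_const W).const_add Y
  have h2 := hD.mul h1
  simp only [zero_smul, add_zero] at h2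
  have h3 := (LinearMap.toContinuousLinearMap l).hasFDerivAt.comp_hasDerivAt (0 : ℝ) h2
  have h4 := hl l h 0
  rw [pow_zero, one_mul, zero_add] at h4
  rw [← h4]
  simpa only [pow_succ] using! h3

end Powers

section PolynomialMaps

variable {V A : Type*} [AddCommGroup V] [Module ℝ V] [Ring A] [Algebra ℝ A]
  [FiniteDimensional ℝ A]

theorem mul_polynomial {f g : V → A}
    (hf : ∀ l : A →ₗ[ℝ] ℝ, (fun x => l (f x)) ∈ polynomialFunctions V)
    (hg : ∀ l : A →ₗ[ℝ] ℝ, (fun x => l (g x)) ∈ polynomialFunctions V) (l : A →ₗ[ℝ] ℝ) :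
    (fun x => l (f x * g x)) ∈ polynomialFunctions V := by
  let b := Module.finBasis ℝ A
  have : (fun x => l (f x * g x)) = ∑ i, ∑ j, l (b i * b j) •
      ((fun x => b.coord i (f x)) * fun x => b.coord j (g x)) := by
    ext x
    conv_lhs => rw [← b.sum_repr (f x), ← b.sum_repr (g x)]
    simp only [Finset.sum_mul_sum, map_sum, Finset.sum_apply, Pi.smul_apply, Pi.mul_apply,
      smul_eq_mul, Module.Basis.coord_apply, smul_mul_smul_comm, map_smul]
    simp only [mul_comm]
  rw [this]
  exact sum_mem fun i _ => sum_mem fun j _ => Subalgebra.smul_mem _ (mul_mem (hf _) (hg _)) _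

theorem pow_polynomial {f : V → A}
    (hf : ∀ l : A →ₗ[ℝ] ℝ, (fun x => l (f x)) ∈ polynomialFunctions V)
    (k : ℕ) (l : A →ₗ[ℝ] ℝ) : (fun x => l (f x ^ k)) ∈ polynomialFunctions V := by
  induction k generalizing l with
  | zero => simpa using const_mem_polynomialFunctions (l 1)
  | succ k ih =>
    simp only [pow_succ]
    exact mul_polynomial ih hf l

end PolynomialMaps

/-! ### Skew-Hermitian matrices supported on a diagonal block -/

section Blocks

open Matrix

variable {𝕜 : Type*} [RCLike 𝕜] {ι : Type*} [DecidableEq ι]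

/-- The coordinate projection onto `S`. -/
noncomputable def coordProj (𝕜 : Type*) [RCLike 𝕜] (S : Finset ι) : Matrix ι ι 𝕜 :=
  diagonal fun i => if i ∈ S then 1 else 0

theorem conjTranspose_coordProj {S : Finset ι} : (coordProj 𝕜 S)ᴴ = coordProj 𝕜 S := by
  rw [coordProj, diagonal_conjTranspose]
  congr 1
  ext i
  by_cases hi : i ∈ S <;> simp [hi]

variable [Fintype ι]

/-- The diagonal block of `X` on `S`, as a matrix of full size. -/
noncomputable def block (S : Finset ι) : Matrix ι ι 𝕜 →ₗ[ℝ] Matrix ι ι 𝕜 where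
  toFun X := coordProj 𝕜 S * X * coordProj 𝕜 S
  map_add' X Y := by rw [mul_add, add_mul]
  map_smul' r X := by simp

variable {S S' : Finset ι} {X Y x ξ η ζ : Matrix ι ι 𝕜}

theorem block_def (S : Finset ι) (X : Matrix ι ι 𝕜) :
    block S X = coordProj 𝕜 S * X * coordProj 𝕜 S := rfl

theorem block_apply (S : Finset ι) (X : Matrix ι ι 𝕜) (i j : ι) :
    block S X i j = if i ∈ S ∧ j ∈ S then X i j else 0 := by
  simp only [block_def, coordProj, mul_diagonal, diagonal_mul]
  split_ifs <;> simp_all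

theorem coordProj_mul_of_subset (h : S ⊆ S') : coordProj 𝕜 S * coordProj 𝕜 S' = coordProj 𝕜 S := by
  rw [coordProj, coordProj, diagonal_mul_diagonal]
  congr 1
  ext i
  by_cases hi : i ∈ S
  · simp [hi, h hi]
  · simp [hi]

theorem mul_coordProj_of_subset (h : S ⊆ S') : coordProj 𝕜 S' * coordProj 𝕜 S = coordProj 𝕜 S := by
  rw [coordProj, coordProj, diagonal_mul_diagonal]
  congr 1
  ext i
  by_cases hi : i ∈ S
  · simp [hi, h hi]
  · simp [hi]

theorem coordProj_univ : coordProj 𝕜 (Finset.univ : Finset ι) = 1 := by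
  simp [coordProj]

theorem coordProj_mul_coordProj_mul {κ : Type*} (Z : Matrix ι κ 𝕜) :
    coordProj 𝕜 S * (coordProj 𝕜 S * Z) = coordProj 𝕜 S * Z := by
  rw [← Matrix.mul_assoc, coordProj_mul_of_subset subset_rfl]

theorem conjTranspose_block : (block S X)ᴴ = block S Xᴴ := by
  simp [block_def, conjTranspose_mul, conjTranspose_coordProj, mul_assoc]

theorem coordProj_mul_block : coordProj 𝕜 S * block S X = block S X := by
  rw [block_def, ← mul_assoc, ← mul_assoc, coordProj_mul_of_subset subset_rfl]

theorem block_mul_coordProj : block S X * coordProj 𝕜 S = block S X := by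
  rw [block_def, mul_assoc, coordProj_mul_of_subset subset_rfl]

theorem block_block_of_subset (h : S ⊆ S') : block S' (block S X) = block S X := by
  rw [block_def S', block_def S, ← mul_assoc, ← mul_assoc, mul_coordProj_of_subset h, mul_assoc,
    coordProj_mul_of_subset h]

theorem block_block_of_subset' (h : S ⊆ S') : block S (block S' X) = block S X := by
  ext i j
  simp only [block_apply]
  by_cases hi : i ∈ S <;> by_cases hj : j ∈ S <;> simp [hi, hj]
  simp [h hi, h hj]

variable (𝕜) in
/-- The skew-Hermitian matrices whose entries vanish outside `S × S`. -/
def skewOn (S : Finset ι) : Submodule ℝ (Matrix ι ι 𝕜) where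
  carrier := {X | Xᴴ = -X ∧ block S X = X}
  zero_mem' := by simp
  add_mem' hX hY := ⟨by rw [conjTranspose_add, hX.1, hY.1, neg_add], by rw [map_add, hX.2, hY.2]⟩
  smul_mem' r X hX := ⟨by simp [conjTranspose_smul, hX.1], by rw [map_smul, hX.2]⟩

theorem skewOn_mono (h : S ⊆ S') : skewOn 𝕜 S ≤ skewOn 𝕜 S' := fun X hX =>
  ⟨hX.1, by rw [← hX.2, block_block_of_subset h]⟩

theorem block_mem_skewOn (hX : Xᴴ = -X) : block S X ∈ skewOn 𝕜 S :=
  ⟨by rw [conjTranspose_block, hX, map_neg], block_block_of_subset subset_rfl⟩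

theorem mem_skewOn_univ : X ∈ skewOn 𝕜 (Finset.univ : Finset ι) ↔ Xᴴ = -X :=
  ⟨fun h => h.1, fun h => ⟨h, by simp [block_def, coordProj_univ]⟩⟩

theorem lie_mem_skewOn (hX : X ∈ skewOn 𝕜 S) (hY : Y ∈ skewOn 𝕜 S) : ⁅X, Y⁆ ∈ skewOn 𝕜 S := by
  refine ⟨?_, ?_⟩
  · rw [Ring.lie_def, conjTranspose_sub, conjTranspose_mul, conjTranspose_mul, hX.1, hY.1]
    noncomm_ring
  · have h1 : block S (X * Y) = X * Y := by
      rw [← hX.2, ← hY.2, block_def S (_ * _), ← mul_assoc, coordProj_mul_block, mul_assoc,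
        block_mul_coordProj]
    have h2 : block S (Y * X) = Y * X := by
      rw [← hX.2, ← hY.2, block_def S (_ * _), ← mul_assoc, coordProj_mul_block, mul_assoc,
        block_mul_coordProj]
    rw [Ring.lie_def, map_sub, h1, h2]

/-! ### The trace form -/

variable (𝕜 ι) in
/-- The trace form `-Re tr (x y)`, positive definite on skew-Hermitian matrices. -/
noncomputable def traceForm : LinearMap.BilinForm ℝ (Matrix ι ι 𝕜) :=
  LinearMap.mk₂ ℝ (fun x y => -RCLike.re (trace (x * y)))
    (fun x y z => by rw [add_mul, trace_add, map_add, neg_add])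
    (fun r x y => by rw [smul_mul, trace_smul, RCLike.smul_re, smul_eq_mul, mul_neg])
    (fun x y z => by rw [mul_add, trace_add, map_add, neg_add])
    (fun r x y => by rw [Matrix.mul_smul, trace_smul, RCLike.smul_re, smul_eq_mul, mul_neg])

theorem traceForm_apply (x y : Matrix ι ι 𝕜) :
    traceForm 𝕜 ι x y = -RCLike.re (trace (x * y)) := rfl

theorem traceForm_comm (x y : Matrix ι ι 𝕜) : traceForm 𝕜 ι x y = traceForm 𝕜 ι y x := by
  rw [traceForm_apply, trace_mul_comm, traceForm_apply]

theorem traceForm_lie (x y z : Matrix ι ι 𝕜) :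
    traceForm 𝕜 ι x ⁅y, z⁆ = traceForm 𝕜 ι ⁅x, y⁆ z := by
  simp only [traceForm_apply, Ring.lie_def, mul_sub, sub_mul, trace_sub, ← mul_assoc]
  rw [trace_mul_cycle x z y]

theorem traceForm_block (x y : Matrix ι ι 𝕜) :
    traceForm 𝕜 ι (block S x) y = traceForm 𝕜 ι x (block S y) := by
  rw [traceForm_apply, traceForm_apply, block_def, block_def, mul_assoc, mul_assoc, trace_mul_comm]
  simp only [mul_assoc]

theorem traceForm_conj (u : (Matrix ι ι 𝕜)ˣ) (x y : Matrix ι ι 𝕜) :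
    traceForm 𝕜 ι (u * x * ((u⁻¹ : (Matrix ι ι 𝕜)ˣ) : Matrix ι ι 𝕜))
      (u * y * ((u⁻¹ : (Matrix ι ι 𝕜)ˣ) : Matrix ι ι 𝕜)) =
      traceForm 𝕜 ι x y := by
  have e : (u : Matrix ι ι 𝕜) * x * ((u⁻¹ : (Matrix ι ι 𝕜)ˣ) : Matrix ι ι 𝕜) *
      (u * y * ((u⁻¹ : (Matrix ι ι 𝕜)ˣ) : Matrix ι ι 𝕜)) =
        u * (x * y) * ((u⁻¹ : (Matrix ι ι 𝕜)ˣ) : Matrix ι ι 𝕜) := by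
    simp [mul_assoc]
  rw [traceForm_apply, traceForm_apply, e, trace_mul_comm, Units.inv_mul_cancel_left]

theorem traceForm_self (hX : Xᴴ = -X) : traceForm 𝕜 ι X X = ∑ i, ∑ j, ‖X i j‖ ^ 2 := by
  have h (i j : ι) : X j i = -star (X i j) := by
    have := congrFun (congrFun hX j) i
    rw [conjTranspose_apply, neg_apply] at this
    rw [this, neg_neg]
  rw [traceForm_apply, trace, map_sum, ← Finset.sum_neg_distrib]
  refine Finset.sum_congr rfl fun i _ => ?_
  rw [diag_apply, mul_apply, map_sum, ← Finset.sum_neg_distrib]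
  refine Finset.sum_congr rfl fun j _ => ?_
  rw [h i j, mul_neg, map_neg, neg_neg, RCLike.star_def, RCLike.mul_conj]
  norm_cast

theorem traceForm_self_pos (hX : Xᴴ = -X) (h0 : X ≠ 0) : 0 < traceForm 𝕜 ι X X := by
  rw [traceForm_self hX]
  have h1 (i j : ι) : 0 ≤ ‖X i j‖ ^ 2 := sq_nonneg _
  obtain ⟨i, j, hij⟩ : ∃ i j, X i j ≠ 0 := by
    by_contra! h
    exact h0 (by ext i j; exact h i j)
  refine Finset.sum_pos' (fun i _ => Finset.sum_nonneg fun j _ => h1 i j) ⟨i, Finset.mem_univ _, ?_⟩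
  exact Finset.sum_pos' (fun j _ => h1 i j) ⟨j, Finset.mem_univ _, by positivity⟩

/-- A skew-Hermitian matrix orthogonal to all skew-Hermitian matrices supported on `S` has a
vanishing block on `S`. -/
theorem block_eq_zero_of_orthogonal (hX : Xᴴ = -X) (h : ∀ η ∈ skewOn 𝕜 S, traceForm 𝕜 ι X η = 0) :
    block S X = 0 := by
  by_contra h0
  have hm := block_mem_skewOn (S := S) hX
  have h1 := traceForm_self_pos hm.1 h0
  rw [traceForm_block, hm.2, h _ hm] at h1
  exact lt_irrefl _ h1

/-! ### Traces of powers of diagonal blocks -/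

/-- The function `-Re (c tr (x_S ^ (m + 1))) / (m + 1)` of the diagonal block `x_S`. -/
noncomputable def tracePow (S : Finset ι) (m : ℕ) (c : 𝕜) (x : Matrix ι ι 𝕜) : ℝ :=
  -RCLike.re (c * trace (block S x ^ (m + 1))) / (m + 1)

/-- The gradient `c x_S ^ m` of `tracePow S m c` for the trace form; the zeroth power of a block
on `S` is the projection onto `S`. -/
noncomputable def blockPow (S : Finset ι) (m : ℕ) (c : 𝕜) (x : Matrix ι ι 𝕜) : Matrix ι ι 𝕜 :=
  c • (coordProj 𝕜 S * block S x ^ m)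

/-- The coefficients `c` for which `c x ^ m` is skew-Hermitian for all skew-Hermitian `x`. -/
def IsSkewCoeff (m : ℕ) (c : 𝕜) : Prop := star c = (-1) ^ (m + 1) * c

theorem coordProj_comm_block_pow (m : ℕ) :
    coordProj 𝕜 S * block S x ^ m = block S x ^ m * coordProj 𝕜 S := by
  have : Commute (coordProj 𝕜 S) (block S x) := by
    rw [Commute, SemiconjBy, coordProj_mul_block, block_mul_coordProj]
  exact this.pow_right m

theorem conjTranspose_pow_of_skew (hX : Xᴴ = -X) (m : ℕ) :
    (X ^ m)ᴴ = (-1 : 𝕜) ^ m • X ^ m := by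
  rw [conjTranspose_pow, hX, neg_pow]
  rcases Nat.even_or_odd m with h | h <;> simp [h.neg_one_pow]

theorem blockPow_mem {m : ℕ} {c : 𝕜} (hx : xᴴ = -x) (hc : IsSkewCoeff m c) :
    blockPow S m c x ∈ skewOn 𝕜 S := by
  have hb := block_mem_skewOn (S := S) hx
  refine ⟨?_, ?_⟩
  · rw [blockPow, conjTranspose_smul, conjTranspose_mul, conjTranspose_coordProj,
      conjTranspose_pow_of_skew hb.1, smul_mul, smul_smul, hc, ← coordProj_comm_block_pow,
      ← neg_smul, mul_right_comm, ← pow_add]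
    congr 1
    rw [show m + 1 + m = 2 * m + 1 by ring, pow_succ, pow_mul]
    simp
  · rw [blockPow, block_def, Matrix.mul_smul, Matrix.smul_mul]
    congr 1
    rw [← mul_assoc, coordProj_mul_of_subset subset_rfl, mul_assoc, ← coordProj_comm_block_pow,
      ← mul_assoc, coordProj_mul_of_subset subset_rfl]

theorem blockPow_commute (m : ℕ) (c : 𝕜) : Commute (block S x) (blockPow S m c x) := by
  refine Commute.smul_right ?_ c
  refine Commute.mul_right ?_ (Commute.pow_right (Commute.refl _) m)
  rw [Commute, SemiconjBy, coordProj_mul_block, block_mul_coordProj]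

/-- The span of the skew-Hermitian multiples of powers of the block on `S`. -/
noncomputable def blockPowSpan (S : Finset ι) (x : Matrix ι ι 𝕜) : Submodule ℝ (Matrix ι ι 𝕜) :=
  Submodule.span ℝ {Z | ∃ m c, IsSkewCoeff m c ∧ Z = blockPow S m c x}

theorem blockPowSpan_le (hx : xᴴ = -x) : blockPowSpan S x ≤ skewOn 𝕜 S :=
  Submodule.span_le.2 (by rintro _ ⟨m, c, hc, rfl⟩; exact blockPow_mem hx hc)

theorem traceForm_lie_blockPowSpan (hx : xᴴ = -x) (hζ : ζ ∈ blockPowSpan S x)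
    (hη : block S η = η) : traceForm 𝕜 ι x ⁅ζ, η⁆ = 0 := by
  induction hζ using Submodule.span_induction with
  | mem ζ hζ =>
    obtain ⟨m, c, hc, rfl⟩ := hζ
    have hb := (blockPow_mem (S := S) hx hc).2
    rw [traceForm_lie, ← hη, ← traceForm_block, Ring.lie_def]
    set ζ := blockPow S m c x with hζ
    have e1 : block S (x * ζ) = block S x * ζ := by
      rw [← hb, block_def S (x * _), block_def S x, block_def S ζ]
      simp only [mul_assoc, coordProj_mul_coordProj_mul, coordProj_mul_of_subset subset_rfl]
    have e2 : block S (ζ * x) = ζ * block S x := by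
      rw [← hb, block_def S (_ * x), block_def S x, block_def S ζ]
      simp only [mul_assoc, coordProj_mul_coordProj_mul]
    rw [map_sub, e1, e2, (blockPow_commute m c).eq, sub_self, map_zero, LinearMap.zero_apply]
  | zero => simp
  | add a b _ _ ha hb => rw [ring_add_lie, map_add, ha, hb, add_zero]
  | smul r a _ ha => rw [ring_smul_lie, map_smul, ha, smul_zero]

theorem traceForm_lie_blockPow_blockPow (hx : xᴴ = -x) (h : S ⊆ S') {m m' : ℕ} {c c' : 𝕜}
    (hc : IsSkewCoeff m c) (hc' : IsSkewCoeff m' c') :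
    traceForm 𝕜 ι x ⁅blockPow S' m' c' x, blockPow S m c x⁆ = 0 :=
  traceForm_lie_blockPowSpan hx (Submodule.subset_span ⟨m', c', hc', rfl⟩)
    (skewOn_mono h (blockPow_mem hx hc)).2

/-- The real part of a multiple of the trace, as a linear functional. -/
noncomputable def reTrace (c : 𝕜) : Matrix ι ι 𝕜 →ₗ[ℝ] ℝ where
  toFun X := RCLike.re (c * trace X)
  map_add' X Y := by rw [trace_add, mul_add, map_add]
  map_smul' r X := by
    rw [trace_smul, mul_smul_comm, RCLike.smul_re, RingHom.id_apply, smul_eq_mul]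

theorem tracePow_mem (S : Finset ι) (m : ℕ) (c : 𝕜) :
    tracePow S m c ∈ polynomialFunctions (Matrix ι ι 𝕜) := by
  have : FiniteDimensional ℝ (Matrix ι ι 𝕜) := Module.Finite.trans 𝕜 _
  have h := pow_polynomial (f := fun x : Matrix ι ι 𝕜 => block S x)
    (fun l => linear_mem_polynomialFunctions (l ∘ₗ block S)) (m + 1) (reTrace c)
  have e : tracePow S m c = (-1 / ((m : ℝ) + 1)) • fun x => reTrace c (block S x ^ (m + 1)) := by
    ext x
    simp only [tracePow, reTrace, LinearMap.coe_mk, AddHom.coe_mk, Pi.smul_apply, smul_eq_mul]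
    ring
  rw [e]
  exact Subalgebra.smul_mem _ h _

theorem tracePow_conj (m : ℕ) (c : 𝕜) (u : (Matrix ι ι 𝕜)ˣ)
    (hu : (u : Matrix ι ι 𝕜) * coordProj 𝕜 S = coordProj 𝕜 S * u) (x : Matrix ι ι 𝕜) :
    tracePow S m c ((u : Matrix ι ι 𝕜) * x * ((u⁻¹ : (Matrix ι ι 𝕜)ˣ) : Matrix ι ι 𝕜)) =
      tracePow S m c x := by
  have hu' : ((u⁻¹ : (Matrix ι ι 𝕜)ˣ) : Matrix ι ι 𝕜) * coordProj 𝕜 S =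
      coordProj 𝕜 S * ((u⁻¹ : (Matrix ι ι 𝕜)ˣ) : Matrix ι ι 𝕜) := by
    rw [Units.inv_mul_eq_iff_eq_mul, ← mul_assoc, hu, mul_assoc, Units.mul_inv, mul_one]
  have e : block S ((u : Matrix ι ι 𝕜) * x * ((u⁻¹ : (Matrix ι ι 𝕜)ˣ) : Matrix ι ι 𝕜)) =
      (u : Matrix ι ι 𝕜) * block S x * ((u⁻¹ : (Matrix ι ι 𝕜)ˣ) : Matrix ι ι 𝕜) := by
    rw [block_def, block_def, ← mul_assoc, ← mul_assoc, ← hu, mul_assoc _ _ (coordProj 𝕜 S), hu']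
    simp only [mul_assoc]
  rw [tracePow, tracePow, e, Units.conj_pow, trace_mul_comm, Units.inv_mul_cancel_left]

end Blocks

section BlocksDerivative

open Matrix

variable {𝕜 : Type*} [RCLike 𝕜] {ι : Type*} [Fintype ι] [DecidableEq ι]

attribute [local instance] Matrix.linftyOpNormedRing Matrix.linftyOpNormedAlgebra

theorem hasDerivAt_tracePow (S : Finset ι) (m : ℕ) (c : 𝕜) (x w : Matrix ι ι 𝕜) :
    HasDerivAt (fun t : ℝ => tracePow S m c (x + t • w))
      (traceForm 𝕜 ι (blockPow S m c x) w) 0 := by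
  have : FiniteDimensional ℝ (Matrix ι ι 𝕜) := Module.Finite.trans 𝕜 _
  have h := hasDerivAt_trace_pow (reTrace c)
    (fun a b => by
      change RCLike.re (c * trace (a * b)) = RCLike.re (c * trace (b * a))
      rw [trace_mul_comm])
    (block S x) (block S w) m
  have h2 := (h.neg).div_const ((m : ℝ) + 1)
  have hm : ((m : ℝ) + 1) ≠ 0 := by positivity
  have e : traceForm 𝕜 ι (blockPow S m c x) w =
      -(((m : ℝ) + 1) * reTrace c (block S x ^ m * block S w)) / (m + 1) := by
    rw [neg_div, mul_div_cancel_left₀ _ hm, traceForm_apply, blockPow, smul_mul, trace_smul,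
      smul_eq_mul]
    simp only [reTrace, LinearMap.coe_mk, AddHom.coe_mk]
    congr 3
    rw [block_def S w, ← mul_assoc, ← mul_assoc, trace_mul_comm _ (coordProj 𝕜 S), ← mul_assoc,
      ← mul_assoc, coordProj_comm_block_pow]
    simp only [mul_assoc, coordProj_mul_coordProj_mul]
  rw [e]
  refine h2.congr_of_eventuallyEq (Filter.Eventually.of_forall fun t => ?_)
  change -RCLike.re (c * trace (block S (x + t • w) ^ (m + 1))) / ((m : ℝ) + 1) =
    -RCLike.re (c * trace ((block S x + t • block S w) ^ (m + 1))) / ((m : ℝ) + 1)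
  rw [map_add, map_smul]

end BlocksDerivative

/-! ### Matrices on a subset of the indices -/

section Embedding

open Matrix

variable {𝕜 : Type*} [RCLike 𝕜] {ι κ : Type*} [DecidableEq ι]

variable (𝕜) in
/-- The matrix of the inclusion of coordinate spaces given by an injection of index types. -/
def inclusion (e : κ ↪ ι) : Matrix ι κ 𝕜 := of fun i k => if i = e k then 1 else 0

section

variable [Fintype κ]

theorem inclusion_mul_conjTranspose (e : κ ↪ ι) :
    inclusion 𝕜 e * (inclusion 𝕜 e)ᴴ = coordProj 𝕜 (Finset.univ.map e) := by
  ext i j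
  rw [mul_apply, coordProj, diagonal_apply]
  simp only [inclusion, of_apply, conjTranspose_apply]
  by_cases hi : ∃ k, e k = i
  · obtain ⟨k, rfl⟩ := hi
    rw [Finset.sum_eq_single k (fun l _ hl => by simp [hl.symm]) (by simp)]
    simp [apply_ite, eq_comm]
  · have h1 (k : κ) : i ≠ e k := fun h => hi ⟨k, h.symm⟩
    have h2 : ¬∃ k, e k = i := hi
    simp [h1, h2]

/-- Extension by zero of a matrix along an injection of index types. -/
noncomputable def extend (e : κ ↪ ι) : Matrix κ κ 𝕜 →ₗ[ℝ] Matrix ι ι 𝕜 where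
  toFun X := inclusion 𝕜 e * X * (inclusion 𝕜 e)ᴴ
  map_add' X Y := by rw [Matrix.mul_add, Matrix.add_mul]
  map_smul' r X := by simp

variable (e : κ ↪ ι)

theorem extend_def (X : Matrix κ κ 𝕜) :
    extend e X = inclusion 𝕜 e * X * (inclusion 𝕜 e)ᴴ := rfl

theorem extend_one [DecidableEq κ] :
    extend e (1 : Matrix κ κ 𝕜) = coordProj 𝕜 (Finset.univ.map e) := by
  rw [extend_def, Matrix.mul_one, inclusion_mul_conjTranspose]

theorem extend_smul (c : 𝕜) (X : Matrix κ κ 𝕜) : extend e (c • X) = c • extend e X := by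
  simp [extend_def]

theorem conjTranspose_extend (X : Matrix κ κ 𝕜) : (extend e X)ᴴ = extend e Xᴴ := by
  simp only [extend_def, conjTranspose_mul, conjTranspose_conjTranspose, Matrix.mul_assoc]

end

section

variable [Fintype ι]

/-- The submatrix selected by an injection of index types. -/
noncomputable def restrict (e : κ ↪ ι) : Matrix ι ι 𝕜 →ₗ[ℝ] Matrix κ κ 𝕜 where
  toFun X := (inclusion 𝕜 e)ᴴ * X * inclusion 𝕜 e
  map_add' X Y := by rw [Matrix.mul_add, Matrix.add_mul]
  map_smul' r X := by simp

variable (e : κ ↪ ι)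

theorem conjTranspose_inclusion_mul [DecidableEq κ] : (inclusion 𝕜 e)ᴴ * inclusion 𝕜 e = 1 := by
  ext k l
  simp [inclusion, mul_apply, one_apply, apply_ite, eq_comm]

theorem restrict_def (X : Matrix ι ι 𝕜) :
    restrict e X = (inclusion 𝕜 e)ᴴ * X * inclusion 𝕜 e := rfl

theorem restrict_apply (X : Matrix ι ι 𝕜) (k l : κ) : restrict e X k l = X (e k) (e l) := by
  simp [restrict_def, inclusion, mul_apply, apply_ite]

theorem conjTranspose_restrict (X : Matrix ι ι 𝕜) : (restrict e X)ᴴ = restrict e Xᴴ := by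
  simp only [restrict_def, conjTranspose_mul, conjTranspose_conjTranspose, Matrix.mul_assoc]

end

variable [Fintype ι] [Fintype κ] (e : κ ↪ ι)

theorem extend_restrict (X : Matrix ι ι 𝕜) :
    extend e (restrict e X) = block (Finset.univ.map e) X := by
  rw [restrict_def, extend_def, block_def, ← inclusion_mul_conjTranspose]
  simp only [Matrix.mul_assoc]

variable [DecidableEq κ]

theorem traceForm_extend (X : Matrix κ κ 𝕜) (Y : Matrix ι ι 𝕜) :
    traceForm 𝕜 ι (extend e X) Y = traceForm 𝕜 κ X (restrict e Y) := by
  rw [traceForm_apply, traceForm_apply, extend_def, restrict_def, Matrix.mul_assoc,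
    Matrix.mul_assoc, trace_mul_comm]
  simp only [Matrix.mul_assoc]

theorem restrict_extend (X : Matrix κ κ 𝕜) : restrict e (extend e X) = X := by
  rw [restrict_def, extend_def]
  calc (inclusion 𝕜 e)ᴴ * (inclusion 𝕜 e * X * (inclusion 𝕜 e)ᴴ) * inclusion 𝕜 e
      = ((inclusion 𝕜 e)ᴴ * inclusion 𝕜 e) * X * ((inclusion 𝕜 e)ᴴ * inclusion 𝕜 e) := by
        simp only [Matrix.mul_assoc]
    _ = X := by rw [conjTranspose_inclusion_mul, one_mul, mul_one]

theorem extend_mul (X Y : Matrix κ κ 𝕜) : extend e (X * Y) = extend e X * extend e Y := by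
  simp only [extend_def]
  calc inclusion 𝕜 e * (X * Y) * (inclusion 𝕜 e)ᴴ
      = inclusion 𝕜 e * X * (1 : Matrix κ κ 𝕜) * Y * (inclusion 𝕜 e)ᴴ := by
        simp only [Matrix.mul_assoc, Matrix.one_mul]
    _ = inclusion 𝕜 e * X * (inclusion 𝕜 e)ᴴ * (inclusion 𝕜 e * Y * (inclusion 𝕜 e)ᴴ) := by
        rw [← conjTranspose_inclusion_mul e]
        simp only [Matrix.mul_assoc]

theorem extend_pow (X : Matrix κ κ 𝕜) (m : ℕ) :
    extend e (X ^ m) = coordProj 𝕜 (Finset.univ.map e) * extend e X ^ m := by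
  induction m with
  | zero => rw [pow_zero, extend_one, pow_zero, mul_one]
  | succ m ih => rw [pow_succ, extend_mul, ih, pow_succ, mul_assoc]

theorem extend_lie (X Y : Matrix κ κ 𝕜) : extend e ⁅X, Y⁆ = ⁅extend e X, extend e Y⁆ := by
  rw [Ring.lie_def, map_sub, extend_mul, extend_mul, Ring.lie_def]

theorem block_extend (X : Matrix κ κ 𝕜) :
    block (Finset.univ.map e) (extend e X) = extend e X := by
  rw [← extend_restrict, restrict_extend]

theorem extend_mem_skewOn {X : Matrix κ κ 𝕜} (hX : Xᴴ = -X) :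
    extend e X ∈ skewOn 𝕜 (Finset.univ.map e) :=
  ⟨by rw [conjTranspose_extend, hX, map_neg], block_extend e X⟩

theorem blockPow_of_block_eq_extend {x : Matrix ι ι 𝕜} {a : Matrix κ κ 𝕜}
    (h : block (Finset.univ.map e) x = extend e a) (m : ℕ) (c : 𝕜) :
    blockPow (Finset.univ.map e) m c x = extend e (c • a ^ m) := by
  rw [blockPow, h, ← extend_pow, extend_smul]

end Embedding

/-! ### Adding one index -/

section Step

open Matrix

variable {𝕜 : Type*} [RCLike 𝕜] {ι : Type} [Fintype ι] [DecidableEq ι] {S : Finset ι}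

theorem coordProj_mulVec (v : ι → 𝕜) (i : ι) :
    (coordProj 𝕜 S *ᵥ v) i = if i ∈ S then v i else 0 := by
  simp [coordProj, mulVec_diagonal]

theorem HasBordering.exists_vector (h : HasBordering 𝕜) {A : Matrix ι ι 𝕜}
    (hA : A ∈ skewOn 𝕜 S) :
    ∃ β : ι → 𝕜, coordProj 𝕜 S *ᵥ β = β ∧ ∀ (Y : Matrix ι ι 𝕜) (c : ι → 𝕜),
      coordProj 𝕜 S *ᵥ c = c →
      A * Y - Y * A = vecMulVec β (star c) - vecMulVec c (star β) →
        ∃ (p : ℕ → 𝕜) (N : ℕ), (∀ j, star (p j) = (-1) ^ j * p j) ∧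
          c = ∑ j ∈ Finset.range N, p j • (A ^ j *ᵥ β) := by
  let e : S ↪ ι := Function.Embedding.subtype _
  have he : Finset.univ.map e = S := Finset.attach_map_val
  let V : Matrix ι S 𝕜 := inclusion 𝕜 e
  have hV : Vᴴ * V = 1 := conjTranspose_inclusion_mul e
  have hP : V * Vᴴ = coordProj 𝕜 S := by
    have h := inclusion_mul_conjTranspose (𝕜 := 𝕜) e
    rwa [he] at h
  have hAP : A * coordProj 𝕜 S = A := by rw [← hA.2, block_mul_coordProj]
  have hPA : coordProj 𝕜 S * A = A := by rw [← hA.2, coordProj_mul_block]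
  let A' : Matrix S S 𝕜 := Vᴴ * A * V
  have hA' : A'ᴴ = -A' := by
    simp [A', conjTranspose_mul, hA.1, Matrix.mul_assoc]
  have hVA : V * A' = A * V := by
    simp only [A', ← Matrix.mul_assoc, hP, hPA]
  obtain ⟨b, hb⟩ := h A' hA'
  have hVb : Vᴴ *ᵥ (V *ᵥ b) = b := by rw [mulVec_mulVec, hV, one_mulVec]
  refine ⟨V *ᵥ b, ?_, fun Y c hc hY => ?_⟩
  · rw [← hP, ← mulVec_mulVec, hVb]
  obtain ⟨p, N, hp, hcp⟩ := hb (Vᴴ * Y * V) (Vᴴ *ᵥ c) (by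
    have h1 : A' * (Vᴴ * Y * V) = Vᴴ * (A * Y) * V := by
      calc _ = Vᴴ * (A * (V * Vᴴ)) * Y * V := by simp only [A', Matrix.mul_assoc]
        _ = _ := by rw [hP, hAP]; simp only [Matrix.mul_assoc]
    have h2 : Vᴴ * Y * V * A' = Vᴴ * (Y * A) * V := by
      calc _ = Vᴴ * Y * ((V * Vᴴ) * A) * V := by simp only [A', Matrix.mul_assoc]
        _ = _ := by rw [hP, hPA]; simp only [Matrix.mul_assoc]
    have h3 (u v : ι → 𝕜) :
        Vᴴ * vecMulVec u (star v) * V = vecMulVec (Vᴴ *ᵥ u) (star (Vᴴ *ᵥ v)) := by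
      rw [mul_vecMulVec, vecMulVec_mul, star_mulVec, conjTranspose_conjTranspose]
    rw [h1, h2, ← Matrix.sub_mul, ← Matrix.mul_sub, hY, Matrix.mul_sub, Matrix.sub_mul, h3, h3,
      hVb])
  refine ⟨p, N, hp, ?_⟩
  have hpow (j : ℕ) : V *ᵥ (A' ^ j *ᵥ b) = A ^ j *ᵥ (V *ᵥ b) := by
    induction j with
    | zero => simp
    | succ j ih =>
      rw [pow_succ', ← mulVec_mulVec, mulVec_mulVec, hVA, ← mulVec_mulVec, ih, mulVec_mulVec,
        pow_succ']
  rw [← hc, ← hP, ← mulVec_mulVec, hcp, mulVec_sum]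
  simp only [mulVec_smul, hpow]

/-- The entry of a power of a bordered matrix in the new column. -/
theorem coordProj_pow_mulVec {A y : Matrix ι ι 𝕜} {β ε : ι → 𝕜}
    (hAP : A * coordProj 𝕜 S = A) (hy : coordProj 𝕜 S * y = A + vecMulVec β (star ε))
    (hAε : A *ᵥ ε = 0) (hε : star ε ⬝ᵥ ε = 1) (j : ℕ) :
    coordProj 𝕜 S *ᵥ (y ^ (j + 1) *ᵥ ε) =
      ∑ l ∈ Finset.range (j + 1), (star ε ⬝ᵥ (y ^ (j - l) *ᵥ ε)) • (A ^ l *ᵥ β) := by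
  have hv (u : ι → 𝕜) : coordProj 𝕜 S *ᵥ (y *ᵥ u) = A *ᵥ u + (star ε ⬝ᵥ u) • β := by
    rw [mulVec_mulVec, hy, add_mulVec, vecMulVec_mulVec]
    simp
  induction j with
  | zero => simp [hv, hAε, hε]
  | succ j ih =>
    rw [pow_succ' y (j + 1), ← mulVec_mulVec, hv, Finset.sum_range_succ', ← hAP, ← mulVec_mulVec,
      ih, mulVec_sum, hAP]
    simp only [mulVec_smul, Nat.sub_zero, pow_zero, one_mulVec, Nat.reduceSubDiff]
    congr 1
    refine Finset.sum_congr rfl fun l _ => ?_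
    rw [mulVec_mulVec, ← pow_succ']

/-- Multiplicity freeness of the pair of unitary (orthogonal) Lie algebras on `S` and on `S` with
one more index, at a suitable point that extends any given one. The given matrix is bordered by a
vector `β` that sees all its eigenvalues. If `ξ` is orthogonal to the smaller Lie algebra, the
bordering property expresses the new column of `ξ` through the vectors `A ^ j β`, which are also the
new columns of combinations of powers of the block; subtracting these from `ξ` leaves a matrix with
no off-diagonal entries in the new row and column. -/
theorem HasBordering.exists_isMultiplicityFree (h : HasBordering 𝕜) {s : ι} (hs : s ∉ S)
    {A : Matrix ι ι 𝕜} (hA : A ∈ skewOn 𝕜 S) :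
    ∃ y ∈ skewOn 𝕜 (insert s S), block S y = A ∧ y s s = 0 ∧
      ∀ x : Matrix ι ι 𝕜, xᴴ = -x → block (insert s S) x = y →
        IsMultiplicityFree (traceForm 𝕜 ι x) (skewOn 𝕜 S) (skewOn 𝕜 (insert s S))
          (blockPowSpan (insert s S) x) := by
  obtain ⟨β, hβ, hstep⟩ := h.exists_vector hA
  set P := coordProj 𝕜 S with hPdef
  set P' := coordProj 𝕜 (insert s S) with hP'def
  have hSS : S ⊆ insert s S := Finset.subset_insert s S
  have hAP : A * P = A := by rw [← hA.2, block_mul_coordProj]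
  have hPA : P * A = A := by rw [← hA.2, coordProj_mul_block]
  have hPs : Pᴴ = P := conjTranspose_coordProj
  let ε : ι → 𝕜 := Pi.single s 1
  have hPε : P *ᵥ ε = 0 := by
    ext i
    rw [coordProj_mulVec]
    by_cases hi : i ∈ S
    · have : i ≠ s := fun h => hs (h ▸ hi)
      simp [ε, this]
    · simp [hi]
  have hAε : A *ᵥ ε = 0 := by rw [← hAP, ← mulVec_mulVec, hPε, mulVec_zero]
  have hεP : star ε ᵥ* P = 0 := by
    rw [← hPs, ← star_mulVec, hPε, star_zero]
  have hβP : star β ᵥ* P = star β := by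
    rw [← hPs, ← star_mulVec, hβ]
  have hεε : star ε ⬝ᵥ ε = 1 := by simp [ε]
  have hεM (M : Matrix ι ι 𝕜) : star ε ⬝ᵥ (M *ᵥ ε) = M s s := by
    simp [ε]
  let y : Matrix ι ι 𝕜 := A + vecMulVec β (star ε) - vecMulVec ε (star β)
  have hPy : P * y = A + vecMulVec β (star ε) := by
    simp only [y, mul_sub, mul_add, mul_vecMulVec, hPA, hβ, hPε, zero_vecMulVec, sub_zero]
  have hyP : y * P = A - vecMulVec ε (star β) := by
    simp only [y, sub_mul, add_mul, vecMulVec_mul, hAP, hεP, hβP, vecMulVec_zero, add_zero]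
  have hys : yᴴ = -y := by
    simp only [y, conjTranspose_sub, conjTranspose_add, conjTranspose_vecMulVec, star_star, hA.1]
    abel
  have hP'ε : P' *ᵥ ε = ε := by
    ext i
    rw [coordProj_mulVec]
    by_cases hi : i = s
    · simp [hi]
    · simp [ε, hi]
  have hP'P : P' * P = P := mul_coordProj_of_subset hSS
  have hPP' : P * P' = P := coordProj_mul_of_subset hSS
  have hP's : P'ᴴ = P' := conjTranspose_coordProj
  have hP'β : P' *ᵥ β = β := by rw [← hβ, mulVec_mulVec, hP'P]
  have hβP' : star β ᵥ* P' = star β := by rw [← hP's, ← star_mulVec, hP'β]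
  have hεP' : star ε ᵥ* P' = star ε := by rw [← hP's, ← star_mulVec, hP'ε]
  have hy : y ∈ skewOn 𝕜 (insert s S) := by
    refine ⟨hys, ?_⟩
    have h1 : P' * A * P' = A := by
      rw [← hPA, ← mul_assoc, hP'P, hPA, ← hAP, mul_assoc, hPP', hAP]
    rw [block_def, ← hP'def]
    simp only [y, mul_sub, mul_add, sub_mul, add_mul, mul_vecMulVec, vecMulVec_mul, h1, hP'β, hP'ε,
      hβP', hεP']
  have hβs : β s = 0 := by
    rw [← hβ, coordProj_mulVec, if_neg hs]
  refine ⟨y, hy, ?_, ?_, fun x hx hxy => ?_⟩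
  · rw [block_def, ← hPdef, hPy, add_mul, vecMulVec_mul, hAP, hεP, vecMulVec_zero, add_zero]
  · have : A s s = 0 := by rw [← hA.2, block_apply]; simp [hs]
    simp [y, vecMulVec_apply, this, hβs]
  intro ξ hξ horth
  have hξP' : P' * ξ = ξ := by rw [← hξ.2, coordProj_mul_block]
  have hP'ξ : ξ * P' = ξ := by rw [← hξ.2, block_mul_coordProj]
  let c : ι → 𝕜 := P *ᵥ (ξ *ᵥ ε)
  have hc : P *ᵥ c = c := by
    simp only [c, mulVec_mulVec, ← mul_assoc, hPdef, coordProj_mul_of_subset subset_rfl]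
  -- orthogonality to `𝔲(S)` means that the block on `S` of the commutator vanishes
  have hblock : P * (y * ξ - ξ * y) * P = 0 := by
    have h0 : block S ⁅x, ξ⁆ = 0 := by
      refine block_eq_zero_of_orthogonal ?_ fun η hη => ?_
      · rw [Ring.lie_def, conjTranspose_sub, conjTranspose_mul, conjTranspose_mul, hx, hξ.1]
        noncomm_ring
      · rw [← traceForm_lie]
        exact horth η hη
    rw [block_def, ← hPdef, Ring.lie_def] at h0
    rw [← hxy, block_def, ← hP'def, ← h0]
    have h1 : P * (P' * x * P' * ξ) * P = P * (x * ξ) * P := by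
      calc _ = (P * P') * x * (P' * ξ) * P := by simp only [mul_assoc]
        _ = _ := by rw [hPP', hξP']; simp only [mul_assoc]
    have h2 : P * (ξ * (P' * x * P')) * P = P * (ξ * x) * P := by
      calc _ = P * (ξ * P') * x * (P' * P) := by simp only [mul_assoc]
        _ = _ := by rw [hP'P, hP'ξ]; simp only [mul_assoc]
    rw [mul_sub, sub_mul, h1, h2, mul_sub, sub_mul]
  obtain ⟨p, N, hp, hcp⟩ := hstep (P * ξ * P) c hc (by
    have h1 : star ε ᵥ* (ξ * P) = -star c := by
      have : ξ * P = -(P * ξ)ᴴ := by rw [conjTranspose_mul, hξ.1, hPs, neg_mul, neg_neg]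
      rw [this, vecMul_neg, ← star_mulVec]
      simp only [c, mulVec_mulVec]
    have h2 : P * y * ξ * P = A * (P * ξ * P) - vecMulVec β (star c) := by
      rw [hPy, add_mul, add_mul, mul_assoc (vecMulVec β _), vecMulVec_mul, h1, vecMulVec_neg,
        ← sub_eq_add_neg, ← mul_assoc A, ← mul_assoc A, hAP]
    have h3 : P * ξ * (y * P) = P * ξ * P * A - vecMulVec c (star β) := by
      rw [hyP, mul_sub, mul_vecMulVec, ← mulVec_mulVec, mul_assoc (P * ξ) P A, hPA]
    have h4 : P * (y * ξ - ξ * y) * P = P * y * ξ * P - P * ξ * (y * P) := by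
      simp only [mul_sub, sub_mul, mul_assoc]
    rw [h4, h2, h3] at hblock
    rw [← sub_eq_zero, ← hblock]
    abel)
  have hγ (m : ℕ) : star ((y ^ m) s s) = (-1) ^ m * (y ^ m) s s := by
    have := congrFun (congrFun (conjTranspose_pow_of_skew hys m) s) s
    simpa using this
  -- every vector that can occur in the new column comes from a power of the block
  have hcol (j : ℕ) : ∀ q : 𝕜, star q = (-1) ^ j * q →
      ∃ Z ∈ blockPowSpan (insert s S) x, P *ᵥ (Z *ᵥ ε) = q • (A ^ j *ᵥ β) := by
    induction j using Nat.strong_induction_on with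
    | _ j ih =>
      intro q hq
      have hlow (l : ℕ) (hl : l < j) : ∃ Z ∈ blockPowSpan (insert s S) x,
          P *ᵥ (Z *ᵥ ε) = (q * (y ^ (j - l)) s s) • (A ^ l *ᵥ β) := by
        refine ih l hl _ ?_
        rw [star_mul', hq, hγ]
        have : (-1 : 𝕜) ^ j * (-1) ^ (j - l) = (-1) ^ l := by
          rw [← pow_add, show j + (j - l) = 2 * (j - l) + l by omega, pow_add, pow_mul]
          simp
        linear_combination q * (y ^ (j - l)) s s * this
      choose! Z hZ hZε using hlow
      refine ⟨blockPow (insert s S) (j + 1) q x - ∑ l ∈ Finset.range j, Z l,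
        sub_mem (Submodule.subset_span ⟨j + 1, q, ?_, rfl⟩)
          (sum_mem fun l hl => hZ l (Finset.mem_range.1 hl)), ?_⟩
      · rw [IsSkewCoeff, hq]
        ring
      · have h1 : P *ᵥ (blockPow (insert s S) (j + 1) q x *ᵥ ε) =
            q • (P *ᵥ (y ^ (j + 1) *ᵥ ε)) := by
          rw [blockPow, hxy, ← hP'def, smul_mulVec, mulVec_smul, mulVec_mulVec, ← mul_assoc, hPP',
            mulVec_mulVec]
        have h2 : P *ᵥ ((∑ l ∈ Finset.range j, Z l) *ᵥ ε) =
            ∑ l ∈ Finset.range j, (q * (y ^ (j - l)) s s) • (A ^ l *ᵥ β) := by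
          rw [sum_mulVec, mulVec_sum]
          exact Finset.sum_congr rfl fun l hl => hZε l (Finset.mem_range.1 hl)
        rw [sub_mulVec, mulVec_sub, h1, h2, coordProj_pow_mulVec hAP hPy hAε hεε,
          Finset.sum_range_succ, smul_add, Finset.smul_sum]
        simp only [hεM, smul_smul]
        simp
  choose Z hZ hZε using fun j => hcol j (p j) (hp j)
  set W := ∑ j ∈ Finset.range N, Z j with hW
  have hWm : W ∈ blockPowSpan (insert s S) x := sum_mem fun j _ => hZ j
  have hWε : P *ᵥ (W *ᵥ ε) = c := by
    rw [hW, sum_mulVec, mulVec_sum, hcp]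
    exact Finset.sum_congr rfl fun j _ => hZε j
  set ζ := ξ - W with hζ
  have hζm : ζ ∈ skewOn 𝕜 (insert s S) := sub_mem hξ (blockPowSpan_le hx hWm)
  have hζε : P *ᵥ (ζ *ᵥ ε) = 0 := by
    rw [hζ, sub_mulVec, mulVec_sub, hWε, sub_self]
  set γ := ζ s s with hγdef
  have hsk (i j : ι) : ζ i j = -star (ζ j i) := by
    have := congrFun (congrFun hζm.1 i) j
    rw [conjTranspose_apply, Matrix.neg_apply] at this
    rw [this, neg_neg]
  have hγs : IsSkewCoeff 0 γ := by
    have := hsk s s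
    rw [← hγdef] at this
    rw [IsSkewCoeff]
    linear_combination this
  have hζs (i : ι) (hi : i ∈ S) : ζ i s = 0 := by
    have := congrFun hζε i
    rw [coordProj_mulVec, if_pos hi] at this
    simpa [ε] using this
  -- `ζ` is its block on `S` plus a multiple of the new diagonal matrix unit, which is the
  -- difference of the identity matrices of the two blocks
  have hdecomp : ζ = block S ζ + blockPow (insert s S) 0 γ x - blockPow S 0 γ x := by
    ext i j
    have hz : ζ i j = if i ∈ insert s S ∧ j ∈ insert s S then ζ i j else 0 := by
      rw [← block_apply, hζm.2]
    simp only [blockPow, pow_zero, mul_one, coordProj, Matrix.sub_apply, Matrix.add_apply,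
      Matrix.smul_apply, block_apply, diagonal_apply, smul_eq_mul]
    rw [hz]
    by_cases hi : i ∈ S
    · by_cases hj : j ∈ S
      · simp [hi, hj]
      · by_cases hjs : j = s
        · subst hjs
          simp [hi, hs, hζs i hi]
        · have : i ≠ j := fun h => hj (h ▸ hi)
          simp [hj, hjs, this]
    · by_cases his : i = s
      · subst his
        by_cases hj : j ∈ S
        · have : i ≠ j := fun h => hi (h ▸ hj)
          simp [hi, hj, this, hsk i j, hζs j hj]
        · by_cases hjs : j = i
          · subst hjs
            simp [hs, hγdef]
          · simp [hj, hjs, Ne.symm hjs]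
      · simp [hi, his]
  have hWγ : W + blockPow (insert s S) 0 γ x ∈ blockPowSpan (insert s S) x :=
    add_mem hWm (Submodule.subset_span ⟨0, γ, hγs, rfl⟩)
  have hdiff : ξ - (block S ζ - blockPow S 0 γ x) = W + blockPow (insert s S) 0 γ x := by
    have h1 : ξ = W + ζ := by rw [hζ]; abel
    conv_lhs => rw [h1]
    nth_rewrite 1 [hdecomp]
    abel
  refine ⟨block S ζ - blockPow S 0 γ x, sub_mem (block_mem_skewOn hζm.1) (blockPow_mem hx hγs),
    fun η hη => ?_, by rw [hdiff]; exact hWγ⟩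
  have h1 := traceForm_lie_blockPowSpan hx hWγ (skewOn_mono hSS hη).2
  rw [← hdiff] at h1
  have h2 := horth η hη
  have h3 : ξ = (ξ - (block S ζ - blockPow S 0 γ x)) + (block S ζ - blockPow S 0 γ x) := by abel
  rw [h3, ring_add_lie, map_add, h1, zero_add] at h2
  exact h2

end Step

/-! ### A chain of diagonal blocks -/

section BlockChain

variable {𝕜 : Type*} [RCLike 𝕜] {n : ℕ}

/-- The `i`-th set of a chain that starts with `S` and ends with all indices: `S` and all indices
below `i`. -/
def chainSet (S : Finset (Fin n)) (i : ℕ) : Finset (Fin n) :=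
  S ∪ Finset.univ.filter fun j => (j : ℕ) < i

theorem mem_chainSet {S : Finset (Fin n)} {i : ℕ} {j : Fin n} :
    j ∈ chainSet S i ↔ j ∈ S ∨ (j : ℕ) < i := by
  simp [chainSet]

theorem chainSet_mono (S : Finset (Fin n)) : Monotone (chainSet S) := fun i i' h j hj => by
  rw [mem_chainSet] at hj ⊢
  exact hj.imp_right fun h' => h'.trans_le h

theorem chainSet_zero (S : Finset (Fin n)) : chainSet S 0 = S := by
  ext j
  simp [mem_chainSet]

theorem chainSet_of_le (S : Finset (Fin n)) {i : ℕ} (hi : n ≤ i) : chainSet S i = Finset.univ := by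
  ext j
  simp [mem_chainSet, j.2.trans_le hi]

theorem subset_chainSet (S : Finset (Fin n)) (i : ℕ) : S ⊆ chainSet S i := fun j hj => by
  rw [mem_chainSet]
  exact Or.inl hj

/-- The first `i` steps of `HasBordering.exists_chain`. Multiplicity freeness of the earlier steps
is kept because it depends only on the block at which they were made. -/
theorem HasBordering.exists_chain_le (h : HasBordering 𝕜) {S : Finset (Fin n)}
    {a : Matrix (Fin n) (Fin n) 𝕜} (ha : a ∈ skewOn 𝕜 S) (i : ℕ) (hi : i ≤ n) :
    ∃ y ∈ skewOn 𝕜 (chainSet S i), block S y = a ∧ (∀ j ∉ S, y j j = 0) ∧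
      ∀ i' < i, ∀ x : Matrix (Fin n) (Fin n) 𝕜, xᴴ = -x → block (chainSet S i) x = y →
        IsMultiplicityFree (traceForm 𝕜 _ x) (skewOn 𝕜 (chainSet S i'))
          (skewOn 𝕜 (chainSet S (i' + 1))) (blockPowSpan (chainSet S (i' + 1)) x) := by
  induction i with
  | zero =>
    rw [chainSet_zero]
    refine ⟨a, ha, ha.2, fun j hj => ?_, fun i' hi' => absurd hi' (Nat.not_lt_zero _)⟩
    rw [← ha.2, block_apply]
    simp [hj]
  | succ i ih =>
    obtain ⟨y, hy, hya, hyd, hmf⟩ := ih (by omega)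
    let s : Fin n := ⟨i, hi⟩
    by_cases hs : s ∈ chainSet S i
    · have hsucc : chainSet S (i + 1) = chainSet S i := by
        refine le_antisymm (fun j hj => ?_) (chainSet_mono S (Nat.le_succ i))
        rw [mem_chainSet] at hj ⊢
        rcases hj with hj | hj
        · exact Or.inl hj
        · rcases Nat.lt_succ_iff_lt_or_eq.1 hj with hj | hj
          · exact Or.inr hj
          · have : j = s := Fin.ext hj
            rw [this]
            exact mem_chainSet.1 hs
      rw [hsucc]
      refine ⟨y, hy, hya, hyd, fun i' hi' x hx hxy => ?_⟩
      rcases Nat.lt_succ_iff_lt_or_eq.1 hi' with hi' | rfl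
      · exact hmf i' hi' x hx hxy
      · intro ξ hξ horth
        rw [hsucc] at hξ
        exact ⟨ξ, hξ, horth, by simp⟩
    · have hsucc : chainSet S (i + 1) = insert s (chainSet S i) := by
        ext j
        rw [Finset.mem_insert, mem_chainSet, mem_chainSet, Fin.ext_iff, Nat.lt_succ_iff_lt_or_eq]
        tauto
      obtain ⟨y', hy', hyy', hs0, hmf'⟩ := h.exists_isMultiplicityFree hs hy
      rw [hsucc]
      refine ⟨y', hy', ?_, fun j hj => ?_, fun i' hi' x hx hxy => ?_⟩
      · rw [← hya, ← hyy', block_block_of_subset' (subset_chainSet S i)]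
      · by_cases hjs : j = s
        · rw [hjs, hs0]
        · by_cases hji : j ∈ chainSet S i
          · have := hyd j hj
            rw [← hyy', block_apply] at this
            simpa [hji] using this
          · rw [← hy'.2, block_apply]
            simp [hji, hjs]
      · rcases Nat.lt_succ_iff_lt_or_eq.1 hi' with hi' | rfl
        · refine hmf i' hi' x hx ?_
          rw [← hyy', ← hxy, block_block_of_subset' (Finset.subset_insert _ _)]
        · rw [hsucc]
          exact hmf' x hx hxy

/-- Any skew-Hermitian matrix on `S` extends to a skew-Hermitian matrix at which all steps of the
chain from `S` to the set of all indices are multiplicity free. -/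
theorem HasBordering.exists_chain (h : HasBordering 𝕜) {S : Finset (Fin n)}
    {a : Matrix (Fin n) (Fin n) 𝕜} (ha : a ∈ skewOn 𝕜 S) :
    ∃ x : Matrix (Fin n) (Fin n) 𝕜, xᴴ = -x ∧ block S x = a ∧ (∀ j ∉ S, x j j = 0) ∧
      ∀ i, IsMultiplicityFree (traceForm 𝕜 _ x) (skewOn 𝕜 (chainSet S i))
          (skewOn 𝕜 (chainSet S (i + 1))) (blockPowSpan (chainSet S (i + 1)) x) := by
  obtain ⟨x, hx, hxa, hxd, hmf⟩ := h.exists_chain_le ha n le_rfl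
  rw [chainSet_of_le S le_rfl] at hx hmf
  refine ⟨x, hx.1, hxa, hxd, fun i => ?_⟩
  rcases lt_or_ge i n with hi | hi
  · exact hmf i hi x hx.1 hx.2
  · rw [chainSet_of_le S hi, chainSet_of_le S (hi.trans (Nat.le_succ i))]
    exact fun ξ hξ horth => ⟨ξ, hξ, horth, by simp⟩

end BlockChain

/-! ### Groups of matrices on one block -/

section Single

open Matrix

/-- A linear functional that is constant on a group vanishes on its Lie algebra. -/
theorem apply_eq_zero_of_mem_lieAlg {A : Type*} [NormedRing A] [NormedAlgebra ℝ A]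
    [FiniteDimensional ℝ A] {H : Subgroup Aˣ} (l : A →ₗ[ℝ] ℝ) (r : ℝ) (hl : ∀ u ∈ H, l (u : A) = r)
    {X : A} (hX : X ∈ lieAlg H) : l X = 0 := by
  have : CompleteSpace A := FiniteDimensional.complete ℝ A
  induction hX using Submodule.span_induction with
  | mem X hX =>
    have h1 := hasDerivAt_exp_smul_const X (0 : ℝ)
    have h2 := (LinearMap.toContinuousLinearMap l).hasFDerivAt.comp_hasDerivAt (0 : ℝ) h1
    have h3 : HasDerivAt (fun _ : ℝ => r) (l X) 0 := by
      have e : (fun _ : ℝ => r) = fun t : ℝ => l (NormedSpace.exp (t • X)) := by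
        ext t
        obtain ⟨u, hu, h⟩ := hX t
        rw [← h, hl u hu]
      rw [e]
      simpa using! h2
    exact h3.unique (hasDerivAt_const _ _)
  | zero => simp
  | add a b _ _ ha hb => rw [map_add, ha, hb, add_zero]
  | smul r a _ ha => rw [map_smul, ha, smul_zero]

attribute [local instance] Matrix.linftyOpNormedRing Matrix.linftyOpNormedAlgebra

variable {𝕜 : Type*} [RCLike 𝕜]

theorem map_apply_eq_zero_of_mem_lieAlg {ι : Type*} [Fintype ι] [DecidableEq ι]
    {H : Subgroup (Matrix ι ι 𝕜)ˣ} (l : 𝕜 →ₗ[ℝ] ℝ) {i j : ι}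
    (h : ∀ u ∈ H, l ((u : Matrix ι ι 𝕜) i j) = 0) {X : Matrix ι ι 𝕜} (hX : X ∈ lieAlg H) :
    l (X i j) = 0 := by
  have : FiniteDimensional ℝ (Matrix ι ι 𝕜) := Module.Finite.trans 𝕜 _
  exact apply_eq_zero_of_mem_lieAlg (l ∘ₗ Matrix.entryLinearMap ℝ 𝕜 i j) 0 h hX

/-- An entry that vanishes on the group vanishes on its Lie algebra. -/
theorem apply_apply_eq_zero_of_mem_lieAlg {ι : Type*} [Fintype ι] [DecidableEq ι]
    {H : Subgroup (Matrix ι ι 𝕜)ˣ} {i j : ι} (h : ∀ u ∈ H, (u : Matrix ι ι 𝕜) i j = 0)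
    {X : Matrix ι ι 𝕜} (hX : X ∈ lieAlg H) : X i j = 0 := by
  have h₁ := map_apply_eq_zero_of_mem_lieAlg (i := i) (j := j) (RCLike.reLm : 𝕜 →ₗ[ℝ] ℝ)
    (fun u hu => by simp [h u hu]) hX
  have h₂ := map_apply_eq_zero_of_mem_lieAlg (i := i) (j := j) (RCLike.imLm : 𝕜 →ₗ[ℝ] ℝ)
    (fun u hu => by simp [h u hu]) hX
  refine RCLike.ext ?_ ?_
  · simpa using h₁
  · simpa using h₂

/-- Matrices without entries that link `S` with its complement commute with the projection. -/
theorem mul_coordProj_comm {ι : Type*} [Fintype ι] [DecidableEq ι] {S : Finset ι}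
    {u : Matrix ι ι 𝕜} (h : ∀ i j, i ∈ S → j ∉ S → u i j = 0 ∧ u j i = 0) :
    u * coordProj 𝕜 S = coordProj 𝕜 S * u := by
  ext i j
  rw [coordProj, mul_diagonal, diagonal_mul]
  by_cases hi : i ∈ S <;> by_cases hj : j ∈ S <;> simp [hi, hj]
  · exact (h i j hi hj).1.symm
  · exact (h j i hj hi).2

/-- The index set of the traces of powers of the blocks of a chain: the number of the block, the
exponent and the coefficient. -/
abbrev PowIndex (𝕜 : Type*) [RCLike 𝕜] : Type _ :=
  ℕ × {p : ℕ × 𝕜 // IsSkewCoeff p.1 p.2}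

variable {n : ℕ}

/-- The gradients attached to two blocks of a chain commute under the trace form: both blocks of `x`
commute with their own powers, and one of them is contained in the other. -/
theorem traceForm_lie_chain {x : Mat n 𝕜} (hx : xᴴ = -x) (S : Finset (Fin n))
    (p q : PowIndex 𝕜) :
    traceForm 𝕜 _ x ⁅blockPow (chainSet S p.1) p.2.1.1 p.2.1.2 x,
      blockPow (chainSet S q.1) q.2.1.1 q.2.1.2 x⁆ = 0 := by
  rcases le_total q.1 p.1 with h | h
  · exact traceForm_lie_blockPow_blockPow hx (chainSet_mono S h) q.2.2 p.2.2
  · rw [← ring_lie_skew, map_neg,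
      traceForm_lie_blockPow_blockPow hx (chainSet_mono S h) p.2.2 q.2.2, neg_zero]

theorem blockPowSpan_chainSet_le (x : Mat n 𝕜) (S : Finset (Fin n)) (i : ℕ) :
    blockPowSpan (chainSet S i) x ≤ Submodule.span ℝ (Set.range fun p : PowIndex 𝕜 =>
      blockPow (chainSet S p.1) p.2.1.1 p.2.1.2 x) :=
  Submodule.span_mono (by
    rintro _ ⟨m, c, hc, rfl⟩
    exact ⟨(i, ⟨(m, c), hc⟩), rfl⟩)

/-- The trace form of two matrices, one of which is diagonal outside a diagonal block and the other
one of which has no diagonal entries there. -/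
theorem traceForm_eq_of_block {ι κ : Type*} [Fintype ι] [DecidableEq ι] [Fintype κ]
    [DecidableEq κ] (e : κ ↪ ι) {x η : Matrix ι ι 𝕜} {a : Matrix κ κ 𝕜}
    (hxa : block (Finset.univ.map e) x = extend e a) (hx : ∀ j, (∀ k, e k ≠ j) → x j j = 0)
    (hη : ∀ i j, i ≠ j → (∀ k, e k ≠ i) → η i j = 0 ∧ η j i = 0) :
    traceForm 𝕜 ι x η = traceForm 𝕜 κ a (restrict e η) := by
  set S := Finset.univ.map e with hS
  have hmS {i : ι} : i ∉ S ↔ ∀ k, e k ≠ i := by simp [hS]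
  have h1 : trace (x * η) = trace (x * block S η) := by
    simp only [trace, diag_apply, mul_apply, block_apply]
    refine Finset.sum_congr rfl fun i _ => Finset.sum_congr rfl fun j _ => ?_
    by_cases hij : j = i
    · subst hij
      by_cases hj : j ∈ S
      · simp [hj]
      · simp [hx j (hmS.1 hj)]
    · by_cases hj : j ∈ S
      · by_cases hi : i ∈ S
        · simp [hi, hj]
        · simp [(hη i j (Ne.symm hij) (hmS.1 hi)).2]
      · simp [(hη j i hij (hmS.1 hj)).1]
  rw [traceForm_apply, h1, ← traceForm_apply, ← traceForm_block, hxa, traceForm_extend]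

/-- The span of the skew-Hermitian multiples of the powers of a matrix. -/
noncomputable def powSpan {κ : Type*} [Fintype κ] [DecidableEq κ] (a : Matrix κ κ 𝕜) :
    Submodule ℝ (Matrix κ κ 𝕜) :=
  Submodule.span ℝ {Z | ∃ (m : ℕ) (c : 𝕜), IsSkewCoeff m c ∧ Z = c • a ^ m}

/-- A subgroup of the orthogonal or unitary group that consists of an arbitrary group of matrices
on a set `S` of indices and a group of diagonal matrices on the other indices forms an integrable
pair, if the part on `S` has a coisotropic subspace that comes from the powers of a matrix `a`. The
diagonal matrices outside `S` commute with the projections onto all blocks of the chain, which is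
why they need no further assumption. -/
theorem isIntegrablePair_of_block (h𝕜 : HasBordering 𝕜) {G H : Subgroup (Mat n 𝕜)ˣ}
    {κ : Type*} [Fintype κ] [DecidableEq κ] (e : κ ↪ Fin n) (hHG : H ≤ G)
    (hG : lieAlg G = skewOn 𝕜 Finset.univ)
    (hH : ∀ u ∈ H, ∀ i j, i ≠ j → (∀ k, e k ≠ i) → (u : Mat n 𝕜) i j = 0 ∧ (u : Mat n 𝕜) j i = 0)
    (h₀ : Submodule ℝ (Matrix κ κ 𝕜)) (hh₀ : ∀ Y ∈ h₀, extend e Y ∈ lieAlg H)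
    {a : Matrix κ κ 𝕜} (ha : aᴴ = -a)
    (haH : ∀ η ∈ lieAlg H, traceForm 𝕜 κ a (restrict e η) = 0)
    (hbase : ∀ ξ : Matrix κ κ 𝕜, ξᴴ = -ξ → (∀ η ∈ h₀, traceForm 𝕜 κ a ⁅ξ, η⁆ = 0) →
      ξ ∈ h₀ ⊔ powSpan a) :
    IsIntegrablePair G H := by
  have : FiniteDimensional ℝ (Mat n 𝕜) := Module.Finite.trans 𝕜 _
  set S := Finset.univ.map e with hS
  have hmS {i : Fin n} : i ∉ S ↔ ∀ k, e k ≠ i := by simp [hS]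
  obtain ⟨x, hx, hxa, hxd, hmf⟩ := h𝕜.exists_chain (extend_mem_skewOn e ha)
  have hra : restrict e x = a := by
    rw [← restrict_extend e a, ← hxa, ← extend_restrict, restrict_extend]
  have hGm (y : Mat n 𝕜) : y ∈ lieAlg G ↔ yᴴ = -y := by rw [hG, mem_skewOn_univ]
  have hxG : x ∈ lieAlg G := (hGm x).2 hx
  refine isIntegrablePair_of_lagrangian (I := PowIndex 𝕜) (T := traceForm 𝕜 (Fin n)) hHG
    ⟨fun x _ y _ => traceForm_comm x y, fun x hx h0 => ?_, fun u _ x _ y _ => traceForm_conj u x y⟩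
    (fun p => tracePow (chainSet S p.1) p.2.1.1 p.2.1.2)
    (fun p => blockPow (chainSet S p.1) p.2.1.1 p.2.1.2)
    (fun p => tracePow_mem _ _ _) (fun p x w => hasDerivAt_tracePow _ _ _ x w)
    (fun p u hu x => tracePow_conj _ _ u (mul_coordProj_comm fun i j hi hj => ?_) x)
    (fun p x hx => ?_) (fun p q x hx => traceForm_lie_chain ?_ S p q) (y₀ := x)
    ⟨hxG, fun η hη => ?_⟩ (fun ξ hξ hξH hξN => ?_)
  · exact traceForm_self_pos ((hGm x).1 hx) h0
  · have hjS : j ∉ S := fun h => hj (subset_chainSet S _ h)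
    have hij : j ≠ i := fun h => hj (h ▸ hi)
    exact (hH u hu j i hij (hmS.1 hjS)).symm
  · exact (hGm _).2 (blockPow_mem ((hGm x).1 hx) p.2.2).1
  · exact (hGm x).1 hx
  · rw [traceForm_eq_of_block e hxa (fun j hj => hxd j (hmS.2 hj)) fun i j hij hi =>
      ⟨apply_apply_eq_zero_of_mem_lieAlg (fun u hu => (hH u hu i j hij hi).1) hη,
        apply_apply_eq_zero_of_mem_lieAlg (fun u hu => (hH u hu i j hij hi).2) hη⟩]
    exact haH η hη
  · set N := Submodule.span ℝ (Set.range fun p : PowIndex 𝕜 =>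
      blockPow (chainSet S p.1) p.2.1.1 p.2.1.2 x) with hN
    have hM : h₀.map (extend e) ≤ skewOn 𝕜 S := by
      rintro _ ⟨Y, hY, rfl⟩
      exact ⟨(hGm _).1 (lieAlg_mono hHG (hh₀ Y hY)), block_extend e Y⟩
    have hchain : IsCoisotropicIn (traceForm 𝕜 _ x) (skewOn 𝕜 (chainSet S n)) (lieAlg H ⊔ N) := by
      refine IsCoisotropicIn.chain (k := fun i => skewOn 𝕜 (chainSet S i))
        (Z := fun i => blockPowSpan (chainSet S (i + 1)) x)
        (M := h₀.map (extend e) ⊔ blockPowSpan S x) ?_ ?_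
        (fun i j h => skewOn_mono (chainSet_mono S h)) (fun i _ => hmf i)
        (fun i => blockPowSpan_le hx) ?_
        fun i => (blockPowSpan_chainSet_le x S _).trans le_sup_right
      · rw [chainSet_zero]
        intro ξ hξ hη
        have hξe : extend e (restrict e ξ) = ξ := by rw [extend_restrict]; exact hξ.2
        have h1 := hbase (restrict e ξ)
          (by rw [conjTranspose_restrict, hξ.1, map_neg]) fun η hη0 => by
            rw [← hra, traceForm_comm, ← traceForm_extend, traceForm_comm, extend_lie, hξe]
            exact hη _ (Submodule.mem_sup_left ⟨η, hη0, rfl⟩)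
        rw [← hξe]
        have h2 : extend e (restrict e ξ) ∈ (h₀ ⊔ powSpan a).map (extend e) := ⟨_, h1, rfl⟩
        rw [Submodule.map_sup] at h2
        refine (sup_le_sup le_rfl ?_ : _ ≤ h₀.map (extend e) ⊔ blockPowSpan S x) h2
        rw [powSpan, Submodule.map_span, Submodule.span_le]
        rintro _ ⟨_, ⟨m, c, hc, rfl⟩, rfl⟩
        exact Submodule.subset_span ⟨m, c, hc, (blockPow_of_block_eq_extend e hxa m c).symm⟩
      · rw [chainSet_zero]
        exact sup_le hM (blockPowSpan_le hx)
      · refine sup_le_sup ?_ ?_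
        · rintro _ ⟨Y, hY, rfl⟩
          exact hh₀ Y hY
        · have := blockPowSpan_chainSet_le x S 0
          rwa [chainSet_zero] at this
    rw [chainSet_of_le S le_rfl] at hchain
    refine hchain ξ (mem_skewOn_univ.2 ((hGm ξ).1 hξ)) fun η hη => ?_
    have h1 : lieAlg H ⊔ N ≤ LinearMap.ker (lieForm (traceForm 𝕜 _ x) LinearMap.id ξ) := by
      refine sup_le (fun η hη => hξH η hη) (Submodule.span_le.2 ?_)
      rintro _ ⟨p, rfl⟩
      exact hξN p
    exact h1 hη

end Single

/-! ### Cyclic skew-Hermitian matrices -/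

section Cyclic

open Matrix

variable {𝕜 : Type*} [RCLike 𝕜] {κ : Type*} [Fintype κ] [DecidableEq κ]

/-- A skew-Hermitian matrix that commutes with a skew-Hermitian matrix with a cyclic vector is a
combination of powers of the latter. -/
theorem mem_powSpan_of_commute {a ζ : Matrix κ κ 𝕜} {b : κ → 𝕜} (ha : aᴴ = -a)
    (hb : Submodule.span 𝕜 (Set.range fun m : ℕ => a ^ m *ᵥ b) = ⊤) (hζ : ζᴴ = -ζ)
    (hc : a * ζ = ζ * a) : ζ ∈ powSpan a := by
  have h1 : ζ *ᵥ b ∈ Submodule.span 𝕜 (Set.range fun m : ℕ => a ^ m *ᵥ b) := hb ▸ trivial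
  obtain ⟨p, hp⟩ := Finsupp.mem_span_range_iff_exists_finsupp.1 h1
  have h2 : ζ = ∑ m ∈ p.support, p m • a ^ m := by
    apply Matrix.toLin'.injective
    refine LinearMap.ext_on_range hb fun m => ?_
    have e1 : ζ *ᵥ (a ^ m *ᵥ b) = a ^ m *ᵥ (ζ *ᵥ b) := by
      have : Commute ζ (a ^ m) := (show Commute ζ a from hc.symm).pow_right m
      rw [mulVec_mulVec, this.eq, mulVec_mulVec]
    rw [toLin'_apply, toLin'_apply, e1, ← hp, Finsupp.sum, mulVec_sum, sum_mulVec]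
    refine Finset.sum_congr rfl fun j _ => ?_
    rw [mulVec_smul, smul_mulVec, mulVec_mulVec, mulVec_mulVec, ← pow_add, ← pow_add, add_comm]
  have h3 : ζ = ∑ m ∈ p.support, ((p m - (-1) ^ m * star (p m)) / 2) • a ^ m := by
    have e1 : ζ = (2⁻¹ : 𝕜) • (ζ - ζᴴ) := by
      rw [hζ, sub_neg_eq_add, ← two_smul 𝕜 ζ, smul_smul, inv_mul_cancel₀ two_ne_zero, one_smul]
    rw [e1]
    nth_rewrite 1 [h2]
    rw [h2, conjTranspose_sum, ← Finset.sum_sub_distrib, Finset.smul_sum]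
    refine Finset.sum_congr rfl fun m _ => ?_
    rw [conjTranspose_smul, conjTranspose_pow_of_skew ha, smul_smul, ← sub_smul, smul_smul]
    congr 1
    ring
  rw [h3]
  refine sum_mem fun m _ => Submodule.subset_span ⟨m, _, ?_, rfl⟩
  have h4 : ((-1 : 𝕜) ^ m) * (-1) ^ m = 1 := by
    rw [← pow_add, ← two_mul, pow_mul]
    simp
  rw [IsSkewCoeff, star_div₀, star_sub, star_mul', star_pow, star_neg, star_one, star_star,
    star_ofNat, pow_succ]
  linear_combination (-star (p m) / 2) * h4

/-- The skew-symmetric tridiagonal matrix with entries `1` below the diagonal. -/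
def tridiagonal (𝕜 : Type*) [RCLike 𝕜] (k : ℕ) : Mat k 𝕜 :=
  of fun i j => (if (i : ℕ) = j + 1 then 1 else 0) - if (j : ℕ) = i + 1 then 1 else 0

theorem conjTranspose_tridiagonal (k : ℕ) : (tridiagonal 𝕜 k)ᴴ = -tridiagonal 𝕜 k := by
  ext i j
  simp only [tridiagonal, conjTranspose_apply, of_apply, star_sub, apply_ite star, star_one,
    star_zero, Matrix.neg_apply, neg_sub]

/-- The tridiagonal matrix is cyclic: it maps each basis vector to the next one, up to an earlier
one. -/
theorem exists_cyclic (𝕜 : Type*) [RCLike 𝕜] (k : ℕ) :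
    ∃ (a : Mat k 𝕜) (b : Fin k → 𝕜), aᴴ = -a ∧
      Submodule.span 𝕜 (Set.range fun m : ℕ => a ^ m *ᵥ b) = ⊤ := by
  let a := tridiagonal 𝕜 k
  -- the first basis vector is cyclic, written so as to cover size zero as well
  let v (l : ℕ) : Fin k → 𝕜 := fun i => if (i : ℕ) = l then 1 else 0
  refine ⟨a, v 0, conjTranspose_tridiagonal k, ?_⟩
  set W := Submodule.span 𝕜 (Set.range fun m : ℕ => a ^ m *ᵥ v 0) with hW
  have haW (w : Fin k → 𝕜) (hw : w ∈ W) : a *ᵥ w ∈ W := by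
    induction hw using Submodule.span_induction with
    | mem w hw =>
      obtain ⟨m, rfl⟩ := hw
      exact Submodule.subset_span ⟨m + 1, by simp [pow_succ', mulVec_mulVec]⟩
    | zero => simp
    | add w w' _ _ h h' => rw [mulVec_add]; exact add_mem h h'
    | smul r w _ h => rw [mulVec_smul]; exact Submodule.smul_mem _ _ h
  have hvW (l : ℕ) (hl : l < k) : v l ∈ W := by
    induction l using Nat.strong_induction_on with
    | _ l ih =>
      rcases l with _ | l
      · exact Submodule.subset_span ⟨0, by simp⟩
      · have hl' : l < k := by omega
        have e1 : v l = Pi.single ⟨l, hl'⟩ 1 := by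
          ext i
          simp [v, Pi.single_apply, Fin.ext_iff]
        have e2 : a *ᵥ v l = v (l + 1) - if l = 0 then 0 else v (l - 1) := by
          rw [e1, mulVec_single_one]
          ext i
          rcases l with _ | l
          · simp [a, tridiagonal, v, col_apply]
          · simp [a, tridiagonal, v, col_apply, eq_comm]
        have e3 : v (l + 1) = a *ᵥ v l + if l = 0 then 0 else v (l - 1) := by
          rw [e2, sub_add_cancel]
        rw [e3]
        refine add_mem (haW _ (ih l (by omega) hl')) ?_
        split_ifs with h0
        · exact zero_mem _
        · exact ih _ (by omega) (by omega)
  rw [eq_top_iff]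
  intro w _
  have : w = ∑ i, w i • v i := by
    ext j
    simp [v, Finset.sum_apply, Fin.val_inj]
  rw [this]
  exact sum_mem fun i _ => Submodule.smul_mem _ _ (hvW i i.2)

end Cyclic

/-! ### Diagonally embedded groups -/

section Product

open Matrix

variable {𝕜 : Type*} [RCLike 𝕜] {n₁ n₂ : ℕ}

/-- The sum of the trace forms of the factors. -/
noncomputable def prodForm (𝕜 : Type*) [RCLike 𝕜] (n₁ n₂ : ℕ) :
    LinearMap.BilinForm ℝ (Mat n₁ 𝕜 × Mat n₂ 𝕜) :=
  (traceForm 𝕜 (Fin n₁)).compl₁₂ (LinearMap.fst ℝ _ _) (LinearMap.fst ℝ _ _) +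
    (traceForm 𝕜 (Fin n₂)).compl₁₂ (LinearMap.snd ℝ _ _) (LinearMap.snd ℝ _ _)

theorem prodForm_apply (x y : Mat n₁ 𝕜 × Mat n₂ 𝕜) :
    prodForm 𝕜 n₁ n₂ x y = traceForm 𝕜 _ x.1 y.1 + traceForm 𝕜 _ x.2 y.2 := rfl

theorem prodForm_lie (x y z : Mat n₁ 𝕜 × Mat n₂ 𝕜) :
    prodForm 𝕜 n₁ n₂ x ⁅y, z⁆ = traceForm 𝕜 _ x.1 ⁅y.1, z.1⁆ + traceForm 𝕜 _ x.2 ⁅y.2, z.2⁆ := rfl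

/-- Multiplicity freeness may be checked in each factor. -/
theorem IsMultiplicityFree.prod {x : Mat n₁ 𝕜 × Mat n₂ 𝕜} {k₁ g₁ Z₁ : Submodule ℝ (Mat n₁ 𝕜)}
    {k₂ g₂ Z₂ : Submodule ℝ (Mat n₂ 𝕜)} (h₁ : IsMultiplicityFree (traceForm 𝕜 _ x.1) k₁ g₁ Z₁)
    (h₂ : IsMultiplicityFree (traceForm 𝕜 _ x.2) k₂ g₂ Z₂) :
    IsMultiplicityFree (prodForm 𝕜 n₁ n₂ x) (k₁.prod k₂) (g₁.prod g₂) (Z₁.prod Z₂) := by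
  intro ξ hξ horth
  obtain ⟨κ₁, hκ₁, ho₁, hZ₁⟩ := h₁ ξ.1 hξ.1 fun η hη => by
    have := horth (η, 0) ⟨hη, zero_mem _⟩
    rwa [prodForm_lie, ring_lie_zero, map_zero, add_zero] at this
  obtain ⟨κ₂, hκ₂, ho₂, hZ₂⟩ := h₂ ξ.2 hξ.2 fun η hη => by
    have := horth (0, η) ⟨zero_mem _, hη⟩
    rwa [prodForm_lie, ring_lie_zero, map_zero, zero_add] at this
  refine ⟨(κ₁, κ₂), ⟨hκ₁, hκ₂⟩, fun η hη => ?_, hZ₁, hZ₂⟩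
  rw [prodForm_lie, ho₁ η.1 hη.1, ho₂ η.2 hη.2, add_zero]

theorem prodForm_self_pos {x : Mat n₁ 𝕜 × Mat n₂ 𝕜} (h₁ : x.1ᴴ = -x.1) (h₂ : x.2ᴴ = -x.2)
    (h0 : x ≠ 0) : 0 < prodForm 𝕜 n₁ n₂ x x := by
  rw [prodForm_apply]
  have p₁ : 0 ≤ traceForm 𝕜 _ x.1 x.1 := by
    rw [traceForm_self h₁]
    positivity
  have p₂ : 0 ≤ traceForm 𝕜 _ x.2 x.2 := by
    rw [traceForm_self h₂]
    positivity
  by_cases h : x.1 = 0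
  · exact add_pos_of_nonneg_of_pos p₁ (traceForm_self_pos h₂ fun h' => h0 (Prod.ext h h'))
  · exact add_pos_of_pos_of_nonneg (traceForm_self_pos h₁ h) p₂

theorem prodForm_conj (u : (Mat n₁ 𝕜 × Mat n₂ 𝕜)ˣ) (x y : Mat n₁ 𝕜 × Mat n₂ 𝕜) :
    prodForm 𝕜 n₁ n₂ (u * x * ((u⁻¹ : (Mat n₁ 𝕜 × Mat n₂ 𝕜)ˣ) : Mat n₁ 𝕜 × Mat n₂ 𝕜))
      (u * y * ((u⁻¹ : (Mat n₁ 𝕜 × Mat n₂ 𝕜)ˣ) : Mat n₁ 𝕜 × Mat n₂ 𝕜)) = prodForm 𝕜 n₁ n₂ x y := by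
  have h₁ := traceForm_conj (Units.map (MonoidHom.fst (Mat n₁ 𝕜) (Mat n₂ 𝕜)) u) x.1 y.1
  have h₂ := traceForm_conj (Units.map (MonoidHom.snd (Mat n₁ 𝕜) (Mat n₂ 𝕜)) u) x.2 y.2
  rw [← map_inv] at h₁ h₂
  rw [prodForm_apply, prodForm_apply, ← h₁, ← h₂]
  rfl

/-- The traces of powers of the blocks of a chain in each factor. -/
noncomputable def prodTracePow (S₁ : Finset (Fin n₁)) (S₂ : Finset (Fin n₂)) :
    PowIndex 𝕜 ⊕ PowIndex 𝕜 → Mat n₁ 𝕜 × Mat n₂ 𝕜 → ℝ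
  | .inl p, x => tracePow (chainSet S₁ p.1) p.2.1.1 p.2.1.2 x.1
  | .inr p, x => tracePow (chainSet S₂ p.1) p.2.1.1 p.2.1.2 x.2

/-- The gradients of the functions `prodTracePow`. -/
noncomputable def prodBlockPow (S₁ : Finset (Fin n₁)) (S₂ : Finset (Fin n₂)) :
    PowIndex 𝕜 ⊕ PowIndex 𝕜 → Mat n₁ 𝕜 × Mat n₂ 𝕜 → Mat n₁ 𝕜 × Mat n₂ 𝕜
  | .inl p, x => (blockPow (chainSet S₁ p.1) p.2.1.1 p.2.1.2 x.1, 0)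
  | .inr p, x => (0, blockPow (chainSet S₂ p.1) p.2.1.1 p.2.1.2 x.2)

variable (S₁ : Finset (Fin n₁)) (S₂ : Finset (Fin n₂))

theorem prodTracePow_mem (p : PowIndex 𝕜 ⊕ PowIndex 𝕜) :
    prodTracePow S₁ S₂ p ∈ polynomialFunctions (Mat n₁ 𝕜 × Mat n₂ 𝕜) := by
  rcases p with p | p
  · have h := comp_linear_mem_polynomialFunctions (tracePow_mem (chainSet S₁ p.1) p.2.1.1 p.2.1.2)
      (LinearMap.fst ℝ (Mat n₁ 𝕜) (Mat n₂ 𝕜))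
    exact h
  · have h := comp_linear_mem_polynomialFunctions (tracePow_mem (chainSet S₂ p.1) p.2.1.1 p.2.1.2)
      (LinearMap.snd ℝ (Mat n₁ 𝕜) (Mat n₂ 𝕜))
    exact h

theorem hasDerivAt_prodTracePow (p : PowIndex 𝕜 ⊕ PowIndex 𝕜) (x w : Mat n₁ 𝕜 × Mat n₂ 𝕜) :
    HasDerivAt (fun t : ℝ => prodTracePow S₁ S₂ p (x + t • w))
      (prodForm 𝕜 n₁ n₂ (prodBlockPow S₁ S₂ p x) w) 0 := by
  rw [prodForm_apply]
  rcases p with p | p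
  · rw [prodBlockPow, map_zero, LinearMap.zero_apply, add_zero]
    exact hasDerivAt_tracePow (chainSet S₁ p.1) p.2.1.1 p.2.1.2 x.1 w.1
  · rw [prodBlockPow, map_zero, LinearMap.zero_apply, zero_add]
    exact hasDerivAt_tracePow (chainSet S₂ p.1) p.2.1.1 p.2.1.2 x.2 w.2

theorem prodTracePow_conj (p : PowIndex 𝕜 ⊕ PowIndex 𝕜) (u : (Mat n₁ 𝕜 × Mat n₂ 𝕜)ˣ)
    (h₁ : ∀ i j, i ≠ j → i ∉ S₁ → (u : Mat n₁ 𝕜 × Mat n₂ 𝕜).1 i j = 0 ∧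
      (u : Mat n₁ 𝕜 × Mat n₂ 𝕜).1 j i = 0)
    (h₂ : ∀ i j, i ≠ j → i ∉ S₂ → (u : Mat n₁ 𝕜 × Mat n₂ 𝕜).2 i j = 0 ∧
      (u : Mat n₁ 𝕜 × Mat n₂ 𝕜).2 j i = 0) (x : Mat n₁ 𝕜 × Mat n₂ 𝕜) :
    prodTracePow S₁ S₂ p
      (u * x * ((u⁻¹ : (Mat n₁ 𝕜 × Mat n₂ 𝕜)ˣ) : Mat n₁ 𝕜 × Mat n₂ 𝕜)) =
      prodTracePow S₁ S₂ p x := by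
  rcases p with p | p
  · have h := tracePow_conj (S := chainSet S₁ p.1) p.2.1.1 p.2.1.2
      (Units.map (MonoidHom.fst (Mat n₁ 𝕜) (Mat n₂ 𝕜)) u)
      (mul_coordProj_comm fun i j hi hj => (h₁ j i (fun h => hj (h ▸ hi))
        fun h => hj (subset_chainSet S₁ _ h)).symm) x.1
    rw [← map_inv] at h
    exact h
  · have h := tracePow_conj (S := chainSet S₂ p.1) p.2.1.1 p.2.1.2
      (Units.map (MonoidHom.snd (Mat n₁ 𝕜) (Mat n₂ 𝕜)) u)
      (mul_coordProj_comm fun i j hi hj => (h₂ j i (fun h => hj (h ▸ hi))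
        fun h => hj (subset_chainSet S₂ _ h)).symm) x.2
    rw [← map_inv] at h
    exact h

theorem prodForm_lie_prodBlockPow (p q : PowIndex 𝕜 ⊕ PowIndex 𝕜) {x : Mat n₁ 𝕜 × Mat n₂ 𝕜}
    (h₁ : x.1ᴴ = -x.1) (h₂ : x.2ᴴ = -x.2) :
    prodForm 𝕜 n₁ n₂ x ⁅prodBlockPow S₁ S₂ p x, prodBlockPow S₁ S₂ q x⁆ = 0 := by
  rw [prodForm_lie]
  rcases p with p | p <;> rcases q with q | q <;> simp only [prodBlockPow]
  · rw [traceForm_lie_chain h₁ S₁ p q, ring_lie_zero, map_zero, add_zero]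
  · rw [ring_lie_zero, ring_zero_lie, map_zero, map_zero, add_zero]
  · rw [ring_lie_zero, ring_zero_lie, map_zero, map_zero, add_zero]
  · rw [traceForm_lie_chain h₂ S₂ p q, ring_lie_zero, map_zero, add_zero]

/-- The gradients span the sum of the spans for the two factors. -/
theorem prod_blockPowSpan_le (x : Mat n₁ 𝕜 × Mat n₂ 𝕜) (i : ℕ) :
    (blockPowSpan (chainSet S₁ i) x.1).prod (blockPowSpan (chainSet S₂ i) x.2) ≤
      Submodule.span ℝ (Set.range fun p => prodBlockPow S₁ S₂ p x) := by
  set M := Submodule.span ℝ (Set.range fun p => prodBlockPow S₁ S₂ p x)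
  have hZ₁ : (blockPowSpan (chainSet S₁ i) x.1).map (LinearMap.inl ℝ _ _) ≤ M := by
    rw [blockPowSpan, Submodule.map_span, Submodule.span_le]
    rintro _ ⟨_, ⟨m, c, hc, rfl⟩, rfl⟩
    exact Submodule.subset_span ⟨Sum.inl (i, ⟨(m, c), hc⟩), rfl⟩
  have hZ₂ : (blockPowSpan (chainSet S₂ i) x.2).map (LinearMap.inr ℝ _ _) ≤ M := by
    rw [blockPowSpan, Submodule.map_span, Submodule.span_le]
    rintro _ ⟨_, ⟨m, c, hc, rfl⟩, rfl⟩
    exact Submodule.subset_span ⟨Sum.inr (i, ⟨(m, c), hc⟩), rfl⟩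
  rintro z ⟨hz₁, hz₂⟩
  have e : z = LinearMap.inl ℝ _ _ z.1 + LinearMap.inr ℝ _ _ z.2 := by simp
  rw [e]
  exact add_mem (hZ₁ ⟨_, hz₁, rfl⟩) (hZ₂ ⟨_, hz₂, rfl⟩)

section

variable {k : ℕ} (e₁ : Fin k ↪ Fin n₁) (e₂ : Fin k ↪ Fin n₂)

/-- The start of the chain: the diagonally embedded Lie algebra together with the powers of a
cyclic matrix `a` in the factors is coisotropic at `(a, -a)`. The reason is that the matrices that
commute with `a` are combinations of its powers. -/
theorem isCoisotropicIn_diagonal {a : Mat k 𝕜} {b : Fin k → 𝕜} (ha : aᴴ = -a)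
    (hb : Submodule.span 𝕜 (Set.range fun m : ℕ => a ^ m *ᵥ b) = ⊤) {x₁ : Mat n₁ 𝕜} {x₂ : Mat n₂ 𝕜}
    (hxa₁ : block (Finset.univ.map e₁) x₁ = extend e₁ a)
    (hxa₂ : block (Finset.univ.map e₂) x₂ = extend e₂ (-a)) :
    IsCoisotropicIn (prodForm 𝕜 n₁ n₂ (x₁, x₂))
      ((skewOn 𝕜 (Finset.univ.map e₁)).prod (skewOn 𝕜 (Finset.univ.map e₂)))
      ((skewOn 𝕜 (Finset.univ : Finset (Fin k))).map ((extend e₁).prod (extend e₂)) ⊔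
        (blockPowSpan (Finset.univ.map e₁) x₁).prod (blockPowSpan (Finset.univ.map e₂) x₂)) := by
  have hra₁ : restrict e₁ x₁ = a := by
    rw [← restrict_extend e₁ a, ← hxa₁, ← extend_restrict, restrict_extend]
  have hra₂ : restrict e₂ x₂ = -a := by
    rw [← restrict_extend e₂ (-a), ← hxa₂, ← extend_restrict, restrict_extend]
  rintro ξ ⟨hξ₁, hξ₂⟩ hη
  have hξe₁ : extend e₁ (restrict e₁ ξ.1) = ξ.1 := by rw [extend_restrict]; exact hξ₁.2
  have hξe₂ : extend e₂ (restrict e₂ ξ.2) = ξ.2 := by rw [extend_restrict]; exact hξ₂.2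
  set ζ := restrict e₁ ξ.1 - restrict e₂ ξ.2 with hζ
  have hs₂ : (restrict e₂ ξ.2)ᴴ = -restrict e₂ ξ.2 := by
    rw [conjTranspose_restrict, hξ₂.1, map_neg]
  have hζs : ζᴴ = -ζ := by
    rw [hζ, conjTranspose_sub, hs₂, conjTranspose_restrict, hξ₁.1, map_neg]
    abel
  have horth (X : Mat k 𝕜) (hX : X ∈ skewOn 𝕜 Finset.univ) :
      traceForm 𝕜 _ ⁅a, ζ⁆ X = 0 := by
    have h1 := hη _ (Submodule.mem_sup_left ⟨X, hX, rfl⟩)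
    rw [prodForm_lie] at h1
    simp only [LinearMap.prod_apply, Function.prod_apply] at h1
    rw [← hξe₁, ← hξe₂, ← extend_lie, ← extend_lie, traceForm_comm, traceForm_comm x₂,
      traceForm_extend, traceForm_extend, hra₁, hra₂, map_neg, traceForm_comm _ a,
      traceForm_comm _ a, traceForm_lie, traceForm_lie] at h1
    rw [hζ, Ring.lie_def, mul_sub, sub_mul, ← h1, Ring.lie_def, Ring.lie_def]
    simp only [map_sub, LinearMap.sub_apply]
    ring
  have hcomm : ⁅a, ζ⁆ = 0 := by
    have h1 : ⁅a, ζ⁆ᴴ = -⁅a, ζ⁆ :=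
      (lie_mem_skewOn (mem_skewOn_univ.2 ha) (mem_skewOn_univ.2 hζs)).1
    rw [← (mem_skewOn_univ.2 h1).2]
    exact block_eq_zero_of_orthogonal h1 horth
  have hpow : ζ ∈ powSpan a :=
    mem_powSpan_of_commute ha hb hζs (by rwa [Ring.lie_def, sub_eq_zero] at hcomm)
  have hZζ : extend e₁ ζ ∈ blockPowSpan (Finset.univ.map e₁) x₁ := by
    have h2 : extend e₁ ζ ∈ (powSpan a).map (extend e₁) := ⟨_, hpow, rfl⟩
    rw [powSpan, Submodule.map_span] at h2
    refine Submodule.span_le.2 ?_ h2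
    rintro _ ⟨_, ⟨m, c, hc, rfl⟩, rfl⟩
    exact Submodule.subset_span ⟨m, c, hc, (blockPow_of_block_eq_extend e₁ hxa₁ m c).symm⟩
  have hsum : ξ = ((extend e₁).prod (extend e₂)) (restrict e₂ ξ.2) + (extend e₁ ζ, 0) := by
    refine Prod.ext ?_ ?_
    · simp [hζ, hξe₁]
    · simp [hξe₂]
  rw [hsum]
  exact add_mem (Submodule.mem_sup_left ⟨_, mem_skewOn_univ.2 hs₂, rfl⟩)
    (Submodule.mem_sup_right ⟨hZζ, zero_mem _⟩)

end

section

attribute [local instance] Matrix.linftyOpNormedRing Matrix.linftyOpNormedAlgebra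

theorem apply_eq_zero_of_mem_lieAlg_prod {H : Subgroup (Mat n₁ 𝕜 × Mat n₂ 𝕜)ˣ}
    (l : Mat n₁ 𝕜 × Mat n₂ 𝕜 →ₗ[ℝ] 𝕜) (h : ∀ u ∈ H, l (u : Mat n₁ 𝕜 × Mat n₂ 𝕜) = 0)
    {η : Mat n₁ 𝕜 × Mat n₂ 𝕜} (hη : η ∈ lieAlg H) : l η = 0 := by
  have f₁ : FiniteDimensional ℝ (Mat n₁ 𝕜) := Module.Finite.trans 𝕜 _
  have f₂ : FiniteDimensional ℝ (Mat n₂ 𝕜) := Module.Finite.trans 𝕜 _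
  have h1 := apply_eq_zero_of_mem_lieAlg ((RCLike.reLm : 𝕜 →ₗ[ℝ] ℝ) ∘ₗ l) 0
    (fun u hu => by simp [h u hu]) hη
  have h2 := apply_eq_zero_of_mem_lieAlg ((RCLike.imLm : 𝕜 →ₗ[ℝ] ℝ) ∘ₗ l) 0
    (fun u hu => by simp [h u hu]) hη
  refine RCLike.ext ?_ ?_
  · simpa using h1
  · simpa using h2

/-- A diagonally embedded group of matrices in a product of two orthogonal or unitary groups. -/
theorem isIntegrablePair_of_diagonal (h𝕜 : HasBordering 𝕜)
    {G H : Subgroup (Mat n₁ 𝕜 × Mat n₂ 𝕜)ˣ} {k : ℕ} (e₁ : Fin k ↪ Fin n₁) (e₂ : Fin k ↪ Fin n₂)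
    (hHG : H ≤ G) (hG : ∀ x, x ∈ lieAlg G ↔ x.1ᴴ = -x.1 ∧ x.2ᴴ = -x.2)
    (hH₁ : ∀ u ∈ H, ∀ i j, i ≠ j → (∀ l, e₁ l ≠ i) →
      (u : Mat n₁ 𝕜 × Mat n₂ 𝕜).1 i j = 0 ∧ (u : Mat n₁ 𝕜 × Mat n₂ 𝕜).1 j i = 0)
    (hH₂ : ∀ u ∈ H, ∀ i j, i ≠ j → (∀ l, e₂ l ≠ i) →
      (u : Mat n₁ 𝕜 × Mat n₂ 𝕜).2 i j = 0 ∧ (u : Mat n₁ 𝕜 × Mat n₂ 𝕜).2 j i = 0)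
    (hH : ∀ u ∈ H, restrict e₁ (u : Mat n₁ 𝕜 × Mat n₂ 𝕜).1 =
      restrict e₂ (u : Mat n₁ 𝕜 × Mat n₂ 𝕜).2)
    (hh : ∀ X : Mat k 𝕜, Xᴴ = -X → (extend e₁ X, extend e₂ X) ∈ lieAlg H) :
    IsIntegrablePair G H := by
  have f₁ : FiniteDimensional ℝ (Mat n₁ 𝕜) := Module.Finite.trans 𝕜 _
  have f₂ : FiniteDimensional ℝ (Mat n₂ 𝕜) := Module.Finite.trans 𝕜 _
  obtain ⟨a, b, ha, hb⟩ := exists_cyclic 𝕜 k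
  have hna : (-a)ᴴ = -(-a) := by rw [conjTranspose_neg, ha]
  set S₁ := Finset.univ.map e₁ with hS₁
  set S₂ := Finset.univ.map e₂ with hS₂
  have hm₁ {i : Fin n₁} : i ∉ S₁ ↔ ∀ k, e₁ k ≠ i := by simp [hS₁]
  have hm₂ {i : Fin n₂} : i ∉ S₂ ↔ ∀ k, e₂ k ≠ i := by simp [hS₂]
  -- the blocks `a` and `-a` of the base point make it orthogonal to the diagonal subalgebra
  obtain ⟨x₁, hx₁, hxa₁, hxd₁, hmf₁⟩ := h𝕜.exists_chain (extend_mem_skewOn e₁ ha)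
  obtain ⟨x₂, hx₂, hxa₂, hxd₂, hmf₂⟩ := h𝕜.exists_chain (extend_mem_skewOn e₂ hna)
  refine isIntegrablePair_of_lagrangian (I := PowIndex 𝕜 ⊕ PowIndex 𝕜) (T := prodForm 𝕜 n₁ n₂) hHG
    ⟨fun x _ y _ => ?_, fun x hx h0 => prodForm_self_pos ((hG x).1 hx).1 ((hG x).1 hx).2 h0,
      fun u _ x _ y _ => prodForm_conj u x y⟩
    (prodTracePow S₁ S₂) (prodBlockPow S₁ S₂)
    (prodTracePow_mem S₁ S₂) (hasDerivAt_prodTracePow S₁ S₂)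
    (fun p u hu x => prodTracePow_conj S₁ S₂ p u (fun i j hij hi => hH₁ u hu i j hij (hm₁.1 hi))
      (fun i j hij hi => hH₂ u hu i j hij (hm₂.1 hi)) x)
    ?_ (fun p q x hx => prodForm_lie_prodBlockPow S₁ S₂ p q ((hG x).1 hx).1 ((hG x).1 hx).2)
    (y₀ := (x₁, x₂)) ⟨(hG _).2 ⟨hx₁, hx₂⟩, fun η hη => ?_⟩
    (fun ξ hξ hξH hξN => ?_)
  · rw [prodForm_apply, prodForm_apply, traceForm_comm, traceForm_comm x.2]
  · rintro (p | p) x hx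
    · exact (hG _).2 ⟨(blockPow_mem ((hG x).1 hx).1 p.2.2).1, by simp [prodBlockPow]⟩
    · exact (hG _).2 ⟨by simp [prodBlockPow], (blockPow_mem ((hG x).1 hx).2 p.2.2).1⟩
  · have h1 (i j) (hij : i ≠ j) (hi : ∀ l, e₁ l ≠ i) : η.1 i j = 0 ∧ η.1 j i = 0 :=
      ⟨apply_eq_zero_of_mem_lieAlg_prod (entryLinearMap ℝ 𝕜 i j ∘ₗ LinearMap.fst ℝ _ _)
        (fun u hu => (hH₁ u hu i j hij hi).1) hη,
      apply_eq_zero_of_mem_lieAlg_prod (entryLinearMap ℝ 𝕜 j i ∘ₗ LinearMap.fst ℝ _ _)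
        (fun u hu => (hH₁ u hu i j hij hi).2) hη⟩
    have h2 (i j) (hij : i ≠ j) (hi : ∀ l, e₂ l ≠ i) : η.2 i j = 0 ∧ η.2 j i = 0 :=
      ⟨apply_eq_zero_of_mem_lieAlg_prod (entryLinearMap ℝ 𝕜 i j ∘ₗ LinearMap.snd ℝ _ _)
        (fun u hu => (hH₂ u hu i j hij hi).1) hη,
      apply_eq_zero_of_mem_lieAlg_prod (entryLinearMap ℝ 𝕜 j i ∘ₗ LinearMap.snd ℝ _ _)
        (fun u hu => (hH₂ u hu i j hij hi).2) hη⟩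
    have h3 : restrict e₁ η.1 = restrict e₂ η.2 := by
      ext i j
      rw [← sub_eq_zero]
      refine apply_eq_zero_of_mem_lieAlg_prod
        (entryLinearMap ℝ 𝕜 i j ∘ₗ (restrict e₁ ∘ₗ LinearMap.fst ℝ _ _) -
          entryLinearMap ℝ 𝕜 i j ∘ₗ (restrict e₂ ∘ₗ LinearMap.snd ℝ _ _)) (fun u hu => ?_) hη
      have := congrFun (congrFun (hH u hu) i) j
      simp [this]
    rw [prodForm_apply, traceForm_eq_of_block e₁ hxa₁ (fun j hj => hxd₁ j (hm₁.2 hj)) h1,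
      traceForm_eq_of_block e₂ hxa₂ (fun j hj => hxd₂ j (hm₂.2 hj)) h2, h3, map_neg,
      LinearMap.neg_apply, add_neg_cancel]
  · set M := Submodule.span ℝ (Set.range fun p => prodBlockPow S₁ S₂ p (x₁, x₂)) with hM
    let D : Submodule ℝ (Mat n₁ 𝕜 × Mat n₂ 𝕜) :=
      (skewOn 𝕜 (Finset.univ : Finset (Fin k))).map ((extend e₁).prod (extend e₂))
    have hD : D ≤ lieAlg H := by
      rintro _ ⟨X, hX, rfl⟩
      exact hh X hX.1
    have hchain : IsCoisotropicIn (prodForm 𝕜 n₁ n₂ (x₁, x₂))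
        ((skewOn 𝕜 (chainSet S₁ (max n₁ n₂))).prod (skewOn 𝕜 (chainSet S₂ (max n₁ n₂))))
        (lieAlg H ⊔ M) := by
      refine IsCoisotropicIn.chain
        (k := fun i => (skewOn 𝕜 (chainSet S₁ i)).prod (skewOn 𝕜 (chainSet S₂ i)))
        (Z := fun i => (blockPowSpan (chainSet S₁ (i + 1)) x₁).prod
          (blockPowSpan (chainSet S₂ (i + 1)) x₂))
        (M := D ⊔ (blockPowSpan S₁ x₁).prod (blockPowSpan S₂ x₂)) ?_ ?_
        (fun i j h => Submodule.prod_mono (skewOn_mono (chainSet_mono S₁ h))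
          (skewOn_mono (chainSet_mono S₂ h)))
        (fun i _ => (hmf₁ i).prod (x := (x₁, x₂)) (hmf₂ i))
        (fun i => Submodule.prod_mono (blockPowSpan_le hx₁) (blockPowSpan_le hx₂)) ?_
        fun i => (prod_blockPowSpan_le S₁ S₂ (x₁, x₂) _).trans le_sup_right
      · simp only [chainSet_zero]
        exact isCoisotropicIn_diagonal e₁ e₂ ha hb hxa₁ hxa₂
      · simp only [chainSet_zero]
        refine sup_le ?_ (Submodule.prod_mono (blockPowSpan_le hx₁) (blockPowSpan_le hx₂))
        rintro _ ⟨X, hX, rfl⟩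
        exact ⟨extend_mem_skewOn e₁ hX.1, extend_mem_skewOn e₂ hX.1⟩
      · refine sup_le_sup hD ?_
        have := prod_blockPowSpan_le S₁ S₂ (x₁, x₂) 0
        rwa [chainSet_zero, chainSet_zero] at this
    rw [chainSet_of_le S₁ (le_max_left _ _), chainSet_of_le S₂ (le_max_right _ _)] at hchain
    have hξ' := (hG ξ).1 hξ
    refine hchain ξ ⟨mem_skewOn_univ.2 hξ'.1, mem_skewOn_univ.2 hξ'.2⟩ fun η hη => ?_
    have h1 : lieAlg H ⊔ M ≤
        LinearMap.ker (lieForm (prodForm 𝕜 n₁ n₂ (x₁, x₂)) LinearMap.id ξ) := by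
      refine sup_le (fun η hη => hξH η hη) (Submodule.span_le.2 ?_)
      rintro _ ⟨p, rfl⟩
      exact hξN p
    exact h1 hη

end

end Product

/-! ### The Lie algebras of the classical groups -/

section ClassicalLieAlgebras

open Matrix

theorem mem_lieAlg_units {A : Type*} [NormedRing A] [NormedAlgebra ℝ A] [CompleteSpace A]
    {S : Submonoid A} {X : A} (h : ∀ t : ℝ, NormedSpace.exp (t • X) ∈ S) : X ∈ lieAlg S.units := by
  let _ : NormedAlgebra ℚ A := NormedAlgebra.restrictScalars ℚ ℝ A
  refine Submodule.subset_span fun t => ?_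
  have h1 : NormedSpace.exp (t • X) * NormedSpace.exp (-(t • X)) = 1 := by
    rw [← NormedSpace.exp_add_of_commute (Commute.neg_right (Commute.refl (t • X))),
      add_neg_cancel, NormedSpace.exp_zero]
  have h2 : NormedSpace.exp (-(t • X)) * NormedSpace.exp (t • X) = 1 := by
    rw [← NormedSpace.exp_add_of_commute (Commute.neg_left (Commute.refl (t • X))),
      neg_add_cancel, NormedSpace.exp_zero]
  refine ⟨⟨_, _, h1, h2⟩, Submonoid.mem_units_iff _ _ |>.2 ⟨h t, ?_⟩, rfl⟩
  have := h (-t)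
  rwa [neg_smul] at this

theorem eq_of_exp_smul_eq {A : Type*} [NormedRing A] [NormedAlgebra ℝ A] [CompleteSpace A]
    {X Y : A} (h : ∀ t : ℝ, NormedSpace.exp (t • X) = NormedSpace.exp (t • Y)) : X = Y := by
  have d₁ := hasDerivAt_exp_smul_const X (0 : ℝ)
  have d₂ := hasDerivAt_exp_smul_const Y (0 : ℝ)
  rw [funext h] at d₁
  simpa using! d₁.unique d₂

variable {𝕜 : Type*} [RCLike 𝕜]

theorem conjTranspose_smul_of_skew {ι : Type*} {X : Matrix ι ι 𝕜} (hX : Xᴴ = -X) (t : ℝ) :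
    (t • X)ᴴ = -(t • X) := by
  rw [conjTranspose_smul, hX, star_trivial, smul_neg]

variable {ι κ : Type*} [Fintype ι] [DecidableEq ι] [Fintype κ] [DecidableEq κ]

/-- The monoids between the exponentials of the skew-Hermitian matrices and the unitary group. -/
def IsSkewExp (S : Submonoid (Matrix ι ι 𝕜)) : Prop :=
  (∀ u ∈ S, uᴴ * u = 1) ∧ ∀ X : Matrix ι ι 𝕜, Xᴴ = -X → NormedSpace.exp X ∈ S

theorem conjTranspose_exp_mul_exp {X : Matrix ι ι 𝕜} (hX : Xᴴ = -X) :
    (NormedSpace.exp X)ᴴ * NormedSpace.exp X = 1 := by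
  let _ : NormedAlgebra ℚ 𝕜 := NormedAlgebra.restrictScalars ℚ ℝ 𝕜
  rw [← exp_conjTranspose, hX, exp_neg, nonsing_inv_mul]
  exact (isUnit_iff_isUnit_det _).1 (isUnit_exp X)

theorem isSkewExp_unitaryGroup : IsSkewExp (unitaryGroup ι 𝕜) :=
  ⟨fun _ hu => mem_unitaryGroup_iff'.1 hu,
    fun _ hX => mem_unitaryGroup_iff'.2 (conjTranspose_exp_mul_exp hX)⟩

theorem mem_specialOrthogonalGroup_iff_conjTranspose {X : Matrix ι ι ℝ} :
    X ∈ specialOrthogonalGroup ι ℝ ↔ Xᴴ * X = 1 ∧ X.det = 1 := by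
  rw [mem_specialOrthogonalGroup_iff, mem_orthogonalGroup_iff']
  rfl

theorem isSkewExp_specialOrthogonalGroup : IsSkewExp (specialOrthogonalGroup ι ℝ) := by
  refine ⟨fun _ hu => (mem_specialOrthogonalGroup_iff_conjTranspose.1 hu).1, fun X hX =>
    mem_specialOrthogonalGroup_iff_conjTranspose.2 ⟨conjTranspose_exp_mul_exp hX, ?_⟩⟩
  -- the exponential is the square of an orthogonal matrix
  have h1 := conjTranspose_exp_mul_exp (conjTranspose_smul_of_skew hX (1 / 2))
  have h2 := congrArg det h1
  rw [det_mul, det_conjTranspose, det_one, star_trivial] at h2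
  have h3 : X = (1 / 2 : ℝ) • X + (1 / 2 : ℝ) • X := by rw [← add_smul]; norm_num
  rw [h3, exp_add_of_commute _ _ (Commute.refl _), det_mul, h2]

section

attribute [local instance] Matrix.linftyOpNormedRing Matrix.linftyOpNormedAlgebra

/-- A one-parameter group of unitary matrices has a skew-Hermitian generator. -/
theorem skew_of_exp_unitary {X : Matrix ι ι 𝕜}
    (h : ∀ t : ℝ, (NormedSpace.exp (t • X))ᴴ * NormedSpace.exp (t • X) = 1) : Xᴴ = -X := by
  let _ : NormedAlgebra ℚ 𝕜 := NormedAlgebra.restrictScalars ℚ ℝ 𝕜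
  have : FiniteDimensional ℝ (Matrix ι ι 𝕜) := Module.Finite.trans 𝕜 _
  have : CompleteSpace (Matrix ι ι 𝕜) := FiniteDimensional.complete ℝ _
  have h1 (t : ℝ) : NormedSpace.exp (t • Xᴴ) = NormedSpace.exp (t • -X) := by
    have e : t • Xᴴ = (t • X)ᴴ := by rw [conjTranspose_smul, star_trivial]
    rw [e, exp_conjTranspose, smul_neg, exp_neg, eq_comm]
    exact inv_eq_left_inv (h t)
  exact eq_of_exp_smul_eq h1

theorem mem_lieAlg_units_iff {S : Submonoid (Matrix ι ι 𝕜)} (hS : IsSkewExp S)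
    {X : Matrix ι ι 𝕜} : X ∈ lieAlg S.units ↔ Xᴴ = -X := by
  have : FiniteDimensional ℝ (Matrix ι ι 𝕜) := Module.Finite.trans 𝕜 _
  have : CompleteSpace (Matrix ι ι 𝕜) := FiniteDimensional.complete ℝ _
  refine ⟨fun h => ?_, fun h => mem_lieAlg_units fun t =>
    hS.2 _ (conjTranspose_smul_of_skew h t)⟩
  have hle : lieAlg S.units ≤ skewOn 𝕜 Finset.univ := Submodule.span_le.2 fun Y hY => by
    refine mem_skewOn_univ.2 (skew_of_exp_unitary fun t => hS.1 _ ?_)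
    obtain ⟨u, hu, h⟩ := hY t
    exact h ▸ ((Submonoid.mem_units_iff _ _).1 hu).1
  exact mem_skewOn_univ.1 (hle h)

theorem mem_lieAlg_prod_units_iff {n₁ n₂ : ℕ} {S₁ : Submonoid (Mat n₁ 𝕜)}
    {S₂ : Submonoid (Mat n₂ 𝕜)}
    (h₁ : IsSkewExp S₁) (h₂ : IsSkewExp S₂) {X : Mat n₁ 𝕜 × Mat n₂ 𝕜} :
    X ∈ lieAlg (S₁.prod S₂).units ↔ X.1ᴴ = -X.1 ∧ X.2ᴴ = -X.2 := by
  have : FiniteDimensional ℝ (Mat n₁ 𝕜) := Module.Finite.trans 𝕜 _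
  have : FiniteDimensional ℝ (Mat n₂ 𝕜) := Module.Finite.trans 𝕜 _
  have : CompleteSpace (Mat n₁ 𝕜) := FiniteDimensional.complete ℝ _
  have : CompleteSpace (Mat n₂ 𝕜) := FiniteDimensional.complete ℝ _
  let _ : NormedAlgebra ℚ (Mat n₁ 𝕜) := NormedAlgebra.restrictScalars ℚ ℝ _
  let _ : NormedAlgebra ℚ (Mat n₂ 𝕜) := NormedAlgebra.restrictScalars ℚ ℝ _
  have hf (Y : Mat n₁ 𝕜 × Mat n₂ 𝕜) : (NormedSpace.exp Y).1 = NormedSpace.exp Y.1 :=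
    Prod.fst_exp Y
  have hs (Y : Mat n₁ 𝕜 × Mat n₂ 𝕜) : (NormedSpace.exp Y).2 = NormedSpace.exp Y.2 :=
    Prod.snd_exp Y
  constructor
  · intro h
    have hle : lieAlg (S₁.prod S₂).units ≤ (skewOn 𝕜 Finset.univ).prod (skewOn 𝕜 Finset.univ) := by
      refine Submodule.span_le.2 fun Y hY => ?_
      have hY' (t : ℝ) : NormedSpace.exp (t • Y.1) ∈ S₁ ∧ NormedSpace.exp (t • Y.2) ∈ S₂ := by
        obtain ⟨u, hu, h⟩ := hY t
        have := Submonoid.mem_prod.1 ((Submonoid.mem_units_iff _ _).1 hu).1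
        rw [h, hf, hs] at this
        exact this
      exact ⟨mem_skewOn_univ.2 (skew_of_exp_unitary fun t => h₁.1 _ (hY' t).1),
        mem_skewOn_univ.2 (skew_of_exp_unitary fun t => h₂.1 _ (hY' t).2)⟩
    exact ⟨mem_skewOn_univ.1 (hle h).1, mem_skewOn_univ.1 (hle h).2⟩
  · rintro ⟨h, h'⟩
    refine mem_lieAlg_units fun t => Submonoid.mem_prod.2 ?_
    exact ⟨(congrArg (· ∈ S₁) (hf (t • X))).mpr (h₁.2 _ (conjTranspose_smul_of_skew h t)),
      (congrArg (· ∈ S₂) (hs (t • X))).mpr (h₂.2 _ (conjTranspose_smul_of_skew h' t))⟩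

end

/-! ### Matrices completed by an identity block -/

/-- The matrix `P` on the indices in the range of `e`, completed by an identity block. -/
noncomputable def pad (e : κ ↪ ι) (P : Matrix κ κ 𝕜) : Matrix ι ι 𝕜 :=
  extend e P + (1 - coordProj 𝕜 (Finset.univ.map e))

theorem coordProj_mul_extend (e : κ ↪ ι) (X : Matrix κ κ 𝕜) :
    coordProj 𝕜 (Finset.univ.map e) * extend e X = extend e X := by
  rw [← extend_one, ← extend_mul, one_mul]

theorem extend_mul_coordProj (e : κ ↪ ι) (X : Matrix κ κ 𝕜) :
    extend e X * coordProj 𝕜 (Finset.univ.map e) = extend e X := by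
  rw [← extend_one, ← extend_mul, mul_one]

/-- The ring homomorphism with values in the matrices that are scalar outside a block. -/
noncomputable def extendHom (e : κ ↪ ι) : Matrix κ κ 𝕜 × 𝕜 →+* Matrix ι ι 𝕜 where
  toFun x := extend e x.1 + x.2 • (1 - coordProj 𝕜 (Finset.univ.map e))
  map_one' := by rw [Prod.fst_one, Prod.snd_one, extend_one, one_smul, add_sub_cancel]
  map_zero' := by simp
  map_add' x y := by
    rw [Prod.fst_add, Prod.snd_add, map_add, add_smul]
    abel
  map_mul' x y := by
    rw [Prod.fst_mul, Prod.snd_mul, extend_mul, add_mul, mul_add, mul_add, Matrix.smul_mul,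
      Matrix.mul_smul, Matrix.smul_mul, Matrix.mul_smul, mul_sub, mul_one, extend_mul_coordProj,
      sub_mul, one_mul, coordProj_mul_extend, sub_self, sub_self, smul_zero, smul_zero,
      sub_mul, one_mul, mul_sub, mul_one, coordProj_mul_of_subset subset_rfl, sub_self, sub_zero,
      smul_smul, add_zero, zero_add]

/-- The exponential of a block extended by zero is completed by an identity block: apply the
continuous ring homomorphism `extendHom` to the exponential of `(X, 0)`. -/
theorem exp_extend (e : κ ↪ ι) (X : Matrix κ κ 𝕜) :
    NormedSpace.exp (extend e X) = pad e (NormedSpace.exp X) := by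
  let _ : NormedRing (Matrix κ κ 𝕜) := Matrix.linftyOpNormedRing
  let _ : NormedAlgebra ℝ (Matrix κ κ 𝕜) := Matrix.linftyOpNormedAlgebra
  let _ : NormedRing (Matrix ι ι 𝕜) := Matrix.linftyOpNormedRing
  let _ : NormedAlgebra ℝ (Matrix ι ι 𝕜) := Matrix.linftyOpNormedAlgebra
  let _ : NormedAlgebra ℚ 𝕜 := NormedAlgebra.restrictScalars ℚ ℝ _
  let _ : NormedAlgebra ℚ (Matrix κ κ 𝕜) := NormedAlgebra.restrictScalars ℚ ℝ _
  let _ : NormedAlgebra ℚ (Matrix ι ι 𝕜) := NormedAlgebra.restrictScalars ℚ ℝ _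
  have : FiniteDimensional ℝ (Matrix κ κ 𝕜) := Module.Finite.trans 𝕜 _
  have : CompleteSpace (Matrix κ κ 𝕜) := FiniteDimensional.complete ℝ _
  have hc : Continuous (extendHom (𝕜 := 𝕜) e) := by
    have h1 : Continuous (extend (𝕜 := 𝕜) e) := LinearMap.continuous_of_finiteDimensional _
    exact (h1.comp continuous_fst).add (continuous_snd.smul continuous_const)
  have h := NormedSpace.map_exp (extendHom (𝕜 := 𝕜) e) hc (X, 0)
  have h1 : extendHom (𝕜 := 𝕜) e (X, 0) = extend e X := by simp [extendHom]
  rw [h1] at h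
  have hf : (NormedSpace.exp (X, (0 : 𝕜))).1 = NormedSpace.exp X := Prod.fst_exp _
  have hs : (NormedSpace.exp (X, (0 : 𝕜))).2 = NormedSpace.exp 0 := Prod.snd_exp _
  rw [NormedSpace.exp_zero] at hs
  have hp {y : Matrix κ κ 𝕜 × 𝕜} {P : Matrix κ κ 𝕜} (h₁ : y.1 = P) (h₂ : y.2 = 1) :
      extendHom e y = pad e P := by
    simp [extendHom, pad, h₁, h₂]
  exact h.symm.trans (hp hf hs)

theorem extend_mem_lieAlg {S : Submonoid (Matrix ι ι 𝕜)} (e : κ ↪ ι) {X : Matrix κ κ 𝕜}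
    (h : ∀ t : ℝ, pad e (NormedSpace.exp (t • X)) ∈ S) : extend e X ∈ lieAlg S.units := by
  have h1 (t : ℝ) : NormedSpace.exp (t • extend e X) ∈ S := by
    rw [← map_smul, exp_extend]
    exact h t
  let _ : NormedRing (Matrix ι ι 𝕜) := Matrix.linftyOpNormedRing
  let _ : NormedAlgebra ℝ (Matrix ι ι 𝕜) := Matrix.linftyOpNormedAlgebra
  have : FiniteDimensional ℝ (Matrix ι ι 𝕜) := Module.Finite.trans 𝕜 _
  have : CompleteSpace (Matrix ι ι 𝕜) := FiniteDimensional.complete ℝ _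
  exact mem_lieAlg_units h1

theorem prod_extend_mem_lieAlg {n₁ n₂ : ℕ} {S : Submonoid (Mat n₁ 𝕜 × Mat n₂ 𝕜)}
    (e₁ : κ ↪ Fin n₁) (e₂ : κ ↪ Fin n₂) {X : Matrix κ κ 𝕜}
    (h : ∀ t : ℝ, (pad e₁ (NormedSpace.exp (t • X)), pad e₂ (NormedSpace.exp (t • X))) ∈ S) :
    (extend e₁ X, extend e₂ X) ∈ lieAlg S.units := by
  have h1 (t : ℝ) :
      (NormedSpace.exp (t • extend e₁ X), NormedSpace.exp (t • extend e₂ X)) ∈ S := by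
    rw [← map_smul, ← map_smul, exp_extend, exp_extend]
    exact h t
  let _ : NormedRing (Mat n₁ 𝕜) := Matrix.linftyOpNormedRing
  let _ : NormedRing (Mat n₂ 𝕜) := Matrix.linftyOpNormedRing
  let _ : NormedAlgebra ℝ (Mat n₁ 𝕜) := Matrix.linftyOpNormedAlgebra
  let _ : NormedAlgebra ℝ (Mat n₂ 𝕜) := Matrix.linftyOpNormedAlgebra
  have : FiniteDimensional ℝ (Mat n₁ 𝕜) := Module.Finite.trans 𝕜 _
  have : FiniteDimensional ℝ (Mat n₂ 𝕜) := Module.Finite.trans 𝕜 _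
  have : CompleteSpace (Mat n₁ 𝕜) := FiniteDimensional.complete ℝ _
  have : CompleteSpace (Mat n₂ 𝕜) := FiniteDimensional.complete ℝ _
  let _ : NormedAlgebra ℚ (Mat n₁ 𝕜) := NormedAlgebra.restrictScalars ℚ ℝ _
  let _ : NormedAlgebra ℚ (Mat n₂ 𝕜) := NormedAlgebra.restrictScalars ℚ ℝ _
  refine mem_lieAlg_units fun t => ?_
  have e : NormedSpace.exp (t • (extend e₁ X, extend e₂ X)) =
      (NormedSpace.exp (t • extend e₁ X), NormedSpace.exp (t • extend e₂ X)) :=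
    Prod.ext (Prod.fst_exp _) (Prod.snd_exp _)
  exact (congrArg (· ∈ S) e).mpr (h1 t)

theorem extend_apply (e : κ ↪ ι) (X : Matrix κ κ 𝕜) (k l : κ) : extend e X (e k) (e l) = X k l := by
  rw [← restrict_apply e (extend e X) k l, restrict_extend]

theorem extend_apply_of_notMem (e : κ ↪ ι) (X : Matrix κ κ 𝕜) {i j : ι}
    (h : (∀ k, e k ≠ i) ∨ ∀ k, e k ≠ j) : extend e X i j = 0 := by
  rw [← block_extend, block_apply, if_neg]
  simpa [or_iff_not_imp_left] using h

theorem pad_apply (e : κ ↪ ι) (P : Matrix κ κ 𝕜) (k l : κ) : pad e P (e k) (e l) = P k l := by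
  simp [pad, extend_apply, coordProj, diagonal_apply, one_apply]

theorem pad_apply_of_notMem (e : κ ↪ ι) (P : Matrix κ κ 𝕜) {i j : ι}
    (h : (∀ k, e k ≠ i) ∨ ∀ k, e k ≠ j) : pad e P i j = (1 : Matrix ι ι 𝕜) i j := by
  rw [pad, Matrix.add_apply, extend_apply_of_notMem e P h, zero_add, Matrix.sub_apply, coordProj,
    diagonal_apply, one_apply]
  split_ifs with h1 h2 <;> simp
  subst h1
  simp at h2
  obtain ⟨k, hk⟩ := h2
  rcases h with h | h <;> exact h k hk

theorem inclusion_trans {ι κ ν : Type*} [DecidableEq ι] [Fintype κ] [DecidableEq κ]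
    (e : ν ↪ κ) (f : κ ↪ ι) :
    inclusion 𝕜 (e.trans f) = inclusion 𝕜 f * inclusion 𝕜 e := by
  ext i j
  simp [inclusion, mul_apply]

variable {ν : Type*} [Fintype ν] [DecidableEq ν]

theorem extend_trans {ι κ ν : Type*} [DecidableEq ι] [Fintype κ] [DecidableEq κ] [Fintype ν]
    (e : ν ↪ κ) (f : κ ↪ ι) (X : Matrix ν ν 𝕜) :
    extend (e.trans f) X = extend f (extend e X) := by
  simp only [extend_def, inclusion_trans, conjTranspose_mul, Matrix.mul_assoc]

theorem pad_trans {ι κ ν : Type*} [DecidableEq ι] [Fintype κ] [DecidableEq κ] [Fintype ν]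
    [DecidableEq ν] (e : ν ↪ κ) (f : κ ↪ ι) (P : Matrix ν ν 𝕜) :
    pad (e.trans f) P = pad f (pad e P) := by
  rw [pad, pad, pad, map_add, map_sub, extend_one, ← extend_one, extend_trans, ← extend_one,
    extend_trans]
  rw [← extend_one e]
  abel

theorem pad_one {ι κ : Type*} [DecidableEq ι] [Fintype κ] [DecidableEq κ] (e : κ ↪ ι) :
    pad e (1 : Matrix κ κ 𝕜) = 1 := by
  rw [pad, extend_one, add_sub_cancel]

theorem pad_mul (e : κ ↪ ι) (P Q : Matrix κ κ 𝕜) : pad e (P * Q) = pad e P * pad e Q := by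
  have h := map_mul (extendHom (𝕜 := 𝕜) e) (P, 1) (Q, 1)
  simpa [extendHom, pad] using h

theorem conjTranspose_pad {ι κ : Type*} [DecidableEq ι] [Fintype κ] (e : κ ↪ ι)
    (P : Matrix κ κ 𝕜) : (pad e P)ᴴ = pad e Pᴴ := by
  rw [pad, pad, conjTranspose_add, conjTranspose_extend, conjTranspose_sub, conjTranspose_one,
    conjTranspose_coordProj]

theorem conjTranspose_pad_mul_pad (e : κ ↪ ι) {P : Matrix κ κ 𝕜} (hP : Pᴴ * P = 1) :
    (pad e P)ᴴ * pad e P = 1 := by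
  rw [conjTranspose_pad, ← pad_mul, hP, pad_one]

theorem pad_inl (P : Matrix κ κ 𝕜) :
    pad (Function.Embedding.inl : κ ↪ κ ⊕ ν) P = fromBlocks P 0 0 1 := by
  ext (i | i) (j | j)
  · exact pad_apply (Function.Embedding.inl : κ ↪ κ ⊕ ν) P i j
  · rw [pad_apply_of_notMem _ _ (Or.inr (by simp))]
    simp
  · rw [pad_apply_of_notMem _ _ (Or.inl (by simp))]
    simp
  · rw [pad_apply_of_notMem _ _ (Or.inl (by simp))]
    simp [one_apply]

theorem pad_inr (P : Matrix κ κ 𝕜) :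
    pad (Function.Embedding.inr : κ ↪ ν ⊕ κ) P = fromBlocks 1 0 0 P := by
  ext (i | i) (j | j)
  · rw [pad_apply_of_notMem _ _ (Or.inl (by simp))]
    simp [one_apply]
  · rw [pad_apply_of_notMem _ _ (Or.inl (by simp))]
    simp
  · rw [pad_apply_of_notMem _ _ (Or.inr (by simp))]
    simp
  · exact pad_apply (Function.Embedding.inr : κ ↪ ν ⊕ κ) P i j

theorem pad_equiv (e : κ ≃ ι) (P : Matrix κ κ 𝕜) : pad e.toEmbedding P = reindex e e P := by
  ext i j
  obtain ⟨i, rfl⟩ := e.surjective i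
  obtain ⟨j, rfl⟩ := e.surjective j
  rw [reindex_apply, submatrix_apply, e.symm_apply_apply, e.symm_apply_apply]
  exact pad_apply e.toEmbedding P i j

theorem extend_fromBlocks {ι κ ν : Type*} [DecidableEq ι] [Fintype κ] [DecidableEq κ] [Fintype ν]
    [DecidableEq ν] (e : κ ⊕ ν ↪ ι) (X : Matrix κ κ 𝕜) (Y : Matrix ν ν 𝕜) :
    extend e (fromBlocks X 0 0 Y) = extend (Function.Embedding.inl.trans e) X +
      extend (Function.Embedding.inr.trans e) Y := by
  rw [extend_trans, extend_trans, ← map_add]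
  congr 1
  ext (i | i) (j | j)
  · rw [Matrix.add_apply, extend_apply_of_notMem .inr Y (Or.inl (by simp)), add_zero]
    exact (extend_apply .inl X i j).symm
  · rw [Matrix.add_apply, extend_apply_of_notMem .inr Y (Or.inl (by simp)),
      extend_apply_of_notMem .inl X (Or.inr (by simp)), add_zero]
    rfl
  · rw [Matrix.add_apply, extend_apply_of_notMem .inr Y (Or.inr (by simp)),
      extend_apply_of_notMem .inl X (Or.inl (by simp)), add_zero]
    rfl
  · rw [Matrix.add_apply, extend_apply_of_notMem .inl X (Or.inl (by simp)), zero_add]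
    exact (extend_apply .inr Y i j).symm

end ClassicalLieAlgebras

/-! ### Two diagonal blocks -/

section TwoBlocks

open Matrix

variable {𝕜 : Type*} [RCLike 𝕜]

theorem mem_powSpan_odd {κ : Type*} [Fintype κ] [DecidableEq κ] (a : Matrix κ κ 𝕜) (m : ℕ) (r : ℝ) :
    r • a ^ (2 * m + 1) ∈ powSpan a := by
  refine Submodule.smul_mem _ r (Submodule.subset_span ⟨2 * m + 1, 1, ?_, by rw [one_smul]⟩)
  rw [IsSkewCoeff, star_one, mul_one, show 2 * m + 1 + 1 = 2 * (m + 1) by ring, pow_mul]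
  simp

/-- A skew-Hermitian matrix orthogonal to all block-diagonal ones has vanishing diagonal blocks. -/
theorem toBlocks_eq_zero_of_orthogonal {κ₁ κ₂ : Type*} [Fintype κ₁] [DecidableEq κ₁] [Fintype κ₂]
    [DecidableEq κ₂] {M : Matrix (κ₁ ⊕ κ₂) (κ₁ ⊕ κ₂) 𝕜} (hM : Mᴴ = -M)
    (h : ∀ (X₁ : Matrix κ₁ κ₁ 𝕜) (X₂ : Matrix κ₂ κ₂ 𝕜), X₁ᴴ = -X₁ → X₂ᴴ = -X₂ →
      traceForm 𝕜 _ M (fromBlocks X₁ 0 0 X₂) = 0) : M.toBlocks₁₁ = 0 ∧ M.toBlocks₂₂ = 0 := by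
  have h' := hM
  rw [← fromBlocks_toBlocks M, fromBlocks_conjTranspose, fromBlocks_neg, fromBlocks_inj] at h'
  have key (X₁ : Matrix κ₁ κ₁ 𝕜) (X₂ : Matrix κ₂ κ₂ 𝕜) :
      traceForm 𝕜 _ M (fromBlocks X₁ 0 0 X₂) =
        traceForm 𝕜 _ M.toBlocks₁₁ X₁ + traceForm 𝕜 _ M.toBlocks₂₂ X₂ := by
    simp only [traceForm_apply]
    conv_lhs => rw [← fromBlocks_toBlocks M]
    rw [fromBlocks_multiply]
    simp [trace, add_comm]
  constructor
  · by_contra h0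
    have := h M.toBlocks₁₁ 0 h'.1 (by simp)
    rw [key, map_zero, add_zero] at this
    exact (traceForm_self_pos h'.1 h0).ne' this
  · by_contra h0
    have := h 0 M.toBlocks₂₂ (by simp) h'.2.2.2
    rw [key, map_zero, zero_add] at this
    exact (traceForm_self_pos h'.2.2.2 h0).ne' this

variable {k₁ k₂ : ℕ}

/-- The rectangular diagonal matrix with diagonal entries `f 0, f 1, …`. -/
def rectDiagonal (𝕜 : Type*) [RCLike 𝕜] (k₁ k₂ : ℕ) (f : ℕ → ℝ) : Matrix (Fin k₁) (Fin k₂) 𝕜 :=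
  of fun i j => if (i : ℕ) = j then ((f i : ℝ) : 𝕜) else 0

theorem rectDiagonal_apply (f : ℕ → ℝ) (i : Fin k₁) (j : Fin k₂) :
    rectDiagonal 𝕜 k₁ k₂ f i j = if (i : ℕ) = j then ((f i : ℝ) : 𝕜) else 0 := rfl

theorem conjTranspose_rectDiagonal (f : ℕ → ℝ) :
    (rectDiagonal 𝕜 k₁ k₂ f)ᴴ = rectDiagonal 𝕜 k₂ k₁ f := by
  ext i j
  rw [conjTranspose_apply, rectDiagonal_apply, rectDiagonal_apply]
  by_cases h : (i : ℕ) = j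
  · simp [h]
  · simp [h, Ne.symm h]

theorem rectDiagonal_mul_apply {κ : Type*} (f : ℕ → ℝ) (M : Matrix (Fin k₂) κ 𝕜) (i : Fin k₁)
    (j : κ) : (rectDiagonal 𝕜 k₁ k₂ f * M) i j =
      if h : (i : ℕ) < k₂ then (f i : 𝕜) * M ⟨i, h⟩ j else 0 := by
  rw [mul_apply]
  by_cases h : (i : ℕ) < k₂
  · rw [dif_pos h, Finset.sum_eq_single ⟨i, h⟩]
    · rw [rectDiagonal_apply, if_pos rfl]
    · intro l _ hl
      rw [rectDiagonal_apply, if_neg fun h' => hl (Fin.ext h'.symm), zero_mul]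
    · simp
  · rw [dif_neg h]
    refine Finset.sum_eq_zero fun l _ => ?_
    rw [rectDiagonal_apply, if_neg fun h' => h (h'.trans_lt l.2), zero_mul]

theorem mul_rectDiagonal_apply {κ : Type*} (f : ℕ → ℝ) (M : Matrix κ (Fin k₁) 𝕜) (i : κ)
    (j : Fin k₂) : (M * rectDiagonal 𝕜 k₁ k₂ f) i j =
      if h : (j : ℕ) < k₁ then M i ⟨j, h⟩ * (f j : 𝕜) else 0 := by
  rw [mul_apply]
  by_cases h : (j : ℕ) < k₁
  · rw [dif_pos h, Finset.sum_eq_single ⟨j, h⟩]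
    · rw [rectDiagonal_apply, if_pos rfl]
    · intro l _ hl
      rw [rectDiagonal_apply, if_neg fun h' => hl (Fin.ext h'), mul_zero]
    · simp
  · rw [dif_neg h]
    refine Finset.sum_eq_zero fun l _ => ?_
    rw [rectDiagonal_apply, if_neg fun h' => h (h'.symm.trans_lt l.2), mul_zero]

theorem rectDiagonal_mul_mul (f g h : ℕ → ℝ) :
    rectDiagonal 𝕜 k₁ k₂ f * rectDiagonal 𝕜 k₂ k₁ g * rectDiagonal 𝕜 k₁ k₂ h =
      rectDiagonal 𝕜 k₁ k₂ (f * g * h) := by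
  ext i j
  rw [Matrix.mul_assoc, rectDiagonal_mul_apply]
  simp only [rectDiagonal_mul_apply, dif_pos i.2, Fin.eta, rectDiagonal_apply]
  by_cases hij : (i : ℕ) = j
  · rw [if_pos hij, if_pos hij, dif_pos (hij ▸ j.2), Pi.mul_apply, Pi.mul_apply, RCLike.ofReal_mul,
      RCLike.ofReal_mul, mul_assoc]
  · simp [hij]

/-- The skew-Hermitian matrix with off-diagonal blocks `Y` and `-Yᴴ`, for a rectangular diagonal
matrix `Y`. -/
noncomputable def offDiagonal (𝕜 : Type*) [RCLike 𝕜] (k₁ k₂ : ℕ) :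
    (ℕ → ℝ) →ₗ[ℝ] Matrix (Fin k₁ ⊕ Fin k₂) (Fin k₁ ⊕ Fin k₂) 𝕜 where
  toFun f := fromBlocks 0 (rectDiagonal 𝕜 k₁ k₂ f) (-rectDiagonal 𝕜 k₂ k₁ f) 0
  map_add' f g := by
    ext (i | i) (j | j) <;> simp [rectDiagonal]
    all_goals split_ifs <;> simp [add_comm]
  map_smul' r f := by
    ext (i | i) (j | j) <;> simp [rectDiagonal]

theorem offDiagonal_def (f : ℕ → ℝ) : offDiagonal 𝕜 k₁ k₂ f =
    fromBlocks 0 (rectDiagonal 𝕜 k₁ k₂ f) (-rectDiagonal 𝕜 k₂ k₁ f) 0 := rfl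

theorem conjTranspose_offDiagonal (f : ℕ → ℝ) :
    (offDiagonal 𝕜 k₁ k₂ f)ᴴ = -offDiagonal 𝕜 k₁ k₂ f := by
  rw [offDiagonal_def, fromBlocks_conjTranspose, fromBlocks_neg, conjTranspose_neg,
    conjTranspose_rectDiagonal, conjTranspose_rectDiagonal, conjTranspose_zero, conjTranspose_zero,
    neg_zero, neg_zero, neg_neg]

theorem offDiagonal_mul_mul (d f : ℕ → ℝ) :
    offDiagonal 𝕜 k₁ k₂ d * offDiagonal 𝕜 k₁ k₂ d * offDiagonal 𝕜 k₁ k₂ f =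
      offDiagonal 𝕜 k₁ k₂ (-(d * d * f)) := by
  rw [map_neg]
  simp only [offDiagonal_def, fromBlocks_multiply, fromBlocks_neg]
  simp [rectDiagonal_mul_mul]

theorem offDiagonal_pow (d : ℕ → ℝ) (m : ℕ) :
    offDiagonal 𝕜 k₁ k₂ d ^ (2 * m + 1) =
      offDiagonal 𝕜 k₁ k₂ fun i => (-(d i * d i)) ^ m * d i := by
  induction m with
  | zero => simp
  | succ m ih =>
    rw [show 2 * (m + 1) + 1 = 2 + (2 * m + 1) by ring, pow_add, ih, sq, offDiagonal_mul_mul]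
    congr 1
    ext i
    simp only [Pi.neg_apply, Pi.mul_apply]
    ring

/-- The diagonal matrices `Y` are obtained from a fixed one by odd polynomials. -/
theorem offDiagonal_mem_powSpan (d f : ℕ → ℝ) (hd : ∀ i j, d i * d i = d j * d j → i = j)
    (hd0 : ∀ i, d i ≠ 0) : offDiagonal 𝕜 k₁ k₂ f ∈ powSpan (offDiagonal 𝕜 k₁ k₂ d) := by
  obtain ⟨q, hq⟩ := exists_polynomial_eval_eq (fun i : Fin (max k₁ k₂) => -(d i * d i))
    (fun i => f i / d i) fun i j h => by rw [Fin.ext (hd i j (neg_injective h))]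
  have h1 : offDiagonal 𝕜 k₁ k₂ f = offDiagonal 𝕜 k₁ k₂ (∑ m ∈ Finset.range (q.natDegree + 1),
      q.coeff m • fun i => (-(d i * d i)) ^ m * d i) := by
    have h2 (i : ℕ) (hi : i < max k₁ k₂) : f i = (∑ m ∈ Finset.range (q.natDegree + 1),
        q.coeff m • fun i => (-(d i * d i)) ^ m * d i) i := by
      have := hq ⟨i, hi⟩
      rw [Polynomial.eval_eq_sum_range, eq_div_iff (hd0 i)] at this
      rw [← this, Finset.sum_mul, Finset.sum_apply]
      exact Finset.sum_congr rfl fun m _ => by rw [Pi.smul_apply, smul_eq_mul, mul_assoc]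
    rw [offDiagonal_def, offDiagonal_def]
    congr 1
    · ext i j
      rw [rectDiagonal_apply, rectDiagonal_apply, h2 i (i.2.trans_le (le_max_left _ _))]
    · congr 1
      ext i j
      rw [rectDiagonal_apply, rectDiagonal_apply, h2 i (i.2.trans_le (le_max_right _ _))]
  rw [h1, map_sum]
  refine sum_mem fun m _ => ?_
  rw [map_smul, ← offDiagonal_pow]
  exact mem_powSpan_odd _ m _

/-- The rectangular matrices `Z` for which both `Y Zᴴ` and `Yᴴ Z` are Hermitian, where `Y` is
diagonal with nonzero real entries of distinct squares, are real and diagonal. -/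
theorem exists_eq_rectDiagonal {d : ℕ → ℝ} (hd : ∀ i j, d i * d i = d j * d j → i = j)
    (hd0 : ∀ i, d i ≠ 0) {Z : Matrix (Fin k₁) (Fin k₂) 𝕜}
    (h₁ : rectDiagonal 𝕜 k₁ k₂ d * Zᴴ = Z * rectDiagonal 𝕜 k₂ k₁ d)
    (h₂ : rectDiagonal 𝕜 k₂ k₁ d * Z = Zᴴ * rectDiagonal 𝕜 k₁ k₂ d) :
    ∃ f : ℕ → ℝ, Z = rectDiagonal 𝕜 k₁ k₂ f := by
  have hd0' (i : ℕ) : (d i : 𝕜) ≠ 0 := RCLike.ofReal_ne_zero.2 (hd0 i)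
  -- the entries, extended by zero
  let z (i j : ℕ) : 𝕜 := if h : i < k₁ ∧ j < k₂ then Z ⟨i, h.1⟩ ⟨j, h.2⟩ else 0
  have hz (i : Fin k₁) (j : Fin k₂) : z i j = Z i j := by simp [z]
  have e₁ (i j : ℕ) (hi : i < k₁) (hj : j < k₁) : (d i : 𝕜) * star (z j i) = z i j * d j := by
    have := congrFun (congrFun h₁ ⟨i, hi⟩) ⟨j, hj⟩
    rw [rectDiagonal_mul_apply, mul_rectDiagonal_apply] at this
    refine Eq.trans ?_ (this.trans ?_)
    · by_cases h : i < k₂ <;> simp [z, hj, h]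
    · by_cases h : j < k₂ <;> simp [z, hi, h]
  have e₂ (i j : ℕ) (hi : i < k₂) (hj : j < k₂) : (d i : 𝕜) * z i j = star (z j i) * d j := by
    have := congrFun (congrFun h₂ ⟨i, hi⟩) ⟨j, hj⟩
    rw [rectDiagonal_mul_apply, mul_rectDiagonal_apply] at this
    refine Eq.trans ?_ (this.trans ?_)
    · by_cases h : i < k₁ <;> simp [z, hj, h]
    · by_cases h : j < k₁ <;> simp [z, hi, h]
  have hoff (i j : ℕ) (hi : i < k₁) (hj : j < k₂) (hij : i ≠ j) : z i j = 0 := by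
    by_cases hj1 : j < k₁
    · by_cases hi2 : i < k₂
      · have h3 : ((d i : 𝕜) * d i - d j * d j) * z i j = 0 := by
          linear_combination d i * e₂ i j hi2 hj + d j * e₁ i j hi hj1
        refine (mul_eq_zero.1 h3).resolve_left fun h => hij (hd i j ?_)
        exact_mod_cast sub_eq_zero.1 h
      · have h3 : z j i = 0 := by simp [z, hi2]
        have h4 := e₁ i j hi hj1
        rw [h3, star_zero, mul_zero, eq_comm] at h4
        exact (mul_eq_zero.1 h4).resolve_right (hd0' j)
    · have hi2 : i < k₂ := by omega
      have h3 : z j i = 0 := by simp [z, hj1]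
      have h4 := e₂ i j hi2 hj
      rw [h3, star_zero, zero_mul] at h4
      exact (mul_eq_zero.1 h4).resolve_left (hd0' i)
  refine ⟨fun i => RCLike.re (z i i), ?_⟩
  ext i j
  rw [rectDiagonal_apply, ← hz]
  split_ifs with hij
  · have h5 := e₁ i i i.2 i.2
    rw [mul_comm] at h5
    have h6 := mul_right_cancel₀ (hd0' i) h5
    rw [← hij]
    exact (RCLike.conj_eq_iff_re.1 h6).symm
  · exact hoff i j i.2 j.2 hij

/-- The start of the chain for two diagonal blocks: at an off-diagonal matrix with distinct singular
values, every matrix orthogonal to the block-diagonal ones for the skew form is block-diagonal up to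
combinations of powers. -/
theorem exists_sub_mem_powSpan_of_orthogonal {d : ℕ → ℝ}
    (hd : ∀ i j, d i * d i = d j * d j → i = j) (hd0 : ∀ i, d i ≠ 0)
    {ξ : Matrix (Fin k₁ ⊕ Fin k₂) (Fin k₁ ⊕ Fin k₂) 𝕜} (hξ : ξᴴ = -ξ)
    (h : ∀ (X₁ : Mat k₁ 𝕜) (X₂ : Mat k₂ 𝕜), X₁ᴴ = -X₁ → X₂ᴴ = -X₂ →
      traceForm 𝕜 _ (offDiagonal 𝕜 k₁ k₂ d) ⁅ξ, fromBlocks X₁ 0 0 X₂⁆ = 0) :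
    ∃ (X₁ : Mat k₁ 𝕜) (X₂ : Mat k₂ 𝕜), X₁ᴴ = -X₁ ∧ X₂ᴴ = -X₂ ∧
      ξ - fromBlocks X₁ 0 0 X₂ ∈ powSpan (offDiagonal 𝕜 k₁ k₂ d) := by
  set a := offDiagonal 𝕜 k₁ k₂ d with ha
  have hM : ⁅a, ξ⁆ᴴ = -⁅a, ξ⁆ := (lie_mem_skewOn
    (mem_skewOn_univ.2 (conjTranspose_offDiagonal d)) (mem_skewOn_univ.2 hξ)).1
  obtain ⟨b₁, b₂⟩ := toBlocks_eq_zero_of_orthogonal hM fun X₁ X₂ hX₁ hX₂ => by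
    rw [← traceForm_lie]
    exact h X₁ X₂ hX₁ hX₂
  have hξ' := hξ
  rw [← fromBlocks_toBlocks ξ, fromBlocks_conjTranspose, fromBlocks_neg, fromBlocks_inj] at hξ'
  obtain ⟨s₁₁, s₂₁, s₁₂, s₂₂⟩ := hξ'
  set Z := ξ.toBlocks₁₂ with hZ
  have hZ' : ξ.toBlocks₂₁ = -Zᴴ := by rw [s₁₂, neg_neg]
  have hfb : ξ = fromBlocks ξ.toBlocks₁₁ Z (-Zᴴ) ξ.toBlocks₂₂ := by
    rw [← hZ', fromBlocks_toBlocks]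
  have hc : ⁅a, ξ⁆ = fromBlocks
      (rectDiagonal 𝕜 k₁ k₂ d * -Zᴴ - Z * -rectDiagonal 𝕜 k₂ k₁ d)
      (rectDiagonal 𝕜 k₁ k₂ d * ξ.toBlocks₂₂ - ξ.toBlocks₁₁ * rectDiagonal 𝕜 k₁ k₂ d)
      (-rectDiagonal 𝕜 k₂ k₁ d * ξ.toBlocks₁₁ - ξ.toBlocks₂₂ * -rectDiagonal 𝕜 k₂ k₁ d)
      (-rectDiagonal 𝕜 k₂ k₁ d * Z - -Zᴴ * rectDiagonal 𝕜 k₁ k₂ d) := by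
    conv_lhs => rw [hfb]
    rw [Ring.lie_def, ha, offDiagonal_def, fromBlocks_multiply, fromBlocks_multiply,
      sub_eq_add_neg, fromBlocks_neg, fromBlocks_add]
    simp only [Matrix.zero_mul, Matrix.mul_zero, zero_add, add_zero, sub_eq_add_neg]
  rw [hc, toBlocks_fromBlocks₁₁] at b₁
  rw [hc, toBlocks_fromBlocks₂₂] at b₂
  obtain ⟨f, hf⟩ := exists_eq_rectDiagonal (Z := Z) hd hd0
    (by rwa [Matrix.mul_neg, Matrix.mul_neg, sub_neg_eq_add, neg_add_eq_zero] at b₁)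
    (by rwa [Matrix.neg_mul, Matrix.neg_mul, sub_neg_eq_add, neg_add_eq_zero] at b₂)
  refine ⟨ξ.toBlocks₁₁, ξ.toBlocks₂₂, s₁₁, s₂₂, ?_⟩
  have hoff : ξ - fromBlocks ξ.toBlocks₁₁ 0 0 ξ.toBlocks₂₂ = offDiagonal 𝕜 k₁ k₂ f := by
    conv_lhs => enter [1]; rw [hfb]
    rw [sub_eq_add_neg, fromBlocks_neg, fromBlocks_add, offDiagonal_def, hf,
      conjTranspose_rectDiagonal]
    simp
  rw [hoff]
  exact offDiagonal_mem_powSpan d f hd hd0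

end TwoBlocks

/-! ### Real matrices among the complex ones -/

section RealInComplex

open Matrix

variable {k : ℕ}

/-- The inclusion of the real matrices as a linear map. -/
noncomputable def ofRealMatrix (k : ℕ) : Mat k ℝ →ₗ[ℝ] Mat k ℂ :=
  Complex.ofRealCLM.toLinearMap.mapMatrix

theorem ofRealMatrix_apply (X : Mat k ℝ) (i j : Fin k) : ofRealMatrix k X i j = X i j := rfl

/-- A diagonal matrix with imaginary entries is a polynomial in one with distinct entries. -/
theorem diagonal_mem_powSpan (d s : Fin k → ℝ) (hd : Function.Injective d) :
    diagonal (fun i => Complex.I * s i) ∈ powSpan (diagonal fun i => Complex.I * (d i : ℂ)) := by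
  obtain ⟨q, hq⟩ := exists_polynomial_eval_eq d s fun i j h => by rw [hd h]
  have h1 : diagonal (fun i => Complex.I * (s i : ℂ)) = ∑ m ∈ Finset.range (q.natDegree + 1),
      ((q.coeff m : ℂ) * Complex.I * (-Complex.I) ^ m) •
        (diagonal fun i => Complex.I * (d i : ℂ)) ^ m := by
    have h2 (m : ℕ) : ((q.coeff m : ℂ) * Complex.I * (-Complex.I) ^ m) •
        (diagonal fun i => Complex.I * (d i : ℂ)) ^ m =
        diagonal fun i => Complex.I * ((q.coeff m * d i ^ m : ℝ) : ℂ) := by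
      rw [diagonal_pow, ← diagonal_smul]
      congr 1
      ext i
      rw [Pi.smul_apply, Pi.pow_apply, smul_eq_mul, mul_assoc, ← mul_pow, ← mul_assoc (-Complex.I),
        neg_mul, Complex.I_mul_I, neg_neg, one_mul]
      push_cast
      ring
    simp only [h2]
    ext i j
    rw [Matrix.sum_apply]
    by_cases hij : i = j
    · subst hij
      simp only [diagonal_apply_eq]
      rw [← Finset.mul_sum, ← Complex.ofReal_sum, ← hq i, Polynomial.eval_eq_sum_range]
    · simp [diagonal_apply_ne _ hij]
  rw [h1]
  refine sum_mem fun m _ => Submodule.subset_span ⟨m, _, ?_, rfl⟩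
  have h3 : (Complex.I) ^ m = (-1) ^ m * (-Complex.I) ^ m := by
    rw [← mul_pow]
    simp
  rw [IsSkewCoeff, star_mul', star_mul', star_pow, star_neg, pow_succ]
  simp only [RCLike.star_def, Complex.conj_I, Complex.conj_ofReal, neg_neg]
  rw [h3]
  ring

/-- The start of the chain for the real matrices among the complex ones: at a diagonal matrix with
distinct imaginary entries, every matrix orthogonal to the real ones for the skew form is real up to
combinations of powers. -/
theorem mem_sup_powSpan_of_orthogonal_real {d : Fin k → ℝ} (hd : Function.Injective d)
    {ξ : Mat k ℂ} (hξ : ξᴴ = -ξ)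
    (h : ∀ X : Mat k ℝ, Xᴴ = -X →
      traceForm ℂ _ (diagonal fun i => Complex.I * (d i : ℂ)) ⁅ξ, ofRealMatrix k X⁆ = 0) :
    ξ ∈ (skewOn ℝ Finset.univ).map (ofRealMatrix k) ⊔
      powSpan (diagonal fun i => Complex.I * (d i : ℂ)) := by
  set a : Mat k ℂ := diagonal fun i => Complex.I * (d i : ℂ) with ha
  have hsk (i j : Fin k) : star (ξ j i) = -ξ i j := congrFun (congrFun hξ i) j
  let R : Mat k ℝ := of fun i j => (⁅a, ξ⁆ i j).re
  have hRij (i j : Fin k) : R i j = -((d i - d j) * (ξ i j).im) := by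
    simp only [R, of_apply, Ring.lie_def, Matrix.sub_apply, ha, diagonal_mul, mul_diagonal]
    simp
    ring
  have hR : Rᴴ = -R := by
    ext i j
    have h2 := congrArg Complex.im (hsk i j)
    simp at h2
    rw [conjTranspose_apply, Matrix.neg_apply, star_trivial, hRij, hRij, ← h2]
    ring
  have hR0 : R = 0 := by
    by_contra h0
    have h1 := h R hR
    rw [traceForm_lie] at h1
    refine (traceForm_self_pos hR h0).ne' (Eq.trans ?_ h1)
    rw [traceForm_apply, traceForm_apply]
    simp only [trace, diag_apply, mul_apply, map_sum]
    congr 1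
    refine Finset.sum_congr rfl fun i _ => Finset.sum_congr rfl fun j _ => ?_
    rw [ofRealMatrix_apply]
    simp [R]
  let ρ : Mat k ℝ := of fun i j => (ξ i j).re
  have hρ : ρᴴ = -ρ := by
    ext i j
    have h2 := congrArg Complex.re (hsk i j)
    simpa [ρ] using h2
  have hdec : ξ = ofRealMatrix k ρ + diagonal fun i => Complex.I * ((ξ i i).im : ℂ) := by
    ext i j
    rw [Matrix.add_apply, ofRealMatrix_apply]
    by_cases hij : i = j
    · subst hij
      rw [diagonal_apply_eq, mul_comm]
      exact (Complex.re_add_im _).symm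
    · have h1 : (d i - d j) * (ξ i j).im = 0 := by
        have := hRij i j
        rw [hR0, Matrix.zero_apply] at this
        linarith
      have h2 : (ξ i j).im = 0 :=
        (mul_eq_zero.1 h1).resolve_left (sub_ne_zero.2 fun h => hij (hd h))
      rw [diagonal_apply_ne _ hij, add_zero]
      exact Complex.ext (by simp [ρ]) (by simp [h2])
  rw [hdec]
  exact add_mem (Submodule.mem_sup_left ⟨ρ, mem_skewOn_univ.2 hρ, rfl⟩)
    (Submodule.mem_sup_right (diagonal_mem_powSpan _ _ hd))

end RealInComplex

/-! ### The block embeddings -/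

section BlockEmbeddings

open Matrix

variable {𝕜 : Type*} [RCLike 𝕜]

/-- The equivalence of index types behind `padHom`. -/
def padEquiv {k n : ℕ} (h : k ≤ n) : Fin k ⊕ Fin (n - k) ≃ Fin n :=
  finSumFinEquiv.trans (finCongr (Nat.add_sub_of_le h))

/-- The inclusion of the first `k` of `n` indices. -/
def padEmb {k n : ℕ} (h : k ≤ n) : Fin k ↪ Fin n :=
  Function.Embedding.inl.trans (padEquiv h).toEmbedding

/-- The inclusion of two consecutive blocks of indices. -/
def sumEmb {k₁ k₂ n : ℕ} (h : k₁ + k₂ ≤ n) : Fin k₁ ⊕ Fin k₂ ↪ Fin n :=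
  finSumFinEquiv.toEmbedding.trans (padEmb h)

theorem padHom_eq_reindex {R : Type*} [CommRing R] {k n : ℕ} (h : k ≤ n) (P : Mat k R) :
    padHom R h P = reindex (padEquiv h) (padEquiv h) (fromBlocks P 0 0 1) := rfl

theorem blockHom_eq_reindex {R : Type*} [CommRing R] {a b : ℕ} (P : Mat a R) (Q : Mat b R) :
    blockHom R a b (P, Q) = reindex finSumFinEquiv finSumFinEquiv (fromBlocks P 0 0 Q) := rfl

theorem det_padHom {R : Type*} [CommRing R] {k n : ℕ} (h : k ≤ n) (P : Mat k R) :
    (padHom R h P).det = P.det := by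
  rw [padHom_eq_reindex, det_reindex_self, det_fromBlocks_zero₂₁, det_one, mul_one]

theorem det_blockHom {R : Type*} [CommRing R] {a b : ℕ} (P : Mat a R) (Q : Mat b R) :
    (blockHom R a b (P, Q)).det = P.det * Q.det := by
  rw [blockHom_eq_reindex, det_reindex_self, det_fromBlocks_zero₂₁]

theorem padHom_eq_pad {k n : ℕ} (h : k ≤ n) (P : Mat k 𝕜) : padHom 𝕜 h P = pad (padEmb h) P := by
  rw [padEmb, pad_trans, pad_inl, pad_equiv, padHom_eq_reindex]

theorem padHom_blockHom {k₁ k₂ n : ℕ} (h : k₁ + k₂ ≤ n) (P : Mat k₁ 𝕜) (Q : Mat k₂ 𝕜) :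
    padHom 𝕜 h (blockHom 𝕜 k₁ k₂ (P, Q)) = pad (sumEmb h) (fromBlocks P 0 0 Q) := by
  rw [padHom_eq_pad, sumEmb, pad_trans, pad_equiv, blockHom_eq_reindex]

theorem coe_mem_of_mem_units {M : Type*} [Monoid M] {S : Submonoid M} {u : Mˣ} (hu : u ∈ S.units) :
    (u : M) ∈ S := ((Submonoid.mem_units_iff _ _).1 hu).1

theorem lieAlg_units_eq_skewOn {n : ℕ} {S : Submonoid (Mat n 𝕜)} (hS : IsSkewExp S) :
    lieAlg S.units = skewOn 𝕜 Finset.univ :=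
  Submodule.ext fun _ => (mem_lieAlg_units_iff hS).trans mem_skewOn_univ.symm

/-- A group that contains the special orthogonal (unitary) groups of two disjoint blocks and consists of
matrices with these two diagonal blocks and diagonal entries elsewhere. -/
theorem isIntegrablePair_of_two_blocks (h𝕜 : HasBordering 𝕜) {n k₁ k₂ : ℕ}
    {SG SH : Submonoid (Mat n 𝕜)} {S₁ : Submonoid (Mat k₁ 𝕜)} {S₂ : Submonoid (Mat k₂ 𝕜)}
    (hSG : IsSkewExp SG) (hS₁ : IsSkewExp S₁) (hS₂ : IsSkewExp S₂)
    (e : Fin k₁ ⊕ Fin k₂ ↪ Fin n) (hle : SH ≤ SG)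
    (hout : ∀ u ∈ SH, ∀ i j, i ≠ j → (∀ k, e k ≠ i) → u i j = 0 ∧ u j i = 0)
    (hoff : ∀ u ∈ SH, ∀ i j, u (e (.inl i)) (e (.inr j)) = 0 ∧ u (e (.inr j)) (e (.inl i)) = 0)
    (hp₁ : ∀ P ∈ S₁, pad (Function.Embedding.inl.trans e) P ∈ SH)
    (hp₂ : ∀ P ∈ S₂, pad (Function.Embedding.inr.trans e) P ∈ SH) :
    IsIntegrablePair SG.units SH.units := by
  -- the singular values of the off-diagonal matrix have to be nonzero and distinct
  let d : ℕ → ℝ := fun i => i + 1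
  have hd0 (i : ℕ) : d i ≠ 0 := (Nat.cast_add_one_pos i).ne'
  have hd (i j : ℕ) (h : d i * d i = d j * d j) : i = j := by
    have h1 : d i = d j := by
      rcases mul_self_eq_mul_self_iff.1 h with h | h
      · exact h
      · have h2 : 0 < d i := Nat.cast_add_one_pos i
        have h3 : 0 < d j := Nat.cast_add_one_pos j
        linarith
    exact Nat.cast_injective (add_right_cancel h1)
  let φ : Mat k₁ 𝕜 × Mat k₂ 𝕜 →ₗ[ℝ] Matrix (Fin k₁ ⊕ Fin k₂) (Fin k₁ ⊕ Fin k₂) 𝕜 :=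
    { toFun := fun X => fromBlocks X.1 0 0 X.2
      map_add' := fun X Y => by simp [fromBlocks_add]
      map_smul' := fun r X => by simp [fromBlocks_smul] }
  refine isIntegrablePair_of_block h𝕜 e (Submonoid.units_mono hle) (lieAlg_units_eq_skewOn hSG)
    (fun u hu => hout _ (coe_mem_of_mem_units hu))
    (((skewOn 𝕜 Finset.univ).prod (skewOn 𝕜 Finset.univ)).map φ) ?_
    (conjTranspose_offDiagonal d) (fun η hη => ?_) (fun ξ hξ h => ?_)
  · rintro _ ⟨X, ⟨hX₁, hX₂⟩, rfl⟩
    have h1 : extend (Function.Embedding.inl.trans e) X.1 ∈ lieAlg SH.units :=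
      extend_mem_lieAlg _ fun t => hp₁ _ (hS₁.2 _ (conjTranspose_smul_of_skew hX₁.1 t))
    have h2 : extend (Function.Embedding.inr.trans e) X.2 ∈ lieAlg SH.units :=
      extend_mem_lieAlg _ fun t => hp₂ _ (hS₂.2 _ (conjTranspose_smul_of_skew hX₂.1 t))
    exact (congrArg (· ∈ lieAlg SH.units) (extend_fromBlocks e X.1 X.2)).mpr (add_mem h1 h2)
  · have h1 (i j) : η (e (.inl i)) (e (.inr j)) = 0 := apply_apply_eq_zero_of_mem_lieAlg
      (fun u hu => (hoff _ (coe_mem_of_mem_units hu) i j).1) hη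
    have h2 (i j) : η (e (.inr j)) (e (.inl i)) = 0 := apply_apply_eq_zero_of_mem_lieAlg
      (fun u hu => (hoff _ (coe_mem_of_mem_units hu) i j).2) hη
    have h3 : (restrict e η).toBlocks₁₂ = 0 := by
      ext i j
      exact (restrict_apply e η _ _).trans (h1 i j)
    have h4 : (restrict e η).toBlocks₂₁ = 0 := by
      ext j i
      exact (restrict_apply e η _ _).trans (h2 i j)
    rw [traceForm_apply, ← fromBlocks_toBlocks (restrict e η), h3, h4, offDiagonal_def,
      fromBlocks_multiply]
    simp [trace]
  · obtain ⟨X₁, X₂, hX₁, hX₂, hp⟩ := exists_sub_mem_powSpan_of_orthogonal hd hd0 hξ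
      fun X₁ X₂ hX₁ hX₂ =>
        h _ ⟨(X₁, X₂), ⟨mem_skewOn_univ.2 hX₁, mem_skewOn_univ.2 hX₂⟩, rfl⟩
    rw [← add_sub_cancel (fromBlocks X₁ 0 0 X₂) ξ]
    exact add_mem (Submodule.mem_sup_left
      ⟨(X₁, X₂), ⟨mem_skewOn_univ.2 hX₁, mem_skewOn_univ.2 hX₂⟩, rfl⟩) (Submodule.mem_sup_right hp)

theorem conjTranspose_fromBlocks_mul_eq_one {κ₁ κ₂ : Type*} [Fintype κ₁] [DecidableEq κ₁]
    [Fintype κ₂] [DecidableEq κ₂] {P : Matrix κ₁ κ₁ 𝕜} {Q : Matrix κ₂ κ₂ 𝕜} (hP : Pᴴ * P = 1)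
    (hQ : Qᴴ * Q = 1) : (fromBlocks P 0 0 Q)ᴴ * fromBlocks P 0 0 Q = 1 := by
  rw [fromBlocks_conjTranspose, fromBlocks_multiply]
  simp [hP, hQ]

/-- Completion by an identity block produces no off-diagonal entries outside the block. -/
theorem pad_apply_eq_zero {ι κ : Type*} [Fintype ι] [DecidableEq ι] [Fintype κ] [DecidableEq κ]
    (e : κ ↪ ι) (P : Matrix κ κ 𝕜) {i j : ι} (hij : i ≠ j) (hi : ∀ k, e k ≠ i) :
    pad e P i j = 0 ∧ pad e P j i = 0 := by
  rw [pad_apply_of_notMem e P (Or.inl hi), pad_apply_of_notMem e P (Or.inr hi), one_apply_ne hij,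
    one_apply_ne hij.symm]
  exact ⟨rfl, rfl⟩

theorem isIntegrablePair_SOBlocks {n k₁ k₂ : ℕ} (h : k₁ + k₂ ≤ n) :
    IsIntegrablePair (SO n).units (SOBlocks h).units := by
  have hmem : ∀ u ∈ SOBlocks h, ∃ P ∈ SO k₁, ∃ Q ∈ SO k₂,
      u = pad (sumEmb h) (fromBlocks P 0 0 Q) := by
    rintro _ ⟨_, ⟨⟨P, Q⟩, ⟨hP, hQ⟩, rfl⟩, rfl⟩
    exact ⟨P, hP, Q, hQ, padHom_blockHom h P Q⟩
  have hmem' (P Q) (hP : P ∈ SO k₁) (hQ : Q ∈ SO k₂) :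
      pad (sumEmb h) (fromBlocks P 0 0 Q) ∈ SOBlocks h :=
    ⟨_, ⟨(P, Q), ⟨hP, hQ⟩, rfl⟩, padHom_blockHom h P Q⟩
  refine isIntegrablePair_of_two_blocks hasBordering_real (S₁ := SO k₁) (S₂ := SO k₂)
    isSkewExp_specialOrthogonalGroup isSkewExp_specialOrthogonalGroup
    isSkewExp_specialOrthogonalGroup (sumEmb h) (fun u hu => ?_) (fun u hu i j hij hi => ?_)
    (fun u hu i j => ?_) (fun P hP => ?_) (fun P hP => ?_)
  · obtain ⟨P, hP, Q, hQ, rfl⟩ := hmem u hu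
    rw [mem_specialOrthogonalGroup_iff_conjTranspose] at hP hQ ⊢
    refine ⟨conjTranspose_pad_mul_pad _ (conjTranspose_fromBlocks_mul_eq_one hP.1 hQ.1), ?_⟩
    rw [← padHom_blockHom, det_padHom, det_blockHom, hP.2, hQ.2, mul_one]
  · obtain ⟨P, hP, Q, hQ, rfl⟩ := hmem u hu
    exact pad_apply_eq_zero _ _ hij hi
  · obtain ⟨P, hP, Q, hQ, rfl⟩ := hmem u hu
    rw [pad_apply, pad_apply]
    exact ⟨rfl, rfl⟩
  · rw [pad_trans, pad_inl]
    exact hmem' P 1 hP (one_mem _)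
  · rw [pad_trans, pad_inr]
    exact hmem' 1 P (one_mem _) hP

theorem isIntegrablePair_UBlocks {n k₁ k₂ k₃ : ℕ} (h : k₁ + k₂ + k₃ ≤ n) :
    IsIntegrablePair (U n).units (UBlocks h).units := by
  let F : (Fin k₁ ⊕ Fin k₂) ⊕ Fin k₃ ↪ Fin n :=
    (Equiv.sumCongr finSumFinEquiv (Equiv.refl _)).toEmbedding.trans (sumEmb h)
  have hF (D : Mat k₁ ℂ) (P : Mat k₂ ℂ) (Q : Mat k₃ ℂ) :
      padHom ℂ h (blockHom ℂ (k₁ + k₂) k₃ (blockHom ℂ k₁ k₂ (D, P), Q)) =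
        pad F (fromBlocks (fromBlocks D 0 0 P) 0 0 Q) := by
    rw [padHom_blockHom, pad_trans, pad_equiv, blockHom_eq_reindex]
    congr 1
    ext (i | i) (j | j) <;> simp
  have hmem : ∀ u ∈ UBlocks h, ∃ D ∈ torus k₁, ∃ P ∈ U k₂, ∃ Q ∈ U k₃,
      u = pad F (fromBlocks (fromBlocks D 0 0 P) 0 0 Q) := by
    rintro _ ⟨_, ⟨⟨_, Q⟩, ⟨⟨⟨D, P⟩, ⟨hD, hP⟩, rfl⟩, hQ⟩, rfl⟩, rfl⟩
    exact ⟨D, hD, P, hP, Q, hQ, hF D P Q⟩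
  have hmem' (P Q) (hP : P ∈ U k₂) (hQ : Q ∈ U k₃) :
      pad F (fromBlocks (fromBlocks 1 0 0 P) 0 0 Q) ∈ UBlocks h :=
    ⟨_, ⟨(_, Q), ⟨⟨(1, P), ⟨one_mem _, hP⟩, rfl⟩, hQ⟩, rfl⟩, hF 1 P Q⟩
  have htorus : ∀ D ∈ torus k₁, ∃ d : Fin k₁ → ℂ, D = diagonal d ∧ Dᴴ * D = 1 := by
    rintro _ ⟨d, hd, rfl⟩
    refine ⟨d, rfl, ?_⟩
    change (diagonal d)ᴴ * diagonal d = 1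
    rw [diagonal_conjTranspose, diagonal_mul_diagonal, ← diagonal_one]
    congr 1
    ext i
    exact Unitary.star_mul_self_of_mem (hd i trivial)
  -- the indices of the torus are left out of the first block of the chain
  let e : Fin k₂ ⊕ Fin k₃ ↪ Fin n :=
    (Function.Embedding.sumMap Function.Embedding.inr (Function.Embedding.refl _)).trans F
  refine isIntegrablePair_of_two_blocks hasBordering_complex (S₁ := U k₂) (S₂ := U k₃)
    isSkewExp_unitaryGroup isSkewExp_unitaryGroup isSkewExp_unitaryGroup e (fun u hu => ?_)
    (fun u hu i j hij hi => ?_) (fun u hu i j => ?_) (fun P hP => ?_) (fun P hP => ?_)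
  · obtain ⟨D, hD, P, hP, Q, hQ, rfl⟩ := hmem u hu
    obtain ⟨d, -, hd⟩ := htorus D hD
    exact mem_unitaryGroup_iff'.2 (conjTranspose_pad_mul_pad _ (conjTranspose_fromBlocks_mul_eq_one
      (conjTranspose_fromBlocks_mul_eq_one hd (mem_unitaryGroup_iff'.1 hP))
      (mem_unitaryGroup_iff'.1 hQ)))
  · obtain ⟨D, hD, P, hP, Q, hQ, rfl⟩ := hmem u hu
    obtain ⟨d, rfl, -⟩ := htorus D hD
    by_cases hiF : ∃ x, F x = i
    · obtain ⟨x, rfl⟩ := hiF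
      by_cases hjF : ∃ y, F y = j
      · obtain ⟨y, rfl⟩ := hjF
        rw [pad_apply, pad_apply]
        rcases x with (x | x) | x
        · rcases y with (y | y) | y
          · have hxy : x ≠ y := fun h => hij (by rw [h])
            simp [hxy, hxy.symm]
          · simp
          · simp
        · exact absurd rfl (hi (.inl x))
        · exact absurd rfl (hi (.inr x))
      · exact (pad_apply_eq_zero _ _ hij.symm fun y hy => hjF ⟨y, hy⟩).symm
    · exact pad_apply_eq_zero _ _ hij fun x hx => hiF ⟨x, hx⟩
  · obtain ⟨D, hD, P, hP, Q, hQ, rfl⟩ := hmem u hu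
    exact ⟨pad_apply F _ (.inl (.inr i)) (.inr j), pad_apply F _ (.inr j) (.inl (.inr i))⟩
  · have h1 : Function.Embedding.inl.trans e =
        (Function.Embedding.inr.trans Function.Embedding.inl).trans F := rfl
    rw [h1, pad_trans (Function.Embedding.inr.trans Function.Embedding.inl) F,
      pad_trans Function.Embedding.inr Function.Embedding.inl, pad_inr, pad_inl]
    exact hmem' P 1 hP (one_mem _)
  · have h1 : Function.Embedding.inr.trans e = Function.Embedding.inr.trans F := rfl
    rw [h1, pad_trans, pad_inr, ← fromBlocks_one]
    exact hmem' 1 P (one_mem _) hP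

theorem exp_ofRealMatrix {k : ℕ} (X : Mat k ℝ) :
    NormedSpace.exp (ofRealMatrix k X) = ofRealMatrix k (NormedSpace.exp X) := by
  let _ : NormedRing (Mat k ℝ) := Matrix.linftyOpNormedRing
  let _ : NormedAlgebra ℝ (Mat k ℝ) := Matrix.linftyOpNormedAlgebra
  let _ : NormedRing (Mat k ℂ) := Matrix.linftyOpNormedRing
  let _ : NormedAlgebra ℝ (Mat k ℂ) := Matrix.linftyOpNormedAlgebra
  let _ : NormedAlgebra ℚ (Mat k ℝ) := NormedAlgebra.restrictScalars ℚ ℝ _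
  let _ : NormedAlgebra ℚ (Mat k ℂ) := NormedAlgebra.restrictScalars ℚ ℝ _
  have hc : Continuous (ofRealMatrix k) := LinearMap.continuous_of_finiteDimensional _
  exact (NormedSpace.map_exp (Complex.ofRealHom.mapMatrix : Mat k ℝ →+* Mat k ℂ) hc X).symm

theorem isIntegrablePair_SOinU {n k : ℕ} (h : k ≤ n) :
    IsIntegrablePair (U n).units (SOinU h).units := by
  have hmem : ∀ u ∈ SOinU h, ∃ P ∈ SO k, u = pad (padEmb h) (ofRealMatrix k P) := by
    rintro _ ⟨_, ⟨P, hP, rfl⟩, rfl⟩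
    exact ⟨P, hP, padHom_eq_pad h _⟩
  have hmem' (P) (hP : P ∈ SO k) : pad (padEmb h) (ofRealMatrix k P) ∈ SOinU h :=
    ⟨_, ⟨P, hP, rfl⟩, padHom_eq_pad h _⟩
  have hle : SOinU h ≤ U n := fun u hu => by
    obtain ⟨P, hP, rfl⟩ := hmem u hu
    have h1 := (mem_specialOrthogonalGroup_iff_conjTranspose.1 hP).1
    refine mem_unitaryGroup_iff'.2 (conjTranspose_pad_mul_pad _ ?_)
    have h2 : (ofRealMatrix k P)ᴴ = complexify k Pᴴ := by
      ext i j
      exact Complex.conj_ofReal _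
    rw [h2, ← map_one (complexify k), ← h1, map_mul]
    rfl
  let d : Fin k → ℝ := fun i => (i : ℕ)
  have hd : Function.Injective d := fun i j h => Fin.ext (Nat.cast_injective h)
  refine isIntegrablePair_of_block hasBordering_complex (padEmb h) (Submonoid.units_mono hle)
    (lieAlg_units_eq_skewOn isSkewExp_unitaryGroup) (fun u hu i j hij hi => ?_)
    ((skewOn ℝ Finset.univ).map (ofRealMatrix k)) ?_
    (a := diagonal fun i => Complex.I * (d i : ℂ)) ?_ (fun η hη => ?_) (fun ξ hξ hX => ?_)
  · obtain ⟨P, hP, hu⟩ := hmem u (coe_mem_of_mem_units hu)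
    rw [hu]
    exact pad_apply_eq_zero _ _ hij hi
  · rintro _ ⟨X, hX, rfl⟩
    refine extend_mem_lieAlg _ fun t => ?_
    rw [← map_smul, exp_ofRealMatrix]
    exact hmem' _ (isSkewExp_specialOrthogonalGroup.2 _ (conjTranspose_smul_of_skew hX.1 t))
  · rw [diagonal_conjTranspose, diagonal_neg]
    congr 1
    ext i
    simp
  · have him (i : Fin k) : (η (padEmb h i) (padEmb h i)).im = 0 := by
      refine map_apply_eq_zero_of_mem_lieAlg (RCLike.imLm : ℂ →ₗ[ℝ] ℝ) (fun u hu => ?_) hη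
      obtain ⟨P, hP, hu⟩ := hmem u (coe_mem_of_mem_units hu)
      have h1 : (u : Mat n ℂ) (padEmb h i) (padEmb h i) = P i i := by
        rw [hu, pad_apply, ofRealMatrix_apply]
      change ((u : Mat n ℂ) (padEmb h i) (padEmb h i)).im = 0
      rw [h1, Complex.ofReal_im]
    rw [traceForm_apply, trace, map_sum]
    refine neg_eq_zero.2 (Finset.sum_eq_zero fun i _ => ?_)
    rw [diag_apply, diagonal_mul, restrict_apply]
    simp [him]
  · exact mem_sup_powSpan_of_orthogonal_real hd hξ fun X hX' =>
      hX _ ⟨X, mem_skewOn_univ.2 hX', rfl⟩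

/-- The diagonal embedding of a special orthogonal (unitary) group in a product of two such
groups. -/
theorem isIntegrablePair_map_diagHom (h𝕜 : HasBordering 𝕜) {n₁ n₂ k : ℕ} (h₁ : k ≤ n₁)
    (h₂ : k ≤ n₂)
    {S₁ : Submonoid (Mat n₁ 𝕜)} {S₂ : Submonoid (Mat n₂ 𝕜)} {S : Submonoid (Mat k 𝕜)}
    (hS₁ : IsSkewExp S₁) (hS₂ : IsSkewExp S₂) (hS : IsSkewExp S)
    (hle : ∀ P ∈ S, padHom 𝕜 h₁ P ∈ S₁ ∧ padHom 𝕜 h₂ P ∈ S₂) :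
    IsIntegrablePair (S₁.prod S₂).units (S.map (diagHom 𝕜 h₁ h₂)).units := by
  have hmem : ∀ u ∈ S.map (diagHom 𝕜 h₁ h₂), ∃ P ∈ S,
      u = (pad (padEmb h₁) P, pad (padEmb h₂) P) := by
    rintro _ ⟨P, hP, rfl⟩
    exact ⟨P, hP, Prod.ext (padHom_eq_pad h₁ P) (padHom_eq_pad h₂ P)⟩
  refine isIntegrablePair_of_diagonal h𝕜 (padEmb h₁) (padEmb h₂) (Submonoid.units_mono ?_)
    (fun x => mem_lieAlg_prod_units_iff hS₁ hS₂) (fun u hu i j hij hi => ?_)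
    (fun u hu i j hij hi => ?_) (fun u hu => ?_) (fun X hX => ?_)
  · rintro _ ⟨P, hP, rfl⟩
    exact hle P hP
  · obtain ⟨P, hP, hu⟩ := hmem u (coe_mem_of_mem_units hu)
    rw [hu]
    exact pad_apply_eq_zero _ _ hij hi
  · obtain ⟨P, hP, hu⟩ := hmem u (coe_mem_of_mem_units hu)
    rw [hu]
    exact pad_apply_eq_zero _ _ hij hi
  · obtain ⟨P, hP, hu⟩ := hmem u (coe_mem_of_mem_units hu)
    rw [hu]
    ext i j
    rw [restrict_apply, restrict_apply]
    exact (pad_apply (padEmb h₁) P i j).trans (pad_apply (padEmb h₂) P i j).symm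
  · refine prod_extend_mem_lieAlg _ _ fun t => ?_
    exact ⟨_, hS.2 _ (conjTranspose_smul_of_skew hX t),
      Prod.ext (padHom_eq_pad h₁ _) (padHom_eq_pad h₂ _)⟩

theorem padHom_mem_SO {k n : ℕ} (h : k ≤ n) {P : Mat k ℝ} (hP : P ∈ SO k) :
    padHom ℝ h P ∈ SO n := by
  rw [mem_specialOrthogonalGroup_iff_conjTranspose] at hP ⊢
  refine ⟨?_, by rw [det_padHom, hP.2]⟩
  rw [padHom_eq_pad]
  exact conjTranspose_pad_mul_pad _ hP.1

theorem padHom_mem_U {k n : ℕ} (h : k ≤ n) {P : Mat k ℂ} (hP : P ∈ U k) : padHom ℂ h P ∈ U n := by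
  rw [padHom_eq_pad]
  exact mem_unitaryGroup_iff'.2 (conjTranspose_pad_mul_pad _ (mem_unitaryGroup_iff'.1 hP))

end BlockEmbeddings

end IntegrablePairs

theorem mainTheorem5 :
    (∀ (n k₁ k₂ : ℕ) (h : k₁ + k₂ ≤ n),
      IntegrablePairs.IsIntegrablePair (IntegrablePairs.SO n).units
        (IntegrablePairs.SOBlocks h).units) ∧
    (∀ (n k₁ k₂ k₃ : ℕ) (h : k₁ + k₂ + k₃ ≤ n),
      IntegrablePairs.IsIntegrablePair (IntegrablePairs.U n).units
        (IntegrablePairs.UBlocks h).units) ∧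
    (∀ (n k : ℕ) (h : k ≤ n),
      IntegrablePairs.IsIntegrablePair (IntegrablePairs.U n).units
        (IntegrablePairs.SOinU h).units) ∧
    (∀ (n₁ n₂ k : ℕ) (h₁ : k ≤ n₁) (h₂ : k ≤ n₂),
      IntegrablePairs.IsIntegrablePair
        ((IntegrablePairs.SO n₁).prod (IntegrablePairs.SO n₂)).units
        ((IntegrablePairs.SO k).map (IntegrablePairs.diagHom ℝ h₁ h₂)).units) ∧
    (∀ (n₁ n₂ k : ℕ) (h₁ : k ≤ n₁) (h₂ : k ≤ n₂),
      IntegrablePairs.IsIntegrablePair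
        ((IntegrablePairs.U n₁).prod (IntegrablePairs.U n₂)).units
        ((IntegrablePairs.U k).map (IntegrablePairs.diagHom ℂ h₁ h₂)).units) := by
  open IntegrablePairs in
  exact ⟨fun n k₁ k₂ h => isIntegrablePair_SOBlocks h,
    fun n k₁ k₂ k₃ h => isIntegrablePair_UBlocks h,
    fun n k h => isIntegrablePair_SOinU h,
    fun n₁ n₂ k h₁ h₂ => isIntegrablePair_map_diagHom hasBordering_real h₁ h₂
      isSkewExp_specialOrthogonalGroup isSkewExp_specialOrthogonalGroup
      isSkewExp_specialOrthogonalGroup fun P hP => ⟨padHom_mem_SO h₁ hP, padHom_mem_SO h₂ hP⟩,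
    fun n₁ n₂ k h₁ h₂ => isIntegrablePair_map_diagHom hasBordering_complex h₁ h₂
      isSkewExp_unitaryGroup isSkewExp_unitaryGroup isSkewExp_unitaryGroup
      fun P hP => ⟨padHom_mem_U h₁ hP, padHom_mem_U h₂ hP⟩⟩
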